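/- Let $k$ be a commutative ring with $\mathbb{Q}\subseteq k$, let $A$ be an associative unital $k$-algebra, $K\subseteq A$ a $k$-subalgebra, and let $(E,p,i)$ be a cleft extension of $A$, i.e. a $k$-algebra $E$ with $k$-algebra maps $p\colon E\to A$, $i\colon A\to E$ such that $p\circ i=\mathrm{id}_A$. Regard $A$ and $K$ as subalgebras of $E$ through $i$ and put $M:=\ker p$, so that $E=A\oplus M$. Write $m\triangledown m'$ for the product of $m,m'\in M$, and set $x\triangledown y:=0$ if $x\in A$ or $y\in A$; write $x\cdot y$ for the product of $E$, changed so that $m\cdot m'=0$ for $m,m'\in M$ (both extended bilinearly to $E$). Put $\bar E:=E/K$, $\bar A:=A/K$, let $\otimes=\otimes_K$, and for a $K$-bimodule $V$ let $V\otimes:=V/[V,K]$. The relative cyclic homology $HC^K_*(E,M)$ is the cyclic homology of the mixed complex $\ker\big((E\otimes\bar E^{\otimes *}\otimes,b,B)\to(A\otimes\bar A^{\otimes *}\otimes,b,B)\big)$, the kernel of the map induced by $p$ between the normalized mixed complexes of the $K$-algebras $E$ and $A$. For $v,w\ge 0$ and $n=v+w$, let $X_{vw}\subseteq E\otimes\bar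 E^{\otimes n}\otimes$ be the $k$-submodule spanned by the classes of the tensors $x_0\otimes\cdots\otimes x_n$ with $x_0\in M$, exactly $w$ of $x_1,\dots,x_n$ in $M$ and the other ones in $A$; let $X_{vw}=0$ otherwise. Define $k$-linear maps $b\colon X_{vw}\to X_{v-1,w}$, $d',d\colon X_{vw}\to X_{v,w-1}$ and $t,N\colon X_{vw}\to X_{vw}$ on such tensors by $$b(x_0\otimes\cdots\otimes x_n)=\sum_{j=0}^{n-1}(-1)^jx_0\otimes\cdots\otimes x_j\cdot x_{j+1}\otimes\cdots\otimes x_n+(-1)^n x_n\cdot x_0\otimes x_1\otimes\cdots\otimes x_{n-1},$$ $$d'(x_0\otimes\cdots\otimes x_n)=\sum_{j=0}^{n-1}(-1)^jx_0\otimes\cdots\otimes x_j\triangledown x_{j+1}\otimes\cdots\otimes x_n,$$ $$d(x_0\otimes\cdots\otimes x_n)=d'(x_0\otimes\cdots\otimes x_n)+(-1)^n x_n\triangledown x_0\otimes x_1\otimes\cdots\otimes x_{n-1},$$ $$t(x_0\otimes\cdots\otimes x_n)=(-1)^{in}x_i\otimes\cdots\otimes x_n\otimes x_0\otimes\cdots\otimes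 x_{i-1},$$ where $i$ is the last index with $x_i\in M$, and $N=\sum_{l=0}^{w}t^l$ (with $b=0$ if $v=0$ and $d=d'=0$ if $w=0$). Then: 1. The above kernel is a mixed complex, and $(X,b,d)$ and $(X,-b,-d')$ are double complexes. 2. The rows $\cdots\to X_{vw}\xrightarrow{\;1-t\;}X_{vw}\xrightarrow{\;N\;}X_{vw}\xrightarrow{\;1-t\;}X_{vw}\to\cdots$ are contractible complexes: with $\sigma=\frac1{w+1}\mathrm{id}$ and $\sigma'=\sum_{j=0}^{w-1}\frac{w-j}{w+1}t^j$ one has $(1-t)N=N(1-t)=0$, $N\sigma+\sigma'(1-t)=\mathrm{id}$ and $(1-t)\sigma'+\sigma N=\mathrm{id}$. 3. $b(1-t)=(1-t)b$ and $d(1-t)=(1-t)d'$. Hence $b$ and $d$ induce maps $\bar b$, $\bar d$ on the cokernels $\bar X_{vw}$ of $1-t\colon X_{vw}\to X_{vw}$; that is, $(\bar X,\bar b,\bar d)$ is the cokernel of $1-t$ from $(X,-b,-d')$ to $(X,b,d)$. It is a double complex, and for every $n\ge 0$ there is an isomorphism of $k$-modules $$HC^K_n(E,M)\;\cong\;H_n\big(\mathrm{Tot}(\bar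 X,\bar b,\bar d)\big).$$ -/

import Mathlib

open scoped TensorProduct

noncomputable section

namespace CleftHC

/-! ### Complexes, mixed complexes, double complexes -/

section Complexes

variable {k : Type*} [CommRing k]

/-- The cycles of a complex `⋯ → C₁ → C₀ → 0`. -/
def cycles (C : ℕ → Type*) [∀ n, AddCommGroup (C n)] [∀ n, Module k (C n)]
    (D : ∀ n, C (n + 1) →ₗ[k] C n) : ∀ n, Submodule k (C n)
  | 0 => ⊤
  | n + 1 => LinearMap.ker (D n)

/-- The homology of a complex `⋯ → C₁ → C₀ → 0` in degree `n`. -/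
abbrev Homology (C : ℕ → Type*) [∀ n, AddCommGroup (C n)] [∀ n, Module k (C n)]
    (D : ∀ n, C (n + 1) →ₗ[k] C n) (n : ℕ) :=
  cycles C D n ⧸ (LinearMap.range (D n)).submoduleOf (cycles C D n)

/-- `(C, b, B)` is a mixed complex. -/
structure IsMixedComplex (C : ℕ → Type*) [∀ n, AddCommGroup (C n)] [∀ n, Module k (C n)]
    (b : ∀ n, C (n + 1) →ₗ[k] C n) (B : ∀ n, C n →ₗ[k] C (n + 1)) : Prop where
  b_b : ∀ n, b n ∘ₗ b (n + 1) = 0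
  B_B : ∀ n, B (n + 1) ∘ₗ B n = 0
  b_B_zero : b 0 ∘ₗ B 0 = 0
  b_B : ∀ n, b (n + 1) ∘ₗ B (n + 1) + B n ∘ₗ b n = 0

/-- The degree `n` part `Cₙ ⊕ Cₙ₋₂ ⊕ Cₙ₋₄ ⊕ ⋯` of the total complex of the double complex `BC` of a
mixed complex. -/
abbrev TotBC (C : ℕ → Type*) (n : ℕ) := ∀ q : {q : ℕ × ℕ // q.1 + 2 * q.2 = n}, C q.1.1

/-- The component of an element of `TotBC C n` in the `j`-th summand `C m`, `m = n - 2 j`. -/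
def componentBC (C : ℕ → Type*) [∀ n, AddCommGroup (C n)] [∀ n, Module k (C n)] (n m j : ℕ)
    (h : m + 2 * j = n) : TotBC C n →ₗ[k] C m where
  toFun f := f ⟨(m, j), h⟩
  map_add' _ _ := rfl
  map_smul' _ _ := rfl

/-- The boundary `b + B` of the total complex of the double complex `BC` of a mixed complex. -/
def totBC (C : ℕ → Type*) [∀ n, AddCommGroup (C n)] [∀ n, Module k (C n)]
    (b : ∀ n, C (n + 1) →ₗ[k] C n) (B : ∀ n, C n →ₗ[k] C (n + 1)) (n : ℕ) :
    TotBC C (n + 1) →ₗ[k] TotBC C n :=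
  LinearMap.pi fun q => match q with
    | ⟨(0, j), h⟩ => b 0 ∘ₗ componentBC C (n + 1) 1 j (by simp only at h; omega)
    | ⟨(m + 1, j), h⟩ =>
        b (m + 1) ∘ₗ componentBC C (n + 1) (m + 2) j (by simp only at h; omega) +
          B m ∘ₗ componentBC C (n + 1) m (j + 1) (by simp only at h; omega)

/-- The cyclic homology of the mixed complex `(C, b, B)`. -/
abbrev CyclicHomology (C : ℕ → Type*) [∀ n, AddCommGroup (C n)] [∀ n, Module k (C n)]
    (b : ∀ n, C (n + 1) →ₗ[k] C n) (B : ∀ n, C n →ₗ[k] C (n + 1)) (n : ℕ) :=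
  Homology (TotBC C) (totBC C b B) n

/-- `(Y, b, d)` is a double complex. The module `Y n w` has the bidegree `(v, w)` with `n = v + w`,
so that `b` lowers `v` and `d` lowers `w`. -/
structure IsDoubleComplex (Y : ℕ → ℕ → Type*) [∀ n w, AddCommGroup (Y n w)]
    [∀ n w, Module k (Y n w)] (b : ∀ n w, Y (n + 1) w →ₗ[k] Y n w)
    (d : ∀ n w, Y (n + 1) (w + 1) →ₗ[k] Y n w) : Prop where
  b_b : ∀ n w, b n w ∘ₗ b (n + 1) w = 0
  d_d : ∀ n w, d n w ∘ₗ d (n + 1) (w + 1) = 0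
  b_d : ∀ n w, b n w ∘ₗ d (n + 1) w + d n w ∘ₗ b (n + 1) (w + 1) = 0

/-- The degree `n` part `∏_w Y n w` of the total complex of a double complex. -/
abbrev Tot (Y : ℕ → ℕ → Type*) (n : ℕ) := ∀ w, Y n w

/-- The boundary `b + d` of the total complex of a double complex. -/
def tot (Y : ℕ → ℕ → Type*) [∀ n w, AddCommGroup (Y n w)] [∀ n w, Module k (Y n w)]
    (b : ∀ n w, Y (n + 1) w →ₗ[k] Y n w) (d : ∀ n w, Y (n + 1) (w + 1) →ₗ[k] Y n w) (n : ℕ) :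
    Tot Y (n + 1) →ₗ[k] Tot Y n :=
  LinearMap.pi fun w => b n w ∘ₗ LinearMap.proj w + d n w ∘ₗ LinearMap.proj (w + 1)

/-- The cokernel of a linear map. -/
def Coker {V W : Type*} [AddCommGroup V] [Module k V] [AddCommGroup W] [Module k W]
    (f : V →ₗ[k] W) : Type _ :=
  W ⧸ LinearMap.range f

instance instAddCommGroupCoker {V W : Type*} [AddCommGroup V] [Module k V] [AddCommGroup W]
    [Module k W] (f : V →ₗ[k] W) : AddCommGroup (Coker f) :=
  inferInstanceAs (AddCommGroup (W ⧸ LinearMap.range f))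

instance instModuleCoker {V W : Type*} [AddCommGroup V] [Module k V] [AddCommGroup W]
    [Module k W] (f : V →ₗ[k] W) : Module k (Coker f) :=
  inferInstanceAs (Module k (W ⧸ LinearMap.range f))

/-- The map between the cokernels of `f` and `f'` induced by `v`, if `v ∘ f = f' ∘ u`. -/
def cokerMap {V W V' W' : Type*} [AddCommGroup V] [Module k V] [AddCommGroup W] [Module k W]
    [AddCommGroup V'] [Module k V'] [AddCommGroup W'] [Module k W'] {f : V →ₗ[k] W}
    {f' : V' →ₗ[k] W'} {u : V →ₗ[k] V'} {v : W →ₗ[k] W'} (h : v ∘ₗ f = f' ∘ₗ u) :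
    Coker f →ₗ[k] Coker f' :=
  Submodule.mapQ (LinearMap.range f) (LinearMap.range f') v (by
    rintro _ ⟨x, rfl⟩
    exact ⟨u x, (LinearMap.congr_fun h x).symm⟩)

end Complexes

/-! ### Cyclic tensor products of a `K`-algebra -/

section Chains

variable {k : Type*} [CommRing k] {C : Type*} [Ring C] [Algebra k C]

/-- The `(n+1)`-fold tensor power of `C` over the ground ring `k`. -/
abbrev Ten (k : Type*) [CommRing k] (C : Type*) [Ring C] [Algebra k C] (n : ℕ) :=
  ⨂[k] (_ : Fin (n + 1)), C

/-- The submodule generated by the differences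
`x₀ ⊗ ⋯ ⊗ xᵢ c ⊗ xᵢ₊₁ ⊗ ⋯ ⊗ xₙ - x₀ ⊗ ⋯ ⊗ xᵢ ⊗ c xᵢ₊₁ ⊗ ⋯ ⊗ xₙ` with `c ∈ K`, where the indices are
read cyclically: `n + 1` is `0` in `Fin (n + 1)`. -/
def balanced (K : Subalgebra k C) (n : ℕ) : Submodule k (Ten k C n) :=
  Submodule.span k {z | ∃ (x : Fin (n + 1) → C) (i : Fin (n + 1)) (c : C), c ∈ K ∧
    z = PiTensorProduct.tprod k (Function.update x i (x i * c)) -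
      PiTensorProduct.tprod k (Function.update x (i + 1) (c * x (i + 1)))}

/-- The submodule generated by the simple tensors `x₀ ⊗ ⋯ ⊗ xₙ` with `xᵢ ∈ K` for some `i ≥ 1`. -/
def degenerate (K : Subalgebra k C) (n : ℕ) : Submodule k (Ten k C n) :=
  Submodule.span k {z | ∃ (x : Fin (n + 1) → C) (i : Fin (n + 1)), i ≠ 0 ∧ x i ∈ K ∧
    z = PiTensorProduct.tprod k x}

/-- The relations that hold in `C ⊗_K (C/K) ⊗_K ⋯ ⊗_K (C/K) ⊗_K`. -/
def relations (K : Subalgebra k C) (n : ℕ) : Submodule k (Ten k C n) :=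
  balanced K n ⊔ degenerate K n

/-- The `k`-module `C ⊗ (C/K)^{⊗ n} ⊗` of normalized Hochschild chains of the `K`-algebra `C`
(tensor products over `K`, the last `⊗` being the quotient by the commutators with `K`),
presented as a quotient of `C ⊗_k ⋯ ⊗_k C`. -/
abbrev Chain (K : Subalgebra k C) (n : ℕ) := Ten k C n ⧸ relations K n

/-- The class of the simple tensor `x₀ ⊗ ⋯ ⊗ xₙ`. -/
def cls (K : Subalgebra k C) (n : ℕ) (x : Fin (n + 1) → C) : Chain K n :=
  (relations K n).mkQ (PiTensorProduct.tprod k x)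

lemma bal_mem (K : Subalgebra k C) {n : ℕ} (x : Fin (n + 1) → C) (i : Fin (n + 1)) {c : C}
    (hc : c ∈ K) : PiTensorProduct.tprod k (Function.update x i (x i * c)) -
      PiTensorProduct.tprod k (Function.update x (i + 1) (c * x (i + 1))) ∈ balanced K n :=
  Submodule.subset_span ⟨x, i, c, hc, rfl⟩

lemma deg_mem (K : Subalgebra k C) {n : ℕ} (x : Fin (n + 1) → C) (i : Fin (n + 1)) (hi : i ≠ 0)
    (hx : x i ∈ K) : PiTensorProduct.tprod k x ∈ degenerate K n :=
  Submodule.subset_span ⟨x, i, hi, hx, rfl⟩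

/-- To map one quotient into another it is enough to check the two kinds of relations. -/
lemma relations_le_comap {K : Subalgebra k C} {D : Type*} [Ring D] [Algebra k D]
    {L : Subalgebra k D} {n m : ℕ} (f : Ten k C n →ₗ[k] Ten k D m)
    (h₁ : ∀ (x : Fin (n + 1) → C) (i : Fin (n + 1)) (c : C), c ∈ K →
      f (PiTensorProduct.tprod k (Function.update x i (x i * c))) -
      f (PiTensorProduct.tprod k (Function.update x (i + 1) (c * x (i + 1)))) ∈ relations L m)
    (h₂ : ∀ (x : Fin (n + 1) → C) (i : Fin (n + 1)), i ≠ 0 → x i ∈ K →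
      f (PiTensorProduct.tprod k x) ∈ relations L m) :
    relations K n ≤ (relations L m).comap f := by
  refine sup_le (Submodule.span_le.2 ?_) (Submodule.span_le.2 ?_)
  · rintro _ ⟨x, i, c, hc, rfl⟩
    simpa using h₁ x i c hc
  · rintro _ ⟨x, i, hi, hx, rfl⟩
    exact h₂ x i hi hx

/-- The rotation `x₀ ⊗ ⋯ ⊗ xₙ ↦ xᵢ ⊗ ⋯ ⊗ xₙ ⊗ x₀ ⊗ ⋯ ⊗ xᵢ₋₁`. -/
def rot {n : ℕ} (i : Fin (n + 1)) : Ten k C n →ₗ[k] Ten k C n :=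
  (PiTensorProduct.reindex k (fun _ => C) (Equiv.subRight i)).toLinearMap

@[simp] lemma rot_tprod {n : ℕ} (i : Fin (n + 1)) (x : Fin (n + 1) → C) :
    rot i (PiTensorProduct.tprod k x) = PiTensorProduct.tprod k (fun j => x (j + i)) := by
  unfold rot
  erw [PiTensorProduct.reindex_tprod]
  rfl

lemma update_rot {C : Type*} {n : ℕ} (x : Fin (n + 1) → C) (i j : Fin (n + 1)) (v : C) :
    (fun l => Function.update x j v (l + i)) =
      Function.update (fun l => x (l + i)) (j - i) v := by
  funext l
  by_cases h : l = j - i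
  · subst h; simp
  · rw [Function.update_of_ne h, Function.update_of_ne]
    rintro rfl
    simp at h

lemma rot_balanced (K : Subalgebra k C) {n : ℕ} (j : Fin (n + 1)) (x : Fin (n + 1) → C)
    (i : Fin (n + 1)) {c : C} (hc : c ∈ K) :
    rot j (PiTensorProduct.tprod k (Function.update x i (x i * c))) -
      rot j (PiTensorProduct.tprod k (Function.update x (i + 1) (c * x (i + 1)))) ∈
        balanced K n := by
  have := bal_mem K (fun l => x (l + j)) (i - j) hc
  rw [rot_tprod, rot_tprod, update_rot, update_rot]
  have e : i + 1 - j = i - j + 1 := by abel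
  rw [e]
  simpa [← e] using this

lemma rot_le_balanced (K : Subalgebra k C) {n : ℕ} (j : Fin (n + 1)) :
    balanced K n ≤ (balanced K n).comap (rot j) := by
  refine Submodule.span_le.2 ?_
  rintro _ ⟨x, i, c, hc, rfl⟩
  simpa using rot_balanced K j x i hc

/-! ### Faces -/

/-- The tuple `(x₀, …, β(xₐ, xₐ₊₁), …, xₙ₊₁)`. -/
def contract (β : C →ₗ[k] C →ₗ[k] C) {n : ℕ} (a : Fin (n + 1)) (x : Fin (n + 2) → C) :
    Fin (n + 1) → C :=
  Function.update (fun l => x (a.succ.succAbove l)) a (β (x a.castSucc) (x a.succ))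

lemma contract_self (β : C →ₗ[k] C →ₗ[k] C) {n : ℕ} (a : Fin (n + 1)) (x : Fin (n + 2) → C) :
    contract β a x a = β (x a.castSucc) (x a.succ) := by
  simp [contract]

lemma contract_ne (β : C →ₗ[k] C →ₗ[k] C) {n : ℕ} (a : Fin (n + 1)) (x : Fin (n + 2) → C)
    {l : Fin (n + 1)} (h : l ≠ a) : contract β a x l = x (a.succ.succAbove l) := by
  simp [contract, h]

lemma contract_update_succ (β : C →ₗ[k] C →ₗ[k] C) {n : ℕ} (a : Fin (n + 1))
    (x : Fin (n + 2) → C) (v : C) : contract β a (Function.update x a.succ v) =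
      Function.update (contract β a x) a (β (x a.castSucc) v) := by
  have : a.castSucc ≠ a.succ := (Fin.castSucc_lt_succ).ne
  funext l
  by_cases h : l = a
  · subst h; simp [contract, this]
  · simp [contract, h]

lemma contract_update_castSucc (β : C →ₗ[k] C →ₗ[k] C) {n : ℕ} (a : Fin (n + 1))
    (x : Fin (n + 2) → C) (v : C) : contract β a (Function.update x a.castSucc v) =
      Function.update (contract β a x) a (β v (x a.succ)) := by
  have : a.succ ≠ a.castSucc := (Fin.castSucc_lt_succ).ne'
  funext l
  by_cases h : l = a
  · subst h; simp [contract, this]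
  · have h2 : a.succ.succAbove l ≠ a.castSucc := by
      rw [← Fin.succAbove_succ_self a]
      exact fun e => h (Fin.succAbove_right_injective e)
    simp [contract, h, h2]

lemma contract_update_ne (β : C →ₗ[k] C →ₗ[k] C) {n : ℕ} (a : Fin (n + 1))
    (x : Fin (n + 2) → C) {l : Fin (n + 1)} (hl : l ≠ a) (v : C) :
    contract β a (Function.update x (a.succ.succAbove l) v) =
      Function.update (contract β a x) l v := by
  have h1 : a.castSucc ≠ a.succ.succAbove l := by
    rw [← Fin.succAbove_succ_self a]
    exact fun e => hl (Fin.succAbove_right_injective e).symm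
  have h2 : a.succ ≠ a.succ.succAbove l := (Fin.succAbove_ne _ _).symm
  funext m
  by_cases h : m = a
  · subst h; simp [contract, h1, h2, hl.symm]
  · by_cases h3 : m = l
    · subst h3; simp [contract, hl]
    · have h4 : a.succ.succAbove m ≠ a.succ.succAbove l :=
        fun e => h3 (Fin.succAbove_right_injective e)
      simp [contract, h, h3, h4]

lemma index_cases {n : ℕ} (a : Fin (n + 1)) (i : Fin (n + 2)) :
    i = a.succ ∨ i = a.castSucc ∨ ∃ l, l ≠ a ∧ i = a.succ.succAbove l := by
  by_cases h : i = a.succ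
  · exact Or.inl h
  · obtain ⟨l, rfl⟩ := Fin.exists_succAbove_eq h
    by_cases hl : l = a
    · subst hl; simp
    · exact Or.inr (Or.inr ⟨l, hl, rfl⟩)

/-- The linear map `x₀ ⊗ ⋯ ⊗ xₙ₊₁ ↦ x₀ ⊗ ⋯ ⊗ β(xₐ, xₐ₊₁) ⊗ ⋯ ⊗ xₙ₊₁` (without sign). -/
def inner (β : C →ₗ[k] C →ₗ[k] C) {n : ℕ} (a : Fin (n + 1)) :
    Ten k C (n + 1) →ₗ[k] Ten k C n :=
  PiTensorProduct.lift
    { toFun := fun x => PiTensorProduct.tprod k (contract β a x)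
      map_update_add' := by
        intro inst x i v w
        obtain rfl : inst = instDecidableEqFin _ := Subsingleton.elim _ _
        rcases index_cases a i with rfl | rfl | ⟨l, hl, rfl⟩
        · simp only [contract_update_succ, map_add, MultilinearMap.map_update_add]
        · simp only [contract_update_castSucc, map_add, LinearMap.add_apply,
            MultilinearMap.map_update_add]
        · simp only [contract_update_ne β a x hl, MultilinearMap.map_update_add]
      map_update_smul' := by
        intro inst x i r v
        obtain rfl : inst = instDecidableEqFin _ := Subsingleton.elim _ _
        rcases index_cases a i with rfl | rfl | ⟨l, hl, rfl⟩
        · simp only [contract_update_succ, map_smul, MultilinearMap.map_update_smul]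
        · simp only [contract_update_castSucc, map_smul, LinearMap.smul_apply,
            MultilinearMap.map_update_smul]
        · simp only [contract_update_ne β a x hl, MultilinearMap.map_update_smul] }

@[simp] lemma inner_tprod (β : C →ₗ[k] C →ₗ[k] C) {n : ℕ} (a : Fin (n + 1))
    (x : Fin (n + 2) → C) :
    inner β a (PiTensorProduct.tprod k x) = PiTensorProduct.tprod k (contract β a x) := by
  simp [inner]

/-- The linear map `x₀ ⊗ ⋯ ⊗ xₙ₊₁ ↦ β(xₙ₊₁, x₀) ⊗ x₁ ⊗ ⋯ ⊗ xₙ` (without sign). -/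
def outer (β : C →ₗ[k] C →ₗ[k] C) (n : ℕ) : Ten k C (n + 1) →ₗ[k] Ten k C n :=
  inner β 0 ∘ₗ rot (Fin.last (n + 1))

lemma outer_tprod (β : C →ₗ[k] C →ₗ[k] C) (n : ℕ) (x : Fin (n + 2) → C) :
    outer β n (PiTensorProduct.tprod k x) = PiTensorProduct.tprod k
      (Function.update (fun l => x l.castSucc) 0 (β (x (Fin.last (n + 1))) (x 0))) := by
  simp only [outer, LinearMap.comp_apply, rot_tprod, inner_tprod]
  congr 1
  have e : ∀ m : Fin (n + 1), m.succ + Fin.last (n + 1) = m.castSucc := by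
    intro m
    ext
    simp only [Fin.val_add, Fin.val_succ, Fin.val_last, Fin.val_castSucc]
    rw [show (m : ℕ) + 1 + (n + 1) = m + (n + 1 + 1) by omega, Nat.add_mod_right,
      Nat.mod_eq_of_lt (by omega)]
  funext l
  by_cases h : l = 0
  · subst h
    rw [contract_self, Function.update_self, e 0]
    simp
  · rw [contract_ne _ _ _ h, Function.update_of_ne h]
    have : (Fin.succ (0 : Fin (n + 1))).succAbove l = l.succ := by
      apply Fin.succAbove_of_lt_succ
      rw [Fin.succ_lt_succ_iff]
      exact Fin.pos_of_ne_zero h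
    rw [this, e l]

/-- `∑_{j=0}^{n} (-1)^j x₀ ⊗ ⋯ ⊗ β(xⱼ, xⱼ₊₁) ⊗ ⋯ ⊗ xₙ₊₁`. -/
def openSum (β : C →ₗ[k] C →ₗ[k] C) (n : ℕ) : Ten k C (n + 1) →ₗ[k] Ten k C n :=
  ∑ a : Fin (n + 1), (-1 : k) ^ (a : ℕ) • inner β a

/-- The previous sum, completed by the last term `(-1)^{n+1} β(xₙ₊₁, x₀) ⊗ x₁ ⊗ ⋯ ⊗ xₙ`. -/
def cyclicSum (β : C →ₗ[k] C →ₗ[k] C) (n : ℕ) : Ten k C (n + 1) →ₗ[k] Ten k C n :=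
  openSum β n + (-1 : k) ^ (n + 1) • outer β n

/-- `K`-bilinearity and `K`-balancedness of a bilinear map. -/
structure Bil (K : Subalgebra k C) (β : C →ₗ[k] C →ₗ[k] C) : Prop where
  left : ∀ c ∈ K, ∀ x y, β (c * x) y = c * β x y
  mid : ∀ c ∈ K, ∀ x y, β (x * c) y = β x (c * y)
  right : ∀ c ∈ K, ∀ x y, β x (y * c) = β x y * c

lemma succAbove_add_one {n : ℕ} (a l : Fin (n + 1)) (h : l ≠ a) :
    a.succ.succAbove l + 1 = a.succ.succAbove (l + 1) := by
  have ha := a.2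
  have hl := l.2
  have h' : (l : ℕ) ≠ a := fun e => h (Fin.ext e)
  rcases Nat.lt_or_gt_of_ne h' with h1 | h1
  · have e : ((l + 1 : Fin (n + 1)) : ℕ) = l + 1 := by
      rw [Fin.val_add_one_of_lt]
      exact Fin.lt_def.2 (by simp; omega)
    rw [Fin.succAbove_of_castSucc_lt a.succ l (Fin.lt_def.2 (by simp; omega)),
      Fin.succAbove_of_castSucc_lt a.succ (l + 1) (Fin.lt_def.2 (by simp [e]; omega))]
    ext
    rw [Fin.val_add_one_of_lt (Fin.lt_def.2 (by simp; omega)), Fin.val_castSucc,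
      Fin.val_castSucc, e]
  · rw [Fin.succAbove_of_lt_succ a.succ l (Fin.lt_def.2 (by simp; omega))]
    by_cases hL : l = Fin.last n
    · subst hL
      simp
    · have h2 : (l : ℕ) < n := by
        have : (l : ℕ) ≠ n := fun e => hL (Fin.ext e)
        omega
      have e : ((l + 1 : Fin (n + 1)) : ℕ) = l + 1 := by
        rw [Fin.val_add_one_of_lt]
        exact Fin.lt_def.2 (by simpa using h2)
      rw [Fin.succAbove_of_lt_succ a.succ (l + 1) (Fin.lt_def.2 (by simp [e]; omega))]
      ext
      rw [Fin.val_add_one_of_lt (Fin.lt_def.2 (by simp; omega)), Fin.val_succ, Fin.val_succ, e]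

lemma succ_add_one {n : ℕ} (a : Fin (n + 1)) : a.succ + 1 = a.succ.succAbove (a + 1) := by
  by_cases hL : a = Fin.last n
  · subst hL
    simp
  · have ha := a.2
    have h2 : (a : ℕ) < n := by
      have : (a : ℕ) ≠ n := fun e => hL (Fin.ext e)
      omega
    have e : ((a + 1 : Fin (n + 1)) : ℕ) = a + 1 := by
      rw [Fin.val_add_one_of_lt]
      exact Fin.lt_def.2 (by simpa using h2)
    rw [Fin.succAbove_of_lt_succ a.succ (a + 1) (Fin.lt_def.2 (by simp [e]))]
    ext
    rw [Fin.val_add_one_of_lt (Fin.lt_def.2 (by simp; omega)), Fin.val_succ, Fin.val_succ, e]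

lemma contract_left {K : Subalgebra k C} {β : C →ₗ[k] C →ₗ[k] C} (hβ : Bil K β) {n : ℕ}
    (a : Fin (n + 1)) (x : Fin (n + 2) → C) {c : C} (hc : c ∈ K) (l : Fin (n + 1)) :
    contract β a (Function.update x (a.succ.succAbove l) (c * x (a.succ.succAbove l))) =
      Function.update (contract β a x) l (c * contract β a x l) := by
  by_cases h : l = a
  · subst h
    rw [Fin.succAbove_succ_self, contract_update_castSucc, contract_self, hβ.left c hc]
  · rw [contract_update_ne β a x h, contract_ne β a x h]

lemma inner_balanced {K : Subalgebra k C} {β : C →ₗ[k] C →ₗ[k] C} (hβ : Bil K β) {n : ℕ}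
    (a : Fin (n + 1)) (x : Fin (n + 2) → C) (i : Fin (n + 2)) {c : C} (hc : c ∈ K) :
    inner β a (PiTensorProduct.tprod k (Function.update x i (x i * c))) -
      inner β a (PiTensorProduct.tprod k (Function.update x (i + 1) (c * x (i + 1)))) ∈
        balanced K n := by
  rw [inner_tprod, inner_tprod]
  rcases index_cases a i with rfl | rfl | ⟨l, hl, rfl⟩
  · rw [contract_update_succ, hβ.right c hc, ← contract_self, succ_add_one,
      contract_left hβ a x hc]
    exact bal_mem K _ a hc
  · rw [contract_update_castSucc, hβ.mid c hc, Fin.coeSucc_eq_succ,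
      contract_update_succ, sub_self]
    exact zero_mem _
  · rw [succAbove_add_one a l hl, contract_left hβ a x hc, contract_update_ne β a x hl,
      ← contract_ne β a x hl]
    exact bal_mem K _ l hc

lemma inner_le_balanced {K : Subalgebra k C} {β : C →ₗ[k] C →ₗ[k] C} (hβ : Bil K β) {n : ℕ}
    (a : Fin (n + 1)) : balanced K (n + 1) ≤ (balanced K n).comap (inner β a) := by
  refine Submodule.span_le.2 ?_
  rintro _ ⟨x, i, c, hc, rfl⟩
  simpa using inner_balanced hβ a x i hc

lemma outer_le_balanced {K : Subalgebra k C} {β : C →ₗ[k] C →ₗ[k] C} (hβ : Bil K β) (n : ℕ) :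
    balanced K (n + 1) ≤ (balanced K n).comap (outer β n) :=
  (rot_le_balanced K (Fin.last (n + 1))).trans
    (Submodule.comap_mono (inner_le_balanced hβ 0))

/-! ### Descent to the normalized chains -/

/-- The bilinear map vanishes as soon as one argument is in `K`. -/
structure Vanishing (K : Subalgebra k C) (β : C →ₗ[k] C →ₗ[k] C) : Prop extends Bil K β where
  zero_left : ∀ c ∈ K, ∀ y, β c y = 0
  zero_right : ∀ c ∈ K, ∀ x, β x c = 0

/-- The bilinear map is the multiplication as soon as one argument is in `K`. -/
structure Unital (K : Subalgebra k C) (β : C →ₗ[k] C →ₗ[k] C) : Prop extends Bil K β where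
  mul_left : ∀ c ∈ K, ∀ y, β c y = c * y
  mul_right : ∀ c ∈ K, ∀ x, β x c = x * c

lemma tprod_zero {n : ℕ} (x : Fin (n + 1) → C) (i : Fin (n + 1)) (h : x i = 0) :
    PiTensorProduct.tprod k x = 0 :=
  (PiTensorProduct.tprod k).map_coord_zero i h

lemma ne_zero_of_succAbove {n : ℕ} (a l : Fin (n + 1)) (h : a.succ.succAbove l ≠ 0) : l ≠ 0 := by
  rintro rfl
  exact h (Fin.succAbove_ne_zero_zero (Fin.succ_ne_zero a))

/-- A face which does not touch the degenerate entry is degenerate. -/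
lemma inner_degenerate {K : Subalgebra k C} (β : C →ₗ[k] C →ₗ[k] C) {n : ℕ} (a : Fin (n + 1))
    (x : Fin (n + 2) → C) (l : Fin (n + 1)) (hl : l ≠ a) (h0 : a.succ.succAbove l ≠ 0)
    (hx : x (a.succ.succAbove l) ∈ K) :
    inner β a (PiTensorProduct.tprod k x) ∈ relations K n := by
  rw [inner_tprod]
  refine Submodule.mem_sup_right (deg_mem K _ l (ne_zero_of_succAbove a l h0) ?_)
  rwa [contract_ne β a x hl]

lemma outer_degenerate {K : Subalgebra k C} (β : C →ₗ[k] C →ₗ[k] C) {n : ℕ}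
    (x : Fin (n + 2) → C) (l : Fin (n + 1)) (hl : l ≠ 0) (hx : x l.castSucc ∈ K) :
    outer β n (PiTensorProduct.tprod k x) ∈ relations K n := by
  rw [outer_tprod]
  refine Submodule.mem_sup_right (deg_mem K _ l hl ?_)
  rwa [Function.update_of_ne hl]

lemma inner_vanishing {K : Subalgebra k C} {β : C →ₗ[k] C →ₗ[k] C} (hβ : Vanishing K β) {n : ℕ}
    (a : Fin (n + 1)) : relations K (n + 1) ≤ (relations K n).comap (inner β a) := by
  refine relations_le_comap _ (fun x i c hc => ?_) (fun x i hi hx => ?_)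
  · exact Submodule.mem_sup_left (inner_balanced hβ.toBil a x i hc)
  · rcases index_cases a i with rfl | rfl | ⟨l, hl, rfl⟩
    · rw [inner_tprod, tprod_zero _ a]
      · exact zero_mem _
      · rw [contract_self, hβ.zero_right _ hx]
    · rw [inner_tprod, tprod_zero _ a]
      · exact zero_mem _
      · rw [contract_self, hβ.zero_left _ hx]
    · exact inner_degenerate β a x l hl hi hx

lemma outer_vanishing {K : Subalgebra k C} {β : C →ₗ[k] C →ₗ[k] C} (hβ : Vanishing K β)
    (n : ℕ) : relations K (n + 1) ≤ (relations K n).comap (outer β n) := by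
  refine relations_le_comap _ (fun x i c hc => ?_) (fun x i hi hx => ?_)
  · rw [← map_sub]
    exact Submodule.mem_sup_left (outer_le_balanced hβ.toBil n (bal_mem K x i hc))
  · refine Fin.lastCases (motive := fun i => i ≠ 0 → x i ∈ K → _) ?_ ?_ i hi hx
    · intro _ h
      rw [outer_tprod, tprod_zero _ 0]
      · exact zero_mem _
      · rw [Function.update_self, hβ.zero_left _ h]
    · intro l hl h
      exact outer_degenerate β x l (by rintro rfl; exact hl rfl) h

lemma openSum_vanishing {K : Subalgebra k C} {β : C →ₗ[k] C →ₗ[k] C} (hβ : Vanishing K β)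
    (n : ℕ) : relations K (n + 1) ≤ (relations K n).comap (openSum β n) := by
  intro z hz
  simp only [Submodule.mem_comap, openSum, LinearMap.sum_apply, LinearMap.smul_apply]
  exact sum_mem fun a _ => Submodule.smul_mem _ _ (inner_vanishing hβ a hz)

lemma cyclicSum_vanishing {K : Subalgebra k C} {β : C →ₗ[k] C →ₗ[k] C} (hβ : Vanishing K β)
    (n : ℕ) : relations K (n + 1) ≤ (relations K n).comap (cyclicSum β n) := by
  intro z hz
  simp only [Submodule.mem_comap, cyclicSum, LinearMap.add_apply, LinearMap.smul_apply]
  exact add_mem (openSum_vanishing hβ n hz) (Submodule.smul_mem _ _ (outer_vanishing hβ n hz))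

lemma cyclicSum_unital {K : Subalgebra k C} {β : C →ₗ[k] C →ₗ[k] C} (hβ : Unital K β)
    (n : ℕ) : relations K (n + 1) ≤ (relations K n).comap (cyclicSum β n) := by
  refine relations_le_comap _ (fun x i c hc => ?_) (fun x i hi hx => ?_)
  · have hz := bal_mem K x i hc
    rw [← map_sub]
    simp only [cyclicSum, openSum, LinearMap.add_apply, LinearMap.smul_apply,
      LinearMap.sum_apply]
    refine Submodule.mem_sup_left (add_mem (sum_mem fun a _ => ?_) ?_)
    · exact Submodule.smul_mem _ _ (inner_le_balanced hβ.toBil a hz)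
    · exact Submodule.smul_mem _ _ (outer_le_balanced hβ.toBil n hz)
  · obtain ⟨a, rfl⟩ := Fin.exists_succ_eq.2 hi
    simp only [cyclicSum, openSum, LinearMap.add_apply, LinearMap.smul_apply,
      LinearMap.sum_apply]
    set w : Fin (n + 1) → C := fun l => x (a.succ.succAbove l) with hw
    have hwa : w a = x a.castSucc := by simp [hw]
    have key := (Submodule.Quotient.mk_eq_zero (relations K n)).2
      (Submodule.mem_sup_left (T := degenerate K n) (bal_mem K w a hx))
    have e1 : inner β a (PiTensorProduct.tprod k x) =
        PiTensorProduct.tprod k (Function.update w a (w a * x a.succ)) := by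
      rw [inner_tprod, contract, hβ.mul_right _ hx, hwa]
    have hother : ∀ b : Fin (n + 1), b ≠ a → b.castSucc ≠ a.succ →
        inner β b (PiTensorProduct.tprod k x) ∈ relations K n := by
      intro b hb hb'
      rcases index_cases b a.succ with h | h | ⟨l, hl, h⟩
      · exact absurd (Fin.succ_injective _ h).symm hb
      · exact absurd h.symm hb'
      · exact inner_degenerate β b x l hl (h ▸ Fin.succ_ne_zero a) (h ▸ hx)
    rw [← Submodule.Quotient.mk_eq_zero, Submodule.Quotient.mk_add, ← Submodule.mkQ_apply,
      map_sum]
    have hz : ∀ b : Fin (n + 1), b ≠ a → b.castSucc ≠ a.succ →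
        (relations K n).mkQ ((-1 : k) ^ (b : ℕ) • inner β b (PiTensorProduct.tprod k x)) = 0 := by
      intro b hb hb'
      rw [map_smul, Submodule.mkQ_apply, (Submodule.Quotient.mk_eq_zero _).2 (hother b hb hb'),
        smul_zero]
    by_cases hL : a = Fin.last n
    · subst hL
      have e2 : outer β n (PiTensorProduct.tprod k x) =
          PiTensorProduct.tprod k (Function.update w (Fin.last n + 1)
            (x (Fin.last n).succ * w (Fin.last n + 1))) := by
        rw [outer_tprod, Fin.last_add_one]
        have : w = fun l => x l.castSucc := by
          funext l
          simp [hw]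
        rw [this, Fin.succ_last, hβ.mul_left _ (by simpa using hx)]
        rfl
      rw [Fintype.sum_eq_single (Fin.last n)]
      · rw [e1, e2, map_smul, Submodule.mkQ_apply, Submodule.Quotient.mk_smul, pow_succ,
          mul_neg_one, neg_smul, ← sub_eq_add_neg, Fin.val_last, ← smul_sub,
          ← Submodule.Quotient.mk_sub, key, smul_zero]
      · intro b hb
        refine hz b hb fun h => ?_
        rw [Fin.succ_last] at h
        exact (Fin.castSucc_lt_last b).ne h
    · have ha := a.2
      have h2 : (a : ℕ) < n := by
        have : (a : ℕ) ≠ n := fun e => hL (Fin.ext e)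
        omega
      have e : ((a + 1 : Fin (n + 1)) : ℕ) = a + 1 := by
        rw [Fin.val_add_one_of_lt]
        exact Fin.lt_def.2 (by simpa using h2)
      have hc : (a + 1).castSucc = a.succ := Fin.ext (by simp [e])
      have hne : a ≠ a + 1 := fun h => by
        have := congrArg Fin.val h
        omega
      have e2 : inner β (a + 1) (PiTensorProduct.tprod k x) =
          PiTensorProduct.tprod k (Function.update w (a + 1) (x a.succ * w (a + 1))) := by
        rw [inner_tprod]
        congr 1
        funext l
        by_cases hl : l = a + 1
        · subst hl
          rw [contract_self, Function.update_self, hc, hβ.mul_left _ hx, hw]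
          simp only [← hc, Fin.succAbove_castSucc_self]
        · rw [contract_ne _ _ _ hl, Function.update_of_ne hl, hw]
          simp only [← hc]
          congr 1
          have hl' : (l : ℕ) ≠ (a + 1 : Fin (n + 1)) := fun h => hl (Fin.ext h)
          rcases Nat.lt_or_gt_of_ne hl' with h | h
          · rw [Fin.succAbove_of_castSucc_lt _ _ (Fin.lt_def.2 (by simp; omega)),
              Fin.succAbove_of_castSucc_lt _ _ (Fin.lt_def.2 (by simp; omega))]
          · rw [Fin.succAbove_of_lt_succ _ _ (Fin.lt_def.2 (by simp; omega)),
              Fin.succAbove_of_lt_succ _ _ (Fin.lt_def.2 (by simp; omega))]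
      have hout : outer β n (PiTensorProduct.tprod k x) ∈ relations K n :=
        outer_degenerate β x (a + 1) (fun h => by simp [h] at e) (hc ▸ hx)
      rw [Fintype.sum_eq_add a (a + 1) hne]
      · rw [e1, e2, Submodule.Quotient.mk_smul, (Submodule.Quotient.mk_eq_zero _).2 hout,
          map_smul, map_smul, Submodule.mkQ_apply, Submodule.mkQ_apply, e, pow_succ,
          mul_neg_one, neg_smul, ← sub_eq_add_neg, ← smul_sub,
          ← Submodule.Quotient.mk_sub, key, smul_zero, smul_zero, add_zero]
      · rintro b ⟨hb, hb'⟩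
        exact hz b hb fun h => hb' (Fin.castSucc_injective _ (h.trans hc.symm))

/-- The multiplication of `C` as a bilinear map. -/
abbrev mulMap (k : Type*) [CommRing k] (C : Type*) [Ring C] [Algebra k C] : C →ₗ[k] C →ₗ[k] C :=
  LinearMap.mul k C

lemma mulMap_unital (K : Subalgebra k C) : Unital K (mulMap k C) where
  left c _ x y := by simp [mul_assoc]
  mid c _ x y := by simp [mul_assoc]
  right c _ x y := by simp [mul_assoc]
  mul_left c _ y := by simp
  mul_right c _ x := by simp

/-- The Hochschild boundary `b` of the normalized chains of the `K`-algebra `C`. -/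
def hochschild (K : Subalgebra k C) (n : ℕ) : Chain K (n + 1) →ₗ[k] Chain K n :=
  Submodule.mapQ _ _ (cyclicSum (mulMap k C) n) (cyclicSum_unital (mulMap_unital K) n)

/-- The linear map `x₀ ⊗ ⋯ ⊗ xₙ ↦ 1 ⊗ x₀ ⊗ ⋯ ⊗ xₙ`. -/
def consOne (n : ℕ) : Ten k C n →ₗ[k] Ten k C (n + 1) :=
  PiTensorProduct.lift
    { toFun := fun x => PiTensorProduct.tprod k (Fin.cons (1 : C) x : Fin (n + 2) → C)
      map_update_add' := by
        intro inst x i v w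
        obtain rfl : inst = instDecidableEqFin _ := Subsingleton.elim _ _
        simp only [Fin.cons_update, MultilinearMap.map_update_add]
      map_update_smul' := by
        intro inst x i r v
        obtain rfl : inst = instDecidableEqFin _ := Subsingleton.elim _ _
        simp only [Fin.cons_update, MultilinearMap.map_update_smul] }

@[simp] lemma consOne_tprod (n : ℕ) (x : Fin (n + 1) → C) :
    consOne n (PiTensorProduct.tprod k x) =
      PiTensorProduct.tprod k (Fin.cons (1 : C) x : Fin (n + 2) → C) := by
  simp [consOne]

lemma consOne_le_balanced (K : Subalgebra k C) (n : ℕ) :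
    balanced K n ≤ (balanced K (n + 1)).comap (consOne n) := by
  refine Submodule.span_le.2 ?_
  rintro _ ⟨x, i, c, hc, rfl⟩
  simp only [SetLike.mem_coe, Submodule.mem_comap, map_sub, consOne_tprod, Fin.cons_update]
  set y : Fin (n + 2) → C := Fin.cons (1 : C) x with hy
  have hys : ∀ j : Fin (n + 1), x j = y j.succ := fun j => by simp [hy]
  by_cases hL : i = Fin.last n
  · subst hL
    have h1 := bal_mem K y (Fin.last n).succ hc
    have h2 := bal_mem K y 0 hc
    have e0 : y 0 = 1 := by simp [hy]
    rw [Fin.last_add_one, hys, hys]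
    simp only [Fin.succ_last, Fin.last_add_one, zero_add, e0, one_mul, mul_one] at h1 h2 ⊢
    simpa using add_mem h1 h2
  · have ha := i.2
    have h2 : (i : ℕ) < n := by
      have : (i : ℕ) ≠ n := fun e => hL (Fin.ext e)
      omega
    have e : i.succ + 1 = (i + 1).succ := by
      ext
      rw [Fin.val_add_one_of_lt (Fin.lt_def.2 (by simp; omega)), Fin.val_succ, Fin.val_succ,
        Fin.val_add_one_of_lt (Fin.lt_def.2 (by simpa using h2))]
    rw [hys, hys, ← e]
    exact bal_mem K y i.succ hc

/-- `x₀ ⊗ ⋯ ⊗ xₙ ↦ ∑ᵢ (-1)^{in} 1 ⊗ xᵢ ⊗ ⋯ ⊗ xₙ ⊗ x₀ ⊗ ⋯ ⊗ xᵢ₋₁`. -/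
def connesSum (n : ℕ) : Ten k C n →ₗ[k] Ten k C (n + 1) :=
  ∑ i : Fin (n + 1), (-1 : k) ^ ((i : ℕ) * n) • (consOne n ∘ₗ rot i)

lemma connesSum_le (K : Subalgebra k C) (n : ℕ) :
    relations K n ≤ (relations K (n + 1)).comap (connesSum n) := by
  refine relations_le_comap _ (fun x i c hc => ?_) (fun x i hi hx => ?_)
  · rw [← map_sub]
    simp only [connesSum, LinearMap.smul_apply, LinearMap.sum_apply, LinearMap.comp_apply]
    refine Submodule.mem_sup_left (sum_mem fun j _ => Submodule.smul_mem _ _ ?_)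
    exact consOne_le_balanced K n (rot_le_balanced K j (bal_mem K x i hc))
  · simp only [connesSum, LinearMap.smul_apply, LinearMap.sum_apply, LinearMap.comp_apply]
    refine Submodule.mem_sup_right (sum_mem fun j _ => Submodule.smul_mem _ _ ?_)
    rw [rot_tprod, consOne_tprod]
    exact deg_mem K _ (i - j).succ (Fin.succ_ne_zero _) (by simpa using hx)

/-- The Connes operator `B` of the normalized chains of the `K`-algebra `C`. -/
def connes (K : Subalgebra k C) (n : ℕ) : Chain K n →ₗ[k] Chain K (n + 1) :=
  Submodule.mapQ _ _ (connesSum n) (connesSum_le K n)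

/-! ### The relative normalized mixed complex of a surjection -/

section Relative

variable {D : Type*} [Ring D] [Algebra k D]

/-- The linear map `x₀ ⊗ ⋯ ⊗ xₙ ↦ f(x₀) ⊗ ⋯ ⊗ f(xₙ)`. -/
def tenMap (f : C →ₐ[k] D) (n : ℕ) : Ten k C n →ₗ[k] Ten k D n :=
  PiTensorProduct.map (fun _ => f.toLinearMap)

@[simp] lemma tenMap_tprod (f : C →ₐ[k] D) (n : ℕ) (x : Fin (n + 1) → C) :
    tenMap f n (PiTensorProduct.tprod k x) = PiTensorProduct.tprod k (fun j => f (x j)) := by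
  simp [tenMap]

lemma map_update (f : C →ₐ[k] D) {n : ℕ} (x : Fin (n + 1) → C) (i : Fin (n + 1)) (v : C) :
    (fun j => f (Function.update x i v j)) = Function.update (fun j => f (x j)) i (f v) := by
  funext j
  by_cases h : j = i
  · subst h; simp
  · simp [h]

lemma tenMap_le (f : C →ₐ[k] D) (K : Subalgebra k C) (n : ℕ) :
    relations K n ≤ (relations (K.map f) n).comap (tenMap f n) := by
  refine relations_le_comap _ (fun x i c hc => ?_) (fun x i hi hx => ?_)
  · simp only [tenMap_tprod, map_update, map_mul]
    exact Submodule.mem_sup_left (bal_mem (K.map f) (fun j => f (x j)) i ⟨c, hc, rfl⟩)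
  · rw [tenMap_tprod]
    exact Submodule.mem_sup_right (deg_mem (K.map f) _ i hi ⟨_, hx, rfl⟩)

/-- The map from the normalized chains of the `K`-algebra `C` to those of `D`, regarded as an
algebra over the image of `K`, which is induced by an algebra map `f : C → D`. -/
def chainMap (f : C →ₐ[k] D) (K : Subalgebra k C) (n : ℕ) :
    Chain K n →ₗ[k] Chain (K.map f) n :=
  Submodule.mapQ _ _ (tenMap f n) (tenMap_le f K n)

/-- The kernel of the map induced by `f` on normalized chains in degree `n`. -/
def relChain (f : C →ₐ[k] D) (K : Subalgebra k C) (n : ℕ) : Submodule k (Chain K n) :=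
  LinearMap.ker (chainMap f K n)

lemma tenMap_inner (f : C →ₐ[k] D) {n : ℕ} (a : Fin (n + 1)) :
    tenMap f n ∘ₗ inner (mulMap k C) a = inner (mulMap k D) a ∘ₗ tenMap f (n + 1) := by
  ext x
  simp only [LinearMap.compMultilinearMap_apply, LinearMap.comp_apply, inner_tprod, tenMap_tprod,
    contract, map_update]
  simp

lemma tenMap_rot (f : C →ₐ[k] D) {n : ℕ} (i : Fin (n + 1)) :
    tenMap f n ∘ₗ rot i = rot i ∘ₗ tenMap f n := by
  ext x
  simp

lemma tenMap_consOne (f : C →ₐ[k] D) (n : ℕ) :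
    tenMap f (n + 1) ∘ₗ consOne n = consOne n ∘ₗ tenMap f n := by
  ext x
  simp only [LinearMap.compMultilinearMap_apply, LinearMap.comp_apply, consOne_tprod, tenMap_tprod]
  congr 1
  funext j
  refine Fin.cases ?_ (fun j => ?_) j <;> simp

lemma tenMap_cyclicSum (f : C →ₐ[k] D) (n : ℕ) (z : Ten k C (n + 1)) :
    tenMap f n (cyclicSum (mulMap k C) n z) =
      cyclicSum (mulMap k D) n (tenMap f (n + 1) z) := by
  have h1 : ∀ (m : ℕ) (a : Fin (m + 1)) (y : Ten k C (m + 1)), tenMap f m (inner (mulMap k C) a y) =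
      inner (mulMap k D) a (tenMap f (m + 1) y) :=
    fun m a y => LinearMap.congr_fun (tenMap_inner f a) y
  have h2 : ∀ (m : ℕ) (a : Fin (m + 1)) (y : Ten k C m), tenMap f m (rot a y) =
      rot a (tenMap f m y) := fun m a y => LinearMap.congr_fun (tenMap_rot f a) y
  simp [cyclicSum, openSum, outer, h1, h2]

lemma tenMap_connesSum (f : C →ₐ[k] D) (n : ℕ) (z : Ten k C n) :
    tenMap f (n + 1) (connesSum n z) = connesSum n (tenMap f n z) := by
  have h1 : ∀ y : Ten k C n, tenMap f (n + 1) (consOne n y) = consOne n (tenMap f n y) :=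
    fun y => LinearMap.congr_fun (tenMap_consOne f n) y
  have h2 : ∀ (a : Fin (n + 1)) (y : Ten k C n), tenMap f n (rot a y) = rot a (tenMap f n y) :=
    fun a y => LinearMap.congr_fun (tenMap_rot f a) y
  simp [connesSum, h1, h2]

lemma chainMap_hochschild (f : C →ₐ[k] D) (K : Subalgebra k C) (n : ℕ) (z : Chain K (n + 1)) :
    chainMap f K n (hochschild K n z) = hochschild (K.map f) n (chainMap f K (n + 1) z) := by
  induction z using Submodule.Quotient.induction_on with
  | H z => simp [chainMap, hochschild, tenMap_cyclicSum]

lemma chainMap_connes (f : C →ₐ[k] D) (K : Subalgebra k C) (n : ℕ) (z : Chain K n) :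
    chainMap f K (n + 1) (connes K n z) = connes (K.map f) n (chainMap f K n z) := by
  induction z using Submodule.Quotient.induction_on with
  | H z => simp [chainMap, connes, tenMap_connesSum]

/-- The Hochschild boundary on the kernel of the map induced by `f`. -/
def relHochschild (f : C →ₐ[k] D) (K : Subalgebra k C) (n : ℕ) :
    relChain f K (n + 1) →ₗ[k] relChain f K n :=
  (hochschild K n).restrict fun z hz => by
    rw [relChain, LinearMap.mem_ker] at hz ⊢
    rw [chainMap_hochschild, hz, map_zero]

/-- The Connes operator on the kernel of the map induced by `f`. -/
def relConnes (f : C →ₐ[k] D) (K : Subalgebra k C) (n : ℕ) :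
    relChain f K n →ₗ[k] relChain f K (n + 1) :=
  (connes K n).restrict fun z hz => by
    rw [relChain, LinearMap.mem_ker] at hz ⊢
    rw [chainMap_connes, hz, map_zero]

end Relative

end Chains

/-! ### Cleft extensions -/

/-- A cleft extension `(E, p, i)` of the `k`-algebra `A`: algebra maps `p : E → A` and `i : A → E`
with `p ∘ i = id`. -/
structure CleftExt (k A E : Type*) [CommRing k] [Ring A] [Algebra k A] [Ring E]
    [Algebra k E] where
  /-- the projection -/
  p : E →ₐ[k] A
  /-- the section -/
  i : A →ₐ[k] E
  p_i : ∀ a, p (i a) = a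

namespace CleftExt

variable {k A E : Type*} [CommRing k] [Ring A] [Algebra k A] [Ring E] [Algebra k E]
  (c : CleftExt k A E)

/-- The projection of `E = i(A) ⊕ ker p` onto `i(A)`. -/
def projA : E →ₗ[k] E := c.i.toLinearMap ∘ₗ c.p.toLinearMap

/-- The projection of `E = i(A) ⊕ ker p` onto `M = ker p`. -/
def projM : E →ₗ[k] E := LinearMap.id - c.projA

/-- The map `▽`: the multiplication on `M = ker p`, zero if an argument is in `i(A)`. -/
def nabla : E →ₗ[k] E →ₗ[k] E := (mulMap k E).compl₁₂ c.projM c.projM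

/-- The multiplication of `E`, changed so that the product of two elements of `M` is zero. -/
def mu : E →ₗ[k] E →ₗ[k] E := mulMap k E - c.nabla

lemma projA_apply (x : E) : c.projA x = c.i (c.p x) := rfl

lemma projM_apply (x : E) : c.projM x = x - c.i (c.p x) := rfl

lemma nabla_apply (x y : E) : c.nabla x y = c.projM x * c.projM y := rfl

lemma mu_apply (x y : E) : c.mu x y = x * y - c.projM x * c.projM y := rfl

lemma p_projA (x : E) : c.p (c.projA x) = c.p x := by simp [projA_apply, c.p_i]

lemma p_projM (x : E) : c.p (c.projM x) = 0 := by simp [projM_apply, c.p_i]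

lemma i_p {x : E} (hx : x ∈ c.i.range) : c.i (c.p x) = x := by
  obtain ⟨a, rfl⟩ := hx
  simp [c.p_i]

lemma projM_of_range {x : E} (hx : x ∈ c.i.range) : c.projM x = 0 := by
  rw [projM_apply, c.i_p hx, sub_self]

lemma projM_of_ker {x : E} (hx : c.p x = 0) : c.projM x = x := by
  simp [projM_apply, hx]

lemma projM_left {r : E} (hr : r ∈ c.i.range) (x : E) : c.projM (r * x) = r * c.projM x := by
  simp only [projM_apply, map_mul, c.i_p hr, mul_sub]

lemma projM_right {r : E} (hr : r ∈ c.i.range) (x : E) : c.projM (x * r) = c.projM x * r := by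
  simp only [projM_apply, map_mul, c.i_p hr, sub_mul]

lemma projA_left {r : E} (hr : r ∈ c.i.range) (x : E) : c.projA (r * x) = r * c.projA x := by
  simp only [projA_apply, map_mul, c.i_p hr]

lemma projA_right {r : E} (hr : r ∈ c.i.range) (x : E) : c.projA (x * r) = c.projA x * r := by
  simp only [projA_apply, map_mul, c.i_p hr]

variable (K : Subalgebra k A)

/-- The subalgebra `K` of `A`, regarded as a subalgebra of `E`. -/
abbrev base : Subalgebra k E := K.map c.i

lemma base_le : ∀ r ∈ c.base K, r ∈ c.i.range := by
  rintro _ ⟨a, -, rfl⟩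
  exact ⟨a, rfl⟩

lemma nabla_vanishing : Vanishing (c.base K) c.nabla where
  left r hr x y := by
    simp only [nabla_apply, c.projM_left (c.base_le K r hr), mul_assoc]
  mid r hr x y := by
    simp only [nabla_apply, c.projM_left (c.base_le K r hr), c.projM_right (c.base_le K r hr),
      mul_assoc]
  right r hr x y := by
    simp only [nabla_apply, c.projM_right (c.base_le K r hr), mul_assoc]
  zero_left r hr y := by
    simp only [nabla_apply, c.projM_of_range (c.base_le K r hr), zero_mul]
  zero_right r hr x := by
    simp only [nabla_apply, c.projM_of_range (c.base_le K r hr), mul_zero]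

lemma mu_unital : Unital (c.base K) c.mu where
  left r hr x y := by
    simp only [mu_apply, c.projM_left (c.base_le K r hr), mul_assoc, mul_sub]
  mid r hr x y := by
    simp only [mu_apply, c.projM_left (c.base_le K r hr), c.projM_right (c.base_le K r hr),
      mul_assoc]
  right r hr x y := by
    simp only [mu_apply, c.projM_right (c.base_le K r hr), mul_assoc, sub_mul]
  mul_left r hr y := by
    simp only [mu_apply, c.projM_of_range (c.base_le K r hr), zero_mul, sub_zero]
  mul_right r hr x := by
    simp only [mu_apply, c.projM_of_range (c.base_le K r hr), mul_zero, sub_zero]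

/-! ### The modules `X_{vw}`

All families are indexed by the tensor degree `n = v + w` and by `w`; a module with `w > n`
(that is, `v < 0`) is zero. -/

/-- `x₀ ⊗ ⋯ ⊗ xₙ` is a very simple tensor with the entries from `M` at the places in `S` and
entries from `i(A)` at the other places. -/
def IsWord {n : ℕ} (S : Finset (Fin n)) (x : Fin n → E) : Prop :=
  ∀ j, (j ∈ S → c.p (x j) = 0) ∧ (j ∉ S → x j ∈ c.i.range)

/-- The module `X_{vw} = M ⊗ B^n_w ⊗` with `v = n - w`: the submodule of `E ⊗ (E/K)^{⊗ n} ⊗`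
spanned by the very simple tensors `x₀ ⊗ ⋯ ⊗ xₙ` with `x₀ ∈ M` and with exactly `w` of the entries
`x₁, …, xₙ` from `M`, the others being from `A`. -/
def X (n w : ℕ) : Submodule k (Chain (c.base K) n) :=
  Submodule.span k {z | ∃ (S : Finset (Fin (n + 1))) (x : Fin (n + 1) → E),
    0 ∈ S ∧ S.card = w + 1 ∧ c.IsWord S x ∧ z = cls (c.base K) n x}

lemma cls_mem {n w : ℕ} {S : Finset (Fin (n + 1))} {x : Fin (n + 1) → E} (h0 : 0 ∈ S)
    (hS : S.card = w + 1) (hx : c.IsWord S x) : cls (c.base K) n x ∈ c.X K n w :=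
  Submodule.subset_span ⟨S, x, h0, hS, hx, rfl⟩

lemma predAbove_succAbove' {n : ℕ} (a l : Fin (n + 1)) :
    a.predAbove (a.succ.succAbove l) = l := by
  by_cases h : l ≤ a
  · rw [Fin.succAbove_of_castSucc_lt _ _ (Fin.castSucc_lt_succ_iff.2 h),
      Fin.predAbove_castSucc_of_le _ _ h]
  · have h' : a < l := not_le.1 h
    rw [Fin.succAbove_of_lt_succ _ _ (Fin.succ_lt_succ_iff.2 h'),
      Fin.predAbove_succ_of_le _ _ h'.le]

/-- The set of places of `M` after the places `a` and `a + 1` have been merged. -/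
def mergeSet {n : ℕ} (a : Fin (n + 1)) (S : Finset (Fin (n + 2))) : Finset (Fin (n + 1)) :=
  S.image a.predAbove

lemma mem_mergeSet {n : ℕ} (a : Fin (n + 1)) (S : Finset (Fin (n + 2))) (l : Fin (n + 1)) :
    l ∈ mergeSet a S ↔ a.succ.succAbove l ∈ S ∨ (l = a ∧ a.succ ∈ S) := by
  simp only [mergeSet, Finset.mem_image]
  constructor
  · rintro ⟨j, hj, rfl⟩
    by_cases h : j = a.succ
    · subst h
      exact Or.inr ⟨Fin.predAbove_succ_self a, hj⟩
    · obtain ⟨m, rfl⟩ := Fin.exists_succAbove_eq h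
      rw [predAbove_succAbove']
      exact Or.inl hj
  · rintro (h | ⟨rfl, h⟩)
    · exact ⟨_, h, predAbove_succAbove' a l⟩
    · exact ⟨_, h, Fin.predAbove_succ_self l⟩

lemma card_mergeSet_of_succ {n : ℕ} (a : Fin (n + 1)) (S : Finset (Fin (n + 2)))
    (h : a.succ ∉ S) : (mergeSet a S).card = S.card := by
  refine Finset.card_image_of_injOn ?_
  intro i hi j hj e
  obtain ⟨l, rfl⟩ := Fin.exists_succAbove_eq (fun e => h (e ▸ hi) : i ≠ a.succ)
  obtain ⟨m, rfl⟩ := Fin.exists_succAbove_eq (fun e => h (e ▸ hj) : j ≠ a.succ)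
  simp only [predAbove_succAbove'] at e
  rw [e]

lemma card_mergeSet_of_castSucc {n : ℕ} (a : Fin (n + 1)) (S : Finset (Fin (n + 2)))
    (h : a.castSucc ∉ S) : (mergeSet a S).card = S.card := by
  refine Finset.card_image_of_injOn ?_
  intro i hi j hj e
  obtain ⟨l, rfl⟩ := Fin.exists_succAbove_eq (fun e => h (e ▸ hi) : i ≠ a.castSucc)
  obtain ⟨m, rfl⟩ := Fin.exists_succAbove_eq (fun e => h (e ▸ hj) : j ≠ a.castSucc)
  simp only [Fin.predAbove_succAbove] at e
  rw [e]

lemma card_mergeSet_of_both {n : ℕ} (a : Fin (n + 1)) (S : Finset (Fin (n + 2)))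
    (h : a.castSucc ∈ S) (h' : a.succ ∈ S) : (mergeSet a S).card + 1 = S.card := by
  have e : mergeSet a S = mergeSet a (S.erase a.succ) := by
    ext l
    simp only [mem_mergeSet, Finset.mem_erase, ne_eq, not_true_eq_false, false_and, and_false,
      or_false, Fin.succAbove_ne, not_false_eq_true, true_and]
    constructor
    · rintro (hl | ⟨rfl, -⟩)
      · exact hl
      · simpa using h
    · exact Or.inl
  rw [e, card_mergeSet_of_succ _ _ (by simp), Finset.card_erase_add_one h']

lemma isWord_contract (β : E →ₗ[k] E →ₗ[k] E) {n : ℕ} (a : Fin (n + 1))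
    {S : Finset (Fin (n + 2))} {x : Fin (n + 2) → E} (hx : c.IsWord S x)
    (h1 : a ∈ mergeSet a S → c.p (β (x a.castSucc) (x a.succ)) = 0)
    (h2 : a ∉ mergeSet a S → β (x a.castSucc) (x a.succ) ∈ c.i.range) :
    c.IsWord (mergeSet a S) (contract β a x) := by
  intro l
  by_cases hl : l = a
  · subst hl
    rw [contract_self]
    exact ⟨h1, h2⟩
  · rw [contract_ne _ _ _ hl, mem_mergeSet]
    simp only [hl, false_and, or_false]
    exact hx _

lemma isWord_rot {n : ℕ} (i : Fin (n + 1)) {S : Finset (Fin (n + 1))} {x : Fin (n + 1) → E}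
    (hx : c.IsWord S x) :
    c.IsWord (S.map (Equiv.subRight i).toEmbedding) (fun j => x (j + i)) := by
  intro j
  have : j ∈ S.map (Equiv.subRight i).toEmbedding ↔ j + i ∈ S := by
    simp only [Finset.mem_map_equiv]
    rfl
  rw [this]
  exact hx _

/-- A face for `mu` sends a very simple tensor to a very simple tensor with the same number of
entries from `M`, or to zero. -/
lemma inner_mu {n w : ℕ} (a : Fin (n + 1)) {S : Finset (Fin (n + 2))} {x : Fin (n + 2) → E}
    (h0 : ∃ s ∈ S, a.predAbove s = 0) (hS : S.card = w + 1) (hx : c.IsWord S x) :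
    (relations (c.base K) n).mkQ (inner c.mu a (PiTensorProduct.tprod k x)) ∈ c.X K n w := by
  rw [inner_tprod]
  have h0' : 0 ∈ mergeSet a S := by simpa [mergeSet] using h0
  have hA := hx a.castSucc
  have hB := hx a.succ
  have hmem := mem_mergeSet a S a
  rw [Fin.succAbove_succ_self] at hmem
  have hker : c.p (x a.castSucc) = 0 ∨ c.p (x a.succ) = 0 →
      c.p (c.mu (x a.castSucc) (x a.succ)) = 0 := by
    rintro (h | h) <;> simp [mu_apply, h, p_projM]
  have hcard : ¬ (a.castSucc ∈ S ∧ a.succ ∈ S) → (mergeSet a S).card = w + 1 := by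
    intro h
    by_cases h1 : a.succ ∈ S
    · rw [card_mergeSet_of_castSucc a S (fun h2 => h ⟨h2, h1⟩), hS]
    · rw [card_mergeSet_of_succ a S h1, hS]
  by_cases hb : a.castSucc ∈ S ∧ a.succ ∈ S
  · rw [tprod_zero _ a]
    · simp
    · rw [contract_self, mu_apply, c.projM_of_ker (hA.1 hb.1), c.projM_of_ker (hB.1 hb.2),
        sub_self]
  · refine c.cls_mem K h0' (hcard hb) (c.isWord_contract _ a hx (fun h => ?_) (fun h => ?_))
    · rw [hmem] at h
      rcases h with h | ⟨-, h⟩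
      · exact hker (Or.inl (hA.1 h))
      · exact hker (Or.inr (hB.1 h))
    · rw [hmem] at h
      push Not at h
      have hA' := hA.2 h.1
      have hB' := hB.2 (h.2 rfl)
      rw [mu_apply, c.projM_of_range hA', zero_mul, sub_zero]
      exact mul_mem hA' hB'

/-- A face for `nabla` sends a very simple tensor to a very simple tensor with one entry from `M`
less, or to zero. -/
lemma inner_nabla {n w : ℕ} (a : Fin (n + 1)) {S : Finset (Fin (n + 2))} {x : Fin (n + 2) → E}
    (h0 : ∃ s ∈ S, a.predAbove s = 0) (hS : S.card = w + 2) (hx : c.IsWord S x) :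
    (relations (c.base K) n).mkQ (inner c.nabla a (PiTensorProduct.tprod k x)) ∈
      c.X K n w := by
  rw [inner_tprod]
  have h0' : 0 ∈ mergeSet a S := by simpa [mergeSet] using h0
  have hA := hx a.castSucc
  have hB := hx a.succ
  by_cases hb : a.castSucc ∈ S ∧ a.succ ∈ S
  · have hcard := card_mergeSet_of_both a S hb.1 hb.2
    refine c.cls_mem K h0' (by omega) (c.isWord_contract _ a hx (fun _ => ?_) (fun h => ?_))
    · simp [nabla_apply, p_projM]
    · rw [mem_mergeSet] at h
      exact absurd (Or.inr ⟨rfl, hb.2⟩) h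
  · rw [tprod_zero _ a]
    · simp
    · rw [contract_self, nabla_apply]
      by_cases h1 : a.castSucc ∈ S
      · rw [c.projM_of_range (hB.2 fun h => hb ⟨h1, h⟩), mul_zero]
      · rw [c.projM_of_range (hA.2 h1), zero_mul]

/-- The hypotheses on the places of `M` for the last face. -/
lemma outer_places {n : ℕ} {S : Finset (Fin (n + 2))} (h0 : 0 ∈ S) :
    ∃ s ∈ S.map (Equiv.subRight (Fin.last (n + 1))).toEmbedding,
      (0 : Fin (n + 1)).predAbove s = 0 := by
  refine ⟨1, ?_, rfl⟩
  rw [Finset.mem_map_equiv]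
  have : (Equiv.subRight (Fin.last (n + 1))).symm 1 = (0 : Fin (n + 2)) := by
    exact (add_comm (1 : Fin (n + 2)) _).trans (Fin.last_add_one (n + 1))
  rwa [this]

lemma hochschild_mem (n w : ℕ) (z : Chain (c.base K) (n + 1)) (hz : z ∈ c.X K (n + 1) w) :
    Submodule.mapQ _ _ (cyclicSum c.mu n) (cyclicSum_unital (c.mu_unital K) n) z ∈
      c.X K n w := by
  refine (Submodule.span_le (p := (c.X K n w).comap _)).2 ?_ hz
  rintro _ ⟨S, x, h0, hS, hx, rfl⟩
  simp only [cls, SetLike.mem_coe, Submodule.mem_comap, Submodule.mkQ_apply,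
    Submodule.mapQ_apply, cyclicSum, openSum, LinearMap.add_apply, LinearMap.smul_apply,
    LinearMap.sum_apply]
  simp only [← Submodule.mkQ_apply, map_add, map_sum, map_smul]
  refine add_mem (sum_mem fun a _ => Submodule.smul_mem _ _ ?_) (Submodule.smul_mem _ _ ?_)
  · exact c.inner_mu K a ⟨0, h0, by simp⟩ hS hx
  · rw [outer, LinearMap.comp_apply, rot_tprod]
    exact c.inner_mu K 0 (outer_places h0) (by simpa using hS) (c.isWord_rot _ hx)

lemma inner_nabla_mem {n w : ℕ} {S : Finset (Fin (n + 2))} {x : Fin (n + 2) → E} (h0 : 0 ∈ S)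
    (hS : S.card = w + 2) (hx : c.IsWord S x) :
    (relations (c.base K) n).mkQ (openSum c.nabla n (PiTensorProduct.tprod k x)) ∈
      c.X K n w := by
  simp only [openSum, LinearMap.smul_apply, LinearMap.sum_apply, map_sum, map_smul]
  exact sum_mem fun a _ => Submodule.smul_mem _ _ (c.inner_nabla K a ⟨0, h0, by simp⟩ hS hx)

lemma openNabla_mem (n w : ℕ) (z : Chain (c.base K) (n + 1)) (hz : z ∈ c.X K (n + 1) (w + 1)) :
    Submodule.mapQ _ _ (openSum c.nabla n) (openSum_vanishing (c.nabla_vanishing K) n) z ∈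
      c.X K n w := by
  refine (Submodule.span_le (p := (c.X K n w).comap _)).2 ?_ hz
  rintro _ ⟨S, x, h0, hS, hx, rfl⟩
  exact c.inner_nabla_mem K h0 hS hx

lemma cyclicNabla_mem (n w : ℕ) (z : Chain (c.base K) (n + 1))
    (hz : z ∈ c.X K (n + 1) (w + 1)) :
    Submodule.mapQ _ _ (cyclicSum c.nabla n) (cyclicSum_vanishing (c.nabla_vanishing K) n) z ∈
      c.X K n w := by
  refine (Submodule.span_le (p := (c.X K n w).comap _)).2 ?_ hz
  rintro _ ⟨S, x, h0, hS, hx, rfl⟩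
  simp only [cls, SetLike.mem_coe, Submodule.mem_comap, Submodule.mkQ_apply,
    Submodule.mapQ_apply, cyclicSum, LinearMap.add_apply, LinearMap.smul_apply]
  simp only [← Submodule.mkQ_apply, map_add, map_smul]
  refine add_mem (c.inner_nabla_mem K h0 hS hx) (Submodule.smul_mem _ _ ?_)
  rw [outer, LinearMap.comp_apply, rot_tprod]
  exact c.inner_nabla K 0 (outer_places h0) (by simpa using hS) (c.isWord_rot _ hx)

/-- `b : X_{vw} → X_{v-1,w}`, the Hochschild boundary formula for the product in which two
elements of `M` multiply to zero. -/
def b (n w : ℕ) : c.X K (n + 1) w →ₗ[k] c.X K n w :=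
  (Submodule.mapQ _ _ (cyclicSum c.mu n) (cyclicSum_unital (c.mu_unital K) n)).restrict
    (c.hochschild_mem K n w)

/-- `d' : X_{v,w+1} → X_{vw}`, the sum of the terms
`(-1)^j x₀ ⊗ ⋯ ⊗ xⱼ ▽ xⱼ₊₁ ⊗ ⋯` without the cyclic one. -/
def d' (n w : ℕ) : c.X K (n + 1) (w + 1) →ₗ[k] c.X K n w :=
  (Submodule.mapQ _ _ (openSum c.nabla n) (openSum_vanishing (c.nabla_vanishing K) n)).restrict
    (c.openNabla_mem K n w)

/-- `d : X_{v,w+1} → X_{vw}`, the same sum as for `d'` together with the cyclic term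
`(-1)^{n+1} xₙ₊₁ ▽ x₀ ⊗ x₁ ⊗ ⋯ ⊗ xₙ`. -/
def d (n w : ℕ) : c.X K (n + 1) (w + 1) →ₗ[k] c.X K n w :=
  (Submodule.mapQ _ _ (cyclicSum c.nabla n)
    (cyclicSum_vanishing (c.nabla_vanishing K) n)).restrict (c.cyclicNabla_mem K n w)

/-! ### The cyclic operator -/

/-- The map which is applied to the entry at the place `j` in order to project onto the tensors
whose last entry from `M` is the one at the place `i`. -/
def lastEntry {n : ℕ} (i j : Fin (n + 1)) : E →ₗ[k] E :=
  if j < i then LinearMap.id else if j = i then c.projM else c.projA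

/-- The projection onto the span of the very simple tensors whose last entry from `M` is the one
at the place `i`. -/
def lastProj {n : ℕ} (i : Fin (n + 1)) : Ten k E n →ₗ[k] Ten k E n :=
  PiTensorProduct.map (c.lastEntry i)

/-- The map which sends a very simple tensor `x₀ ⊗ ⋯ ⊗ xₙ`, whose last entry from `M` is at the
place `i`, to `(-1)^{in} xᵢ ⊗ ⋯ ⊗ xₙ ⊗ x₀ ⊗ ⋯ ⊗ xᵢ₋₁`, and tensors without an entry from `M` to
zero. -/
def tTen (n : ℕ) : Ten k E n →ₗ[k] Ten k E n :=
  ∑ i : Fin (n + 1), (-1 : k) ^ ((i : ℕ) * n) • (rot i ∘ₗ c.lastProj i)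

lemma lastProj_tprod {n : ℕ} (i : Fin (n + 1)) (x : Fin (n + 1) → E) :
    c.lastProj i (PiTensorProduct.tprod k x) =
      PiTensorProduct.tprod k (fun j => c.lastEntry i j (x j)) := by
  rw [lastProj, PiTensorProduct.map_tprod]

lemma lastEntry_left {n : ℕ} (i j : Fin (n + 1)) {r : E} (hr : r ∈ c.i.range) (x : E) :
    c.lastEntry i j (r * x) = r * c.lastEntry i j x := by
  unfold lastEntry
  split_ifs
  · rfl
  · exact c.projM_left hr x
  · exact c.projA_left hr x

lemma lastEntry_right {n : ℕ} (i j : Fin (n + 1)) {r : E} (hr : r ∈ c.i.range) (x : E) :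
    c.lastEntry i j (x * r) = c.lastEntry i j x * r := by
  unfold lastEntry
  split_ifs
  · rfl
  · exact c.projM_right hr x
  · exact c.projA_right hr x

lemma lastEntry_update {n : ℕ} (i m : Fin (n + 1)) (x : Fin (n + 1) → E) (v : E) :
    (fun j => c.lastEntry i j (Function.update x m v j)) =
      Function.update (fun j => c.lastEntry i j (x j)) m (c.lastEntry i m v) := by
  funext j
  by_cases h : j = m
  · subst h; simp
  · simp [h]

lemma tTen_le (n : ℕ) :
    relations (c.base K) n ≤ (relations (c.base K) n).comap (c.tTen n) := by
  refine relations_le_comap _ (fun x m r hr => ?_) (fun x m hm hx => ?_)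
  · have hr' := c.base_le K r hr
    rw [← map_sub]
    simp only [tTen, LinearMap.smul_apply, LinearMap.sum_apply, LinearMap.comp_apply]
    refine Submodule.mem_sup_left (sum_mem fun i _ => Submodule.smul_mem _ _ ?_)
    refine rot_le_balanced _ i ?_
    rw [map_sub, lastProj_tprod, lastProj_tprod, lastEntry_update, lastEntry_update,
      c.lastEntry_left _ _ hr', c.lastEntry_right _ _ hr']
    exact bal_mem _ _ m hr
  · simp only [tTen, LinearMap.smul_apply, LinearMap.sum_apply, LinearMap.comp_apply]
    refine Submodule.mem_sup_right (sum_mem fun i _ => Submodule.smul_mem _ _ ?_)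
    rw [lastProj_tprod, rot_tprod]
    have hx' := c.base_le K _ hx
    by_cases h : m = i
    · subst h
      rw [tprod_zero _ 0]
      · exact zero_mem _
      · simp [lastEntry, c.projM_of_range hx']
    · refine deg_mem _ _ (m - i) (sub_ne_zero.2 h) ?_
      simp only [sub_add_cancel]
      unfold lastEntry
      rw [if_neg h]
      split_ifs
      · exact hx
      · rw [projA_apply, c.i_p hx']
        exact hx

lemma t_mem (n w : ℕ) (z : Chain (c.base K) n) (hz : z ∈ c.X K n w) :
    Submodule.mapQ _ _ (c.tTen n) (c.tTen_le K n) z ∈ c.X K n w := by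
  refine (Submodule.span_le (p := (c.X K n w).comap _)).2 ?_ hz
  rintro _ ⟨S, x, h0, hS, hx, rfl⟩
  simp only [cls, SetLike.mem_coe, Submodule.mem_comap, Submodule.mkQ_apply,
    Submodule.mapQ_apply, tTen, LinearMap.smul_apply, LinearMap.sum_apply, LinearMap.comp_apply]
  simp only [← Submodule.mkQ_apply, map_sum, map_smul]
  refine sum_mem fun i _ => Submodule.smul_mem _ _ ?_
  rw [lastProj_tprod]
  by_cases hi : i ∈ S
  · rw [rot_tprod]
    have hy : c.IsWord S (fun j => c.lastEntry i j (x j)) := by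
      intro j
      simp only [lastEntry]
      split_ifs with h1 h2
      · exact hx j
      · subst h2
        exact ⟨fun _ => c.p_projM _, fun h => absurd hi h⟩
      · exact ⟨fun h => by rw [p_projA]; exact (hx j).1 h, fun _ => ⟨_, rfl⟩⟩
    refine c.cls_mem K ?_ (by simpa using hS) (c.isWord_rot i hy)
    rw [Finset.mem_map_equiv]
    have : (Equiv.subRight i).symm 0 = i := by
      change 0 + i = i
      rw [zero_add]
    rwa [this]
  · rw [tprod_zero _ i]
    · simp
    · simp [lastEntry, c.projM_of_range ((hx i).2 hi)]

/-- The cyclic operator `t : X_{vw} → X_{vw}`. -/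
def t (n w : ℕ) : c.X K n w →ₗ[k] c.X K n w :=
  (Submodule.mapQ _ _ (c.tTen n) (c.tTen_le K n)).restrict (c.t_mem K n w)

/-- `N = 1 + t + ⋯ + t^w`. -/
def N (n w : ℕ) : c.X K n w →ₗ[k] c.X K n w :=
  ∑ l ∈ Finset.range (w + 1), c.t K n w ^ l

/-- The homotopy `σ = (1 / (w + 1)) id`. -/
def sigma [Algebra ℚ k] (n w : ℕ) : c.X K n w →ₗ[k] c.X K n w :=
  algebraMap ℚ k (1 / (w + 1)) • LinearMap.id

/-- The homotopy `σ' = ∑_{j < w} ((w - j) / (w + 1)) t^j`. -/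
def sigma' [Algebra ℚ k] (n w : ℕ) : c.X K n w →ₗ[k] c.X K n w :=
  ∑ j ∈ Finset.range w, algebraMap ℚ k (((w : ℚ) - j) / (w + 1)) • c.t K n w ^ j

/-- The map `1 - t`. -/
abbrev oneSubT (n w : ℕ) : c.X K n w →ₗ[k] c.X K n w := LinearMap.id - c.t K n w

/-- The cokernel of `1 - t` on `X_{vw}`. -/
def Xbar (n w : ℕ) := Coker (c.oneSubT K n w)

instance (n w : ℕ) : AddCommGroup (c.Xbar K n w) :=
  instAddCommGroupCoker (c.oneSubT K n w)

instance (n w : ℕ) : Module k (c.Xbar K n w) :=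
  instModuleCoker (c.oneSubT K n w)

/-- The boundary `X̄_{vw} → X̄_{v-1,w}` induced by `b`. -/
def bBar (hb : ∀ n w, c.b K n w ∘ₗ c.oneSubT K (n + 1) w = c.oneSubT K n w ∘ₗ c.b K n w)
    (n w : ℕ) : c.Xbar K (n + 1) w →ₗ[k] c.Xbar K n w :=
  cokerMap (hb n w)

/-- The boundary `X̄_{v,w+1} → X̄_{vw}` induced by `d`. -/
def dBar (hd : ∀ n w, c.d K n w ∘ₗ c.oneSubT K (n + 1) (w + 1) =
      c.oneSubT K n w ∘ₗ c.d' K n w)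
    (n w : ℕ) : c.Xbar K (n + 1) (w + 1) →ₗ[k] c.Xbar K n w :=
  cokerMap (hd n w)

/-- The homology of the total complex of `(X̄, b̄, d̄)`. -/
abbrev homologyXbar
    (hb : ∀ n w, c.b K n w ∘ₗ c.oneSubT K (n + 1) w = c.oneSubT K n w ∘ₗ c.b K n w)
    (hd : ∀ n w, c.d K n w ∘ₗ c.oneSubT K (n + 1) (w + 1) =
      c.oneSubT K n w ∘ₗ c.d' K n w)
    (n : ℕ) :=
  Homology (Tot (fun m w => c.Xbar K m w))
    (tot (fun m w => c.Xbar K m w) (c.bBar K hb) (c.dBar K hd)) n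

/-- The relative cyclic homology `HC^K_n(E, M)` with `M = ker p`: the cyclic homology of the kernel
of the map `(E ⊗ (E/K)^{⊗ *} ⊗, b, B) → (A ⊗ (A/K)^{⊗ *} ⊗, b, B)` induced by `p`
(the image of `i(K)` under `p` is `K`). -/
abbrev relHC (n : ℕ) :=
  CyclicHomology (fun m => relChain c.p (c.base K) m) (relHochschild c.p (c.base K))
    (relConnes c.p (c.base K)) n

end CleftExt

end CleftHC

end

/-! Call a tensor with every entry in M or in A a word. For a word x of degree n with first entry in
M, let R be the number of A-entries behind its last M-entry, and let τ be the signed rotation by one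
place. Then t x = τ^(R+1) x. The decisive auxiliary map is s(x) = 1 ⊗ (x + τ x + ⋯ + τ^R x), which
raises the degree by one. Write ∂ and B for the Hochschild boundary and the Connes operator of E.

The product of E is the sum of `c.mu` and `c.nabla`, so ∂ restricts to b + d on X
(`hochschild_incl`). The formula ∂(1 ⊗ z) = z - τ z - 1 ⊗ b'z, with b' the boundary without its
cyclic face, telescopes over the R + 1 rotations and gives ∂ s = (1 - t) - s (b + d')
(`hochschild_s`). Running t once through all M-entries of a word performs a full rotation; hence
t^(w+1) = 1 and B = s N on X, while B s = 0 (`tTen_pow_word`, `connes_incl`, `connes_sChain`). The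
maps `incl` and `s` are jointly injective (`Phi_incl`, `Phi_s`, `retr_s`). So X ⊕ sX is a small
mixed subcomplex of the relative complex: it is the cone of 1 - t from (X, -b, -d') to (X, b, d),
and its B is N from the first summand to the second.

The identities for the double complexes and the relations b(1 - t) = (1 - t)b, d(1 - t) = (1 - t)d'
are therefore not computed term by term. They are the components of ∂² = 0 on X and on sX (`bd_bd`,
`bd_sub_tTot`, `bd'_bd'`).

The relative complex has the same ∂-homology as the small one. The remaining words have first entry
in A, and the homotopy x ↦ 1 ⊗ x shortens the block of entries behind an M-entry, so that finitely
many corrections push everything into the small subcomplex (`headDefect_mem`,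
`exists_sub_mem_small`). A comparison of the total complexes turns this into an isomorphism of
cyclic homology.

Finally, ℚ ⊆ k makes the rows contractible (`geom_homotopy`, an identity of polynomials in t). The
projection of the small complex to the cokernel of 1 - t then has a kernel that contributes nothing
to cyclic homology (`exists_of_Phi_hochschild`, `CyclicHomology.nonempty_linearEquiv_of_kernel`). -/

noncomputable section

namespace CleftHC

/-! ### Comparison of the cyclic homology of a mixed complex with that of a subcomplex, and with the
homology of a quotient. -/

section HomologicalAlgebra

variable {k : Type*} [CommRing k]

/-- A chain map which is injective and surjective on homology in degree `n` induces an isomorphism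
there. -/
theorem Homology.nonempty_linearEquiv {C C' : ℕ → Type*} [∀ n, AddCommGroup (C n)]
    [∀ n, Module k (C n)] [∀ n, AddCommGroup (C' n)] [∀ n, Module k (C' n)]
    {D : ∀ n, C (n + 1) →ₗ[k] C n} {D' : ∀ n, C' (n + 1) →ₗ[k] C' n} (φ : ∀ n, C n →ₗ[k] C' n)
    (hφ : ∀ n x, φ n (D n x) = D' n (φ (n + 1) x)) (n : ℕ)
    (hinj : ∀ z ∈ cycles C D n, φ n z ∈ LinearMap.range (D' n) → z ∈ LinearMap.range (D n))
    (hsurj : ∀ z' ∈ cycles C' D' n, ∃ z ∈ cycles C D n, φ n z - z' ∈ LinearMap.range (D' n)) :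
    Nonempty (Homology C D n ≃ₗ[k] Homology C' D' n) := by
  have hcyc : ∀ z ∈ cycles C D n, φ n z ∈ cycles C' D' n := by
    cases n with
    | zero => exact fun _ _ => Submodule.mem_top
    | succ n =>
      intro z hz
      change D' n (φ (n + 1) z) = 0
      rw [← hφ, show D n z = 0 from hz, map_zero]
  let ψ : cycles C D n →ₗ[k] cycles C' D' n := (φ n).restrict hcyc
  have hψ : (LinearMap.range (D n)).submoduleOf (cycles C D n) ≤
      ((LinearMap.range (D' n)).submoduleOf (cycles C' D' n)).comap ψ := by
    rintro ⟨_, hz⟩ ⟨x, rfl⟩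
    exact ⟨φ (n + 1) x, (hφ n x).symm⟩
  refine ⟨LinearEquiv.ofBijective (Submodule.mapQ _ _ ψ hψ) ⟨?_, ?_⟩⟩
  · rw [injective_iff_map_eq_zero]
    intro a ha
    induction a using Submodule.Quotient.induction_on with
    | H z =>
      rw [Submodule.mapQ_apply, Submodule.Quotient.mk_eq_zero] at ha
      rw [Submodule.Quotient.mk_eq_zero]
      exact hinj z z.2 ha
  · intro a
    induction a using Submodule.Quotient.induction_on with
    | H z' =>
      obtain ⟨z, hz, h⟩ := hsurj z' z'.2
      refine ⟨Submodule.Quotient.mk ⟨z, hz⟩, ?_⟩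
      rw [Submodule.mapQ_apply, Submodule.Quotient.eq]
      exact h

variable {C : ℕ → Type*} [∀ n, AddCommGroup (C n)] [∀ n, Module k (C n)]
  (b : ∀ n, C (n + 1) →ₗ[k] C n) (B : ∀ n, C n →ₗ[k] C (n + 1))

/-- The operator `b + B` on the product of all the modules of a mixed complex. -/
def prodBC : (∀ m, C m) →ₗ[k] ∀ m, C m :=
  LinearMap.pi fun m => match m with
    | 0 => b 0 ∘ₗ LinearMap.proj 1
    | m + 1 => b (m + 1) ∘ₗ LinearMap.proj (m + 2) + B m ∘ₗ LinearMap.proj m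

@[simp] lemma prodBC_zero (g : ∀ m, C m) : prodBC b B g 0 = b 0 (g 1) := rfl

@[simp] lemma prodBC_succ (g : ∀ m, C m) (m : ℕ) :
    prodBC b B g (m + 1) = b (m + 1) (g (m + 2)) + B m (g m) := rfl

variable (k C) in
/-- The components of a family which appear in degree `n` of the total complex. -/
def resBC (n : ℕ) : (∀ m, C m) →ₗ[k] TotBC C n :=
  LinearMap.pi fun q => LinearMap.proj q.1.1

/-- In degree n the index j is determined by m, so the total complex is a quotient of the family of
all Cₘ. Computations can thus be made on families indexed by m alone, without dependent indices. -/
lemma totBC_resBC (n : ℕ) (g : ∀ m, C m) :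
    totBC C b B n (resBC k C (n + 1) g) = resBC k C n (prodBC b B g) := by
  funext q
  match q with
  | ⟨(0, j), h⟩ => rfl
  | ⟨(m + 1, j), h⟩ => rfl

lemma exists_resBC (n : ℕ) (r : TotBC C n) : ∃ g, resBC k C n g = r := by
  classical
  refine ⟨fun m => if h : ∃ j, m + 2 * j = n then r ⟨(m, h.choose), h.choose_spec⟩ else 0, ?_⟩
  funext q
  obtain ⟨⟨m, j⟩, h⟩ := q
  have h' : ∃ j, m + 2 * j = n := ⟨j, h⟩
  have e : h'.choose = j := by
    have h1 := h'.choose_spec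
    have h2 : m + 2 * j = n := h
    omega
  change (if h : ∃ j, m + 2 * j = n then r ⟨(m, h.choose), h.choose_spec⟩ else 0 : C m) = _
  rw [dif_pos h']
  have key : ∀ j' (h1 : m + 2 * j' = n), j' = j → r ⟨(m, j'), h1⟩ = r ⟨(m, j), h⟩ := by
    rintro _ _ rfl
    rfl
  exact key _ _ e

lemma prodBC_prodBC (h : IsMixedComplex C b B) (g : ∀ m, C m) :
    prodBC b B (prodBC b B g) = 0 := by
  have hbb := fun n x => LinearMap.congr_fun (h.b_b n) x
  have hBB := fun n x => LinearMap.congr_fun (h.B_B n) x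
  have hbB0 := fun x => LinearMap.congr_fun h.b_B_zero x
  have hbB := fun n x => LinearMap.congr_fun (h.b_B n) x
  simp only [LinearMap.comp_apply, LinearMap.add_apply, LinearMap.zero_apply] at hbb hBB hbB0 hbB
  funext m
  match m with
  | 0 => simp [hbb, hbB0]
  | 1 =>
    have := hbB 0 (g 1)
    simp only [prodBC_succ, prodBC_zero, map_add, hbb, zero_add] at this ⊢
    exact this
  | m + 2 =>
    simp only [prodBC_succ, map_add, hbb, zero_add, hBB, add_zero, Pi.zero_apply]
    exact hbB _ _

/-- A correction u in degree M + 1 is felt only in degree M, through b, and in degree M + 2, through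
B. The second effect is excluded here because the inductions below treat it in different ways. -/
lemma prodBC_single_succ [∀ n, DecidableEq (C n)] (M : ℕ) (u : C (M + 1)) (m : ℕ)
    (hm : m ≠ M + 2) : prodBC b B (Pi.single (M + 1) u) m = if h : m = M then h ▸ b M u else 0 := by
  by_cases h : m = M
  · subst h
    rw [dif_pos rfl]
    cases m with
    | zero => simp
    | succ m =>
      rw [prodBC_succ, Pi.single_eq_same, Pi.single_eq_of_ne (by omega), map_zero, add_zero]
  · rw [dif_neg h]
    cases m with
    | zero => rw [prodBC_zero, Pi.single_eq_of_ne (by omega), map_zero]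
    | succ m =>
      rw [prodBC_succ, Pi.single_eq_of_ne (by omega), Pi.single_eq_of_ne (by omega), map_zero,
        map_zero, add_zero]

/-- The boundary of the total complex in degree n has components only in the degrees n - 1, n - 3,
and so on. In particular a cycle need not satisfy B gₙ = 0. -/
lemma cycles_totBC (n : ℕ) (g : ∀ m, C m) : resBC k C n g ∈ cycles (TotBC C) (totBC C b B) n ↔
    ∀ m j, m + 1 + 2 * j = n → prodBC b B g m = 0 := by
  cases n with
  | zero => exact ⟨fun _ m j h => by omega, fun _ => Submodule.mem_top⟩
  | succ n =>
    change totBC C b B n _ = 0 ↔ _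
    rw [totBC_resBC]
    constructor
    · intro h m j e
      exact congrFun h ⟨(m, j), by change m + 2 * j = n; omega⟩
    · intro h
      funext q
      obtain ⟨⟨m, j⟩, e⟩ := q
      exact h m j (by have : m + 2 * j = n := e; omega)

/-- If the quotient of a mixed complex by a graded submodule `P` is acyclic for `b`, then it is so
for `b + B`. -/
theorem exists_prodBC_sub_mem (h : IsMixedComplex C b B) (P : ∀ n, Submodule k (C n))
    (hB : ∀ n, ∀ z ∈ P n, B n z ∈ P (n + 1)) (hzero : ∀ z, ∃ y, z - b 0 y ∈ P 0)
    (hsucc : ∀ n z, b n z ∈ P n → ∃ y, z - b (n + 1) y ∈ P (n + 1)) (n : ℕ) (r : ∀ m, C m)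
    (hr : ∀ m j, m + 1 + 2 * j = n → prodBC b B r m ∈ P m) :
    ∃ y : ∀ m, C m, ∀ m j, m + 2 * j = n → (r - prodBC b B y) m ∈ P m := by
  classical
  -- The components are moved into P from the bottom degree upwards. A correction in degree M + 1
  -- disturbs only degree M + 2, which is treated later.
  suffices H : ∀ M, ∃ y : ∀ m, C m, ∀ m j, m + 2 * j = n → m < M →
      (r - prodBC b B y) m ∈ P m by
    obtain ⟨y, hy⟩ := H (n + 1)
    exact ⟨y, fun m j e => hy m j e (by omega)⟩
  intro M
  induction M with
  | zero => exact ⟨0, fun m j _ h => absurd h (Nat.not_lt_zero m)⟩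
  | succ M ih =>
    obtain ⟨y, hy⟩ := ih
    by_cases hM : ∃ j, M + 2 * j = n
    swap
    · refine ⟨y, fun m j e hm => hy m j e ?_⟩
      rcases Nat.lt_succ_iff_lt_or_eq.1 hm with h | rfl
      · exact h
      · exact absurd ⟨j, e⟩ hM
    obtain ⟨j, hj⟩ := hM
    have key : ∃ u, (r - prodBC b B y) M - b M u ∈ P M := by
      set z := r - prodBC b B y with hz
      -- Subtracting a boundary does not change b + B. Hence the hypothesis in degree M - 1 says
      -- that b z_M + B z_(M-2) lies in P, and the second summand already does.
      have hz' : prodBC b B z = prodBC b B r := by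
        rw [hz, map_sub, prodBC_prodBC b B h, sub_zero]
      match M with
      | 0 => exact hzero _
      | 1 =>
        refine hsucc 0 _ ?_
        have := hr 0 j (by omega)
        rwa [← hz', prodBC_zero] at this
      | m + 2 =>
        refine hsucc (m + 1) _ ?_
        have h1 := hr (m + 1) j (by omega)
        rw [← hz', prodBC_succ] at h1
        have h2 := hB m _ (hy m (j + 1) (by omega) (by omega))
        exact (Submodule.add_mem_iff_left _ h2).1 h1
    obtain ⟨u, hu⟩ := key
    refine ⟨y + Pi.single (M + 1) u, fun m j' e hm => ?_⟩
    rw [map_add, ← sub_sub, Pi.sub_apply, prodBC_single_succ b B M u m (by omega)]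
    split_ifs with hmM
    · subst hmM
      exact hu
    · rw [sub_zero]
      exact hy m j' e (by omega)

/-- If the quotient of a mixed complex by a mixed subcomplex `P` is acyclic for `b`, then the
inclusion induces an isomorphism in cyclic homology. -/
theorem CyclicHomology.nonempty_linearEquiv_of_sub (h : IsMixedComplex C b B)
    (P : ∀ n, Submodule k (C n)) (hb : ∀ n, ∀ z ∈ P (n + 1), b n z ∈ P n)
    (hB : ∀ n, ∀ z ∈ P n, B n z ∈ P (n + 1)) (hzero : ∀ z, ∃ y, z - b 0 y ∈ P 0)
    (hsucc : ∀ n z, b n z ∈ P n → ∃ y, z - b (n + 1) y ∈ P (n + 1)) (n : ℕ) :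
    Nonempty (CyclicHomology (fun n => P n) (fun n => (b n).restrict (hb n))
      (fun n => (B n).restrict (hB n)) n ≃ₗ[k] CyclicHomology C b B n) := by
  let ι : ∀ n, TotBC (fun n => P n) n →ₗ[k] TotBC C n := fun n =>
    LinearMap.pi fun q => (P q.1.1).subtype ∘ₗ LinearMap.proj q
  have hι : ∀ n x, ι n (totBC (fun n => P n) (fun n => (b n).restrict (hb n))
      (fun n => (B n).restrict (hB n)) n x) = totBC C b B n (ι (n + 1) x) := by
    intro n x
    funext q
    match q with
    | ⟨(0, j), h⟩ => rfl
    | ⟨(m + 1, j), h⟩ => rfl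
  have hιinj : ∀ n, Function.Injective (ι n) := fun n x y e =>
    funext fun q => Subtype.ext (congrFun e q)
  have hlift : ∀ n (g : ∀ m, C m), (∀ m j, m + 2 * j = n → g m ∈ P m) →
      ∃ x, ι n x = resBC k C n g := fun n g hg =>
    ⟨fun q => ⟨g q.1.1, hg _ _ q.2⟩, rfl⟩
  refine Homology.nonempty_linearEquiv ι hι n ?_ ?_
  · rintro z hz ⟨r, hr⟩
    obtain ⟨g, rfl⟩ := exists_resBC (k := k) _ r
    rw [totBC_resBC] at hr
    obtain ⟨y, hy⟩ := exists_prodBC_sub_mem b B h P hB hzero hsucc (n + 1) g (by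
      intro m j e
      have hj : m + 2 * j = n := by omega
      have := congrFun hr ⟨(m, j), hj⟩
      change prodBC b B g m = z ⟨(m, j), hj⟩ at this
      rw [this]
      exact (z ⟨(m, j), hj⟩).2)
    obtain ⟨x, hx⟩ := hlift _ _ hy
    refine ⟨x, hιinj _ ?_⟩
    rw [hι, hx, totBC_resBC, map_sub, prodBC_prodBC b B h, sub_zero, hr]
  · intro z' hz'
    obtain ⟨g, rfl⟩ := exists_resBC (k := k) _ z'
    rw [cycles_totBC] at hz'
    obtain ⟨y, hy⟩ := exists_prodBC_sub_mem b B h P hB hzero hsucc n g (by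
      intro m j e
      rw [hz' m j e]
      exact zero_mem _)
    obtain ⟨x, hx⟩ := hlift _ _ hy
    refine ⟨x, ?_, ?_⟩
    · cases n with
      | zero => exact Submodule.mem_top
      | succ n =>
        change totBC _ _ _ n x = 0
        apply hιinj
        rw [hι, hx, map_zero, totBC_resBC, map_sub, prodBC_prodBC b B h, sub_zero]
        have := (cycles_totBC b B (n + 1) g).2 hz'
        rwa [← totBC_resBC]
    · refine ⟨resBC k C (n + 1) (-y), ?_⟩
      rw [hx, totBC_resBC, map_sub, sub_sub_cancel_left, map_neg, map_neg]

/-- Let `f` be a surjective map from a mixed complex to a complex `(Y, D)` with `f ∘ B = 0`, which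
factors through a map `Φ` with `Φ ∘ B = 0`. If the kernel of `f` satisfies the exactness conditions
`hzero` and `hsucc`, then `f` induces an isomorphism from cyclic homology to homology. -/
theorem CyclicHomology.nonempty_linearEquiv_of_kernel (h : IsMixedComplex C b B)
    {Y : ℕ → Type*} [∀ n, AddCommGroup (Y n)] [∀ n, Module k (Y n)]
    (D : ∀ n, Y (n + 1) →ₗ[k] Y n) {Z : ℕ → Type*} [∀ n, AddCommGroup (Z n)]
    [∀ n, Module k (Z n)] (Φ : ∀ n, C n →ₗ[k] Z n) (f : ∀ n, C n →ₗ[k] Y n)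
    (hf : ∀ n, Function.Surjective (f n)) (hfb : ∀ n z, f n (b n z) = D n (f (n + 1) z))
    (hfB : ∀ n z, f (n + 1) (B n z) = 0) (hΦB : ∀ n z, Φ (n + 1) (B n z) = 0)
    (hker : ∀ n z, B n z = 0 → f n z = 0)
    (hzero : ∀ z, f 0 z = 0 → ∃ y, B 1 y = 0 ∧ f 1 y = 0 ∧ b 0 y = z)
    (hsucc : ∀ n z, f (n + 1) z = 0 → Φ n (b n z) = 0 →
      ∃ y v, B (n + 2) y = 0 ∧ f (n + 2) y = 0 ∧ b (n + 1) y + B n v = z) (n : ℕ) :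
    Nonempty (CyclicHomology C b B n ≃ₗ[k] Homology Y D n) := by
  classical
  have exact : ∀ (n : ℕ) (r : ∀ m, C m), (∀ m j, m + 1 + 2 * j = n → prodBC b B r m = 0) →
      f n (r n) = 0 → ∃ y : ∀ m, C m, f (n + 1) (y (n + 1)) = 0 ∧
        ∀ m j, m + 2 * j = n → (r - prodBC b B y) m = 0 := by
    intro n r hr hrn
    -- This induction runs downwards from the component in degree n. A component is written as b u +
    -- B v with B u = 0, so u does not spoil the degrees above, and v reaches further only through b
    -- v, two degrees below. The condition on f in degree n + 1 is carried along because the final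
    -- map sees only the top component.
    suffices H : ∀ M, ∃ y : ∀ m, C m, f (n + 1) (y (n + 1)) = 0 ∧
        ∀ m j, m + 2 * j = n → j < M → (r - prodBC b B y) m = 0 by
      obtain ⟨y, h1, hy⟩ := H (n + 1)
      exact ⟨y, h1, fun m j e => hy m j e (by omega)⟩
    intro M
    induction M with
    | zero => exact ⟨0, by simp, fun m j _ h => absurd h (Nat.not_lt_zero j)⟩
    | succ M ih =>
      obtain ⟨y, hy1, hy⟩ := ih
      by_cases hM : ∃ m, m + 2 * M = n
      swap
      · refine ⟨y, hy1, fun m j e hm => hy m j e ?_⟩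
        rcases Nat.lt_succ_iff_lt_or_eq.1 hm with h | rfl
        · exact h
        · exact absurd ⟨m, e⟩ hM
      obtain ⟨m, hm⟩ := hM
      set z := r - prodBC b B y with hz
      have hz' : prodBC b B z = prodBC b B r := by
        rw [hz, map_sub, prodBC_prodBC b B h, sub_zero]
      -- At the top this is the hypothesis on r. Further down, z already vanishes in degree m + 2,
      -- so the cycle condition in degree m + 1 reads B zₘ = 0 and `hker` applies.
      have hfz : f m (z m) = 0 := by
        rcases Nat.eq_zero_or_pos M with h0 | h0
        · obtain rfl : m = n := by omega
          rw [hz, Pi.sub_apply, map_sub, hrn, zero_sub, neg_eq_zero]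
          cases m with
          | zero => rw [prodBC_zero, hfb, hy1, map_zero]
          | succ m => rw [prodBC_succ, map_add, hfb, hy1, map_zero, hfB, add_zero]
        · apply hker
          have h1 := hr (m + 1) (M - 1) (by omega)
          rw [← hz', prodBC_succ, hy (m + 2) (M - 1) (by omega) (by omega), map_zero,
            zero_add] at h1
          exact h1
      match m with
      | 0 =>
        obtain ⟨u, hu1, hu2, hu3⟩ := hzero _ hfz
        refine ⟨y + Pi.single 1 u, ?_, fun m' j e hj => ?_⟩
        · rw [Pi.add_apply, map_add, hy1, zero_add]
          by_cases hn : n = 0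
          · subst hn
            rw [Pi.single_eq_same, hu2]
          · rw [Pi.single_eq_of_ne (by omega), map_zero]
        · rw [map_add, ← sub_sub, ← hz, Pi.sub_apply]
          by_cases h2 : m' = 2
          · subst h2
            rw [hy 2 j e (by omega), prodBC_succ, Pi.single_eq_same, hu1,
              Pi.single_eq_of_ne (by omega), map_zero, add_zero, sub_zero]
          · rw [prodBC_single_succ b B 0 u m' h2]
            split_ifs with h3
            · subst h3
              exact sub_eq_zero.2 hu3.symm
            · rw [sub_zero]
              exact hy m' j e (by omega)
      | m + 1 =>
        -- The cycle condition says that b of this component is minus a value of B, or zero at the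
        -- bottom, and Φ annihilates values of B.
        obtain ⟨u, v, hu1, hu2, hu3⟩ := hsucc m _ hfz (by
          have h1 := hr m M (by omega)
          rw [← hz'] at h1
          match m with
          | 0 => rw [← prodBC_zero b B, h1, map_zero]
          | m + 1 =>
            rw [prodBC_succ] at h1
            rw [eq_neg_of_add_eq_zero_left h1, map_neg, hΦB, neg_zero])
        refine ⟨y + (Pi.single (m + 2) u + Pi.single m v), ?_, fun m' j e hj => ?_⟩
        · rw [Pi.add_apply, Pi.add_apply, map_add, hy1, zero_add, map_add,
            Pi.single_eq_of_ne (i := m) (by omega), map_zero, add_zero]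
          by_cases hn : n = m + 1
          · subst hn
            rw [Pi.single_eq_same, hu2]
          · rw [Pi.single_eq_of_ne (by omega), map_zero]
        · rw [map_add, ← sub_sub, ← hz, Pi.sub_apply]
          obtain ⟨l, rfl⟩ : ∃ l, m' = m + 1 + 2 * l := ⟨M - j, by omega⟩
          rcases l with _ | _ | l
          · change z (m + 1) - prodBC b B _ (m + 1) = 0
            rw [prodBC_succ, Pi.add_apply, Pi.add_apply, Pi.single_eq_same, Pi.single_eq_same,
              Pi.single_eq_of_ne (by omega), Pi.single_eq_of_ne (by omega), add_zero, zero_add,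
              hu3, sub_self]
          · change z (m + 3) - prodBC b B _ (m + 2 + 1) = 0
            rw [prodBC_succ, Pi.add_apply, Pi.add_apply, Pi.single_eq_same,
              Pi.single_eq_of_ne (by omega), Pi.single_eq_of_ne (by omega),
              Pi.single_eq_of_ne (by omega), add_zero, map_zero, zero_add, add_zero, hu1,
              sub_zero]
            exact hy _ j e (by omega)
          · rw [hy _ j e (by omega)]
            change 0 - prodBC b B _ (m + 1 + 2 * l + 3 + 1) = 0
            rw [prodBC_succ, Pi.add_apply, Pi.add_apply,
              Pi.single_eq_of_ne (by omega), Pi.single_eq_of_ne (by omega),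
              Pi.single_eq_of_ne (by omega), Pi.single_eq_of_ne (by omega), add_zero, map_zero,
              zero_add, add_zero, map_zero, sub_zero]
  let F : ∀ n, TotBC C n →ₗ[k] Y n := fun n => f n ∘ₗ componentBC C n n 0 (by omega)
  have hF : ∀ n g, F n (resBC k C n g) = f n (g n) := fun _ _ => rfl
  have hFD : ∀ n x, F n (totBC C b B n x) = D n (F (n + 1) x) := by
    intro n x
    obtain ⟨g, rfl⟩ := exists_resBC (k := k) _ x
    rw [totBC_resBC, hF, hF]
    cases n with
    | zero => rw [prodBC_zero, hfb]
    | succ n => rw [prodBC_succ, map_add, hfb, hfB, add_zero]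
  have hlift : ∀ n y, ∃ g : ∀ m, C m, F n (resBC k C n g) = y := by
    intro n y
    obtain ⟨z, rfl⟩ := hf n y
    exact ⟨Pi.single n z, by rw [hF, Pi.single_eq_same]⟩
  have exact' : ∀ n z, z ∈ cycles (TotBC C) (totBC C b B) n → F n z = 0 →
      ∃ y, F (n + 1) y = 0 ∧ totBC C b B n y = z := by
    intro n z hz hz0
    obtain ⟨g, rfl⟩ := exists_resBC (k := k) _ z
    rw [cycles_totBC] at hz
    obtain ⟨y, hy1, hy⟩ := exact n g hz hz0
    refine ⟨resBC k C (n + 1) y, hy1, ?_⟩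
    rw [totBC_resBC]
    funext q
    exact (sub_eq_zero.1 (hy q.1.1 q.1.2 q.2)).symm
  have hcyc : ∀ n y, totBC C b B n y ∈ cycles (TotBC C) (totBC C b B) n := by
    intro n y
    obtain ⟨g, rfl⟩ := exists_resBC (k := k) _ y
    rw [totBC_resBC, cycles_totBC, prodBC_prodBC b B h]
    exact fun _ _ _ => rfl
  refine Homology.nonempty_linearEquiv F hFD n ?_ ?_
  · rintro z hz ⟨ξ, hξ⟩
    obtain ⟨g, rfl⟩ := hlift _ ξ
    rw [← hFD] at hξ
    obtain ⟨y, -, hy⟩ := exact' n (z - totBC C b B n (resBC k C (n + 1) g))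
      (sub_mem hz (hcyc _ _)) (by rw [map_sub, hξ, sub_self])
    exact ⟨y + resBC k C (n + 1) g, by rw [map_add, hy, sub_add_cancel]⟩
  · intro ξ hξ
    obtain ⟨g, rfl⟩ := hlift _ ξ
    cases n with
    | zero => exact ⟨_, Submodule.mem_top, by rw [sub_self]; exact zero_mem _⟩
    | succ n =>
      -- A lift of ξ need not be a cycle, but its boundary is a cycle killed by F. It is therefore
      -- the boundary of an element killed by F, which is subtracted from the lift.
      have h0 : F n (totBC C b B n (resBC k C (n + 1) g)) = 0 := by
        rw [hFD]
        exact hξ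
      obtain ⟨y, hy0, hy⟩ := exact' n _ (hcyc _ _) h0
      refine ⟨resBC k C (n + 1) g - y, ?_, ?_⟩
      · change totBC C b B n _ = 0
        rw [map_sub, hy, sub_self]
      · rw [map_sub, hy0, sub_zero, sub_self]
        exact zero_mem _

end HomologicalAlgebra

/-! ### Simple tensors as sequences indexed by ℕ, their faces and rotations. -/

section Sequences

variable {k : Type*} [CommRing k] {C : Type*} [Ring C] [Algebra k C]

variable (k) in
/-- The simple tensor of the first `n + 1` terms of a sequence. -/
def seqTen (n : ℕ) (x : ℕ → C) : Ten k C n := PiTensorProduct.tprod k fun j : Fin (n + 1) => x j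

lemma seqTen_congr {n : ℕ} {x y : ℕ → C} (h : ∀ l ≤ n, x l = y l) : seqTen k n x = seqTen k n y := by
  unfold seqTen
  congr 1
  funext j
  exact h j (by omega)

lemma exists_seqTen {n : ℕ} (x : Fin (n + 1) → C) :
    ∃ y : ℕ → C, (∀ j : Fin (n + 1), y j = x j) ∧ PiTensorProduct.tprod k x = seqTen k n y := by
  let y : ℕ → C := fun l => if h : l < n + 1 then x ⟨l, h⟩ else 0
  have h : ∀ j : Fin (n + 1), y j = x j := fun j => dif_pos j.2
  refine ⟨y, h, ?_⟩
  unfold seqTen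
  congr 1
  funext j
  exact (h j).symm

lemma ten_ext {V : Type*} [AddCommMonoid V] [Module k V] {n : ℕ} {f g : Ten k C n →ₗ[k] V}
    (h : ∀ x : ℕ → C, f (seqTen k n x) = g (seqTen k n x)) : f = g := by
  refine PiTensorProduct.ext (MultilinearMap.ext fun x => ?_)
  obtain ⟨y, -, hy⟩ := exists_seqTen (k := k) x
  simpa [hy] using h y

/-- The sequence `(x₀, …, β(xⱼ, xⱼ₊₁), …, xₙ)`; for `j = n` the last term is multiplied with the
first one. -/
def seqFace (β : C →ₗ[k] C →ₗ[k] C) (n j : ℕ) (x : ℕ → C) (l : ℕ) : C :=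
  if l = 0 ∧ j = n then β (x n) (x 0)
  else if l < j then x l else if l = j then β (x j) (x (j + 1)) else x (l + 1)

/-- The sequence `(xₙ, x₀, …, xₙ₋₁)`. -/
def seqRot (n : ℕ) (x : ℕ → C) (l : ℕ) : C := if l = 0 then x n else x (l - 1)

/-- The sequence `(1, x₀, x₁, …)`. -/
def seqCons (x : ℕ → C) (l : ℕ) : C := if l = 0 then 1 else x (l - 1)

/-- The `j`-th face, `0 ≤ j ≤ n + 1`, without sign. -/
def face (β : C →ₗ[k] C →ₗ[k] C) (n j : ℕ) : Ten k C (n + 1) →ₗ[k] Ten k C n :=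
  if h : j < n + 1 then inner β ⟨j, h⟩ else outer β n

lemma face_seqTen (β : C →ₗ[k] C →ₗ[k] C) (n j : ℕ) (hj : j ≤ n + 1) (x : ℕ → C) :
    face β n j (seqTen k (n + 1) x) = seqTen k n (seqFace β (n + 1) j x) := by
  unfold face
  split_ifs with h
  · rw [seqTen, inner_tprod, seqTen]
    congr 1
    funext l
    by_cases hl : l = ⟨j, h⟩
    · subst hl
      rw [contract_self, seqFace, if_neg (by rintro ⟨-, h'⟩; omega), if_neg (by simp),
        if_pos rfl]
      rfl
    · have hl' : (l : ℕ) ≠ j := fun e => hl (Fin.ext e)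
      rw [contract_ne _ _ _ hl, seqFace, if_neg (by rintro ⟨-, h'⟩; omega)]
      split_ifs with h1
      · rw [Fin.succAbove_of_castSucc_lt _ _ (Fin.lt_def.2 (by simp; omega))]
        rfl
      · rw [Fin.succAbove_of_lt_succ _ _ (Fin.lt_def.2 (by simp; omega))]
        rfl
  · obtain rfl : j = n + 1 := by omega
    rw [seqTen, outer_tprod, seqTen]
    congr 1
    funext l
    by_cases hl : l = 0
    · subst hl
      simp [seqFace]
    · have hl' : (l : ℕ) ≠ 0 := fun e => hl (Fin.ext e)
      rw [Function.update_of_ne hl, seqFace, if_neg (by rintro ⟨h', -⟩; omega),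
        if_pos (by omega)]
      rfl

lemma consOne_seqTen (n : ℕ) (x : ℕ → C) :
    consOne n (seqTen k n x) = seqTen k (n + 1) (seqCons x) := by
  rw [seqTen, consOne_tprod, seqTen]
  congr 1
  funext j
  refine Fin.cases ?_ (fun j => ?_) j <;> simp [seqCons]

lemma rot_seqTen (n : ℕ) (i : Fin (n + 1)) (x : ℕ → C) :
    rot i (seqTen k n x) =
      seqTen k n fun l => if l + i ≤ n then x (l + i) else x (l + i - (n + 1)) := by
  rw [seqTen, rot_tprod, seqTen]
  congr 1
  funext j
  have hj := j.2
  have hi := i.2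
  rw [Fin.val_add]
  split_ifs with h
  · rw [Nat.mod_eq_of_lt (by omega)]
  · rw [Nat.mod_eq_sub_mod (by omega), Nat.mod_eq_of_lt (by omega)]

variable (k C) in
/-- The signed rotation `x₀ ⊗ ⋯ ⊗ xₙ ↦ (-1)ⁿ xₙ ⊗ x₀ ⊗ ⋯ ⊗ xₙ₋₁`. -/
def cyc (n : ℕ) : Module.End k (Ten k C n) := (-1 : k) ^ n • rot (Fin.last n)

lemma cyc_seqTen (n : ℕ) (x : ℕ → C) :
    cyc k C n (seqTen k n x) = (-1 : k) ^ n • seqTen k n (seqRot n x) := by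
  rw [cyc, LinearMap.smul_apply, rot_seqTen]
  congr 1
  refine seqTen_congr fun l hl => ?_
  unfold seqRot
  simp only [Fin.val_last]
  split_ifs with h1 h2 h2
  · rw [h2, zero_add]
  · omega
  · omega
  · congr 1; omega

/-- The sequence `(xₙ₊₁₋ᵣ, …, xₙ, x₀, …, xₙ₋ᵣ)`. -/
def seqRots (n r : ℕ) (x : ℕ → C) (l : ℕ) : C := if l < r then x (l + (n + 1) - r) else x (l - r)

lemma cyc_pow_seqTen (n r : ℕ) (hr : r ≤ n + 1) (x : ℕ → C) :
    (cyc k C n ^ r) (seqTen k n x) = (-1 : k) ^ (r * n) • seqTen k n (seqRots n r x) := by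
  induction r with
  | zero =>
    simp only [pow_zero, zero_mul, one_smul, Module.End.one_apply]
    exact seqTen_congr fun l _ => by simp [seqRots]
  | succ r ih =>
    rw [pow_succ', Module.End.mul_apply, ih (by omega), map_smul, cyc_seqTen, smul_smul, ← pow_add,
      Nat.succ_mul]
    congr 1
    refine seqTen_congr fun l hl => ?_
    unfold seqRot seqRots
    split_ifs <;> first | omega | (congr 1; omega)

/-- The two exponents add up to n(n + 1), which is even. -/
lemma neg_one_pow_mul_sub (n r : ℕ) (hr : r ≤ n + 1) :
    (-1 : k) ^ ((n + 1 - r) * n) = (-1 : k) ^ (r * n) := by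
  have h : (-1 : k) ^ ((n + 1) * n) = 1 := (Nat.even_mul_pred_self (n + 1)).neg_one_pow
  have h2 : (-1 : k) ^ ((n + 1 - r) * n) * (-1 : k) ^ (r * n) = 1 := by
    rw [← pow_add, ← Nat.add_mul, Nat.sub_add_cancel hr, h]
  have h3 : (-1 : k) ^ (r * n) * (-1 : k) ^ (r * n) = 1 := by
    rw [← pow_add, ← two_mul, pow_mul]
    simp
  calc _ = (-1 : k) ^ ((n + 1 - r) * n) * ((-1 : k) ^ (r * n) * (-1 : k) ^ (r * n)) := by
        rw [h3, mul_one]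
    _ = _ := by rw [← mul_assoc, h2, one_mul]

/-- Moving i entries from the front to the back is the same as moving n + 1 - i entries from the
back to the front. -/
lemma cyc_pow_eq_rot (n : ℕ) (i : Fin (n + 1)) :
    cyc k C n ^ (n + 1 - i : ℕ) = (-1 : k) ^ ((i : ℕ) * n) • rot i := by
  refine ten_ext fun x => ?_
  rw [cyc_pow_seqTen _ _ (by omega), LinearMap.smul_apply, rot_seqTen,
    neg_one_pow_mul_sub _ _ (by omega)]
  congr 1
  refine seqTen_congr fun l hl => ?_
  have := i.2
  unfold seqRots
  split_ifs <;> first | omega | (congr 1; omega)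

lemma cyc_pow_succ (n : ℕ) : cyc k C n ^ (n + 1) = 1 := by
  have := cyc_pow_eq_rot (k := k) (C := C) n 0
  simp only [Fin.val_zero, tsub_zero, zero_mul, pow_zero, one_smul] at this
  rw [this]
  refine ten_ext fun x => ?_
  rw [rot_seqTen]
  refine seqTen_congr fun l hl => ?_
  simp [hl]

/-- The exponents n + 1 - i run over 1, …, n + 1, and the last power is the identity, so they can be
replaced by 0, …, n. -/
lemma connesSum_eq (n : ℕ) :
    connesSum n = consOne n ∘ₗ ∑ r ∈ Finset.range (n + 1), cyc k C n ^ r := by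
  have h1 : connesSum n = consOne n ∘ₗ ∑ i : Fin (n + 1), cyc k C n ^ (n + 1 - i : ℕ) := by
    simp only [connesSum, cyc_pow_eq_rot]
    ext x
    simp
  have h2 := Finset.sum_range_reflect (fun r => cyc k C n ^ (r + 1)) (n + 1)
  have h3 : ∑ r ∈ Finset.range (n + 1), cyc k C n ^ (r + 1) =
      ∑ r ∈ Finset.range (n + 1), cyc k C n ^ r := by
    rw [Finset.sum_range_succ, Finset.sum_range_succ', cyc_pow_succ, pow_zero]
  rw [h1, Fin.sum_univ_eq_sum_range (fun i => cyc k C n ^ (n + 1 - i)) (n + 1), ← h3, ← h2]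
  congr 1
  refine Finset.sum_congr rfl fun r hr => ?_
  have := Finset.mem_range.1 hr
  congr 1
  omega

/-- The `j`-th face with its sign in the Hochschild boundary. -/
def sface (β : C →ₗ[k] C →ₗ[k] C) (n j : ℕ) : Ten k C (n + 1) →ₗ[k] Ten k C n :=
  (-1 : k) ^ j • face β n j

lemma openSum_eq (β : C →ₗ[k] C →ₗ[k] C) (n : ℕ) :
    openSum β n = ∑ j ∈ Finset.range (n + 1), sface β n j := by
  rw [openSum, ← Fin.sum_univ_eq_sum_range]
  refine Finset.sum_congr rfl fun a _ => ?_
  rw [sface, face, dif_pos a.2]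

lemma cyclicSum_eq (β : C →ₗ[k] C →ₗ[k] C) (n : ℕ) :
    cyclicSum β n = ∑ j ∈ Finset.range (n + 2), sface β n j := by
  rw [cyclicSum, openSum_eq, Finset.sum_range_succ _ (n + 1)]
  congr 1
  rw [sface, face, dif_neg (by omega)]

lemma sface_seqTen (β : C →ₗ[k] C →ₗ[k] C) (n j : ℕ) (hj : j ≤ n + 1) (x : ℕ → C) :
    sface β n j (seqTen k (n + 1) x) = (-1 : k) ^ j • seqTen k n (seqFace β (n + 1) j x) := by
  rw [sface, LinearMap.smul_apply, face_seqTen β n j hj]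

/-- With the signs built into faces and rotation, the cyclic relations carry no sign at all. This
one and the next hold for every bilinear map. -/
lemma sface_cyc_succ (β : C →ₗ[k] C →ₗ[k] C) (n j : ℕ) (hj : j ≤ n) :
    sface β n (j + 1) ∘ₗ cyc k C (n + 1) = cyc k C n ∘ₗ sface β n j := by
  refine ten_ext fun x => ?_
  rw [LinearMap.comp_apply, LinearMap.comp_apply, cyc_seqTen, map_smul,
    sface_seqTen _ _ _ (by omega), sface_seqTen _ _ _ (by omega), map_smul, cyc_seqTen, smul_smul,
    smul_smul]
  congr 1
  · ring
  · refine seqTen_congr fun l hl => ?_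
    grind [seqFace, seqRot]

lemma sface_cyc_zero (β : C →ₗ[k] C →ₗ[k] C) (n : ℕ) :
    sface β n 0 ∘ₗ cyc k C (n + 1) = sface β n (n + 1) := by
  refine ten_ext fun x => ?_
  rw [LinearMap.comp_apply, cyc_seqTen, map_smul,
    sface_seqTen _ _ _ (by omega), sface_seqTen _ _ _ (by omega), smul_smul]
  congr 1
  · ring
  · refine seqTen_congr fun l hl => ?_
    grind [seqFace, seqRot]

/-- Faces at places that do not touch commute up to the index shift; associativity enters when three
neighbouring entries are multiplied. -/
lemma face_face (β : C →ₗ[k] C →ₗ[k] C) (hβ : ∀ x y z, β (β x y) z = β x (β y z)) (n i j : ℕ)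
    (hi : i < j) (hj : j ≤ n + 2) :
    face β n i ∘ₗ face β (n + 1) j = face β n (j - 1) ∘ₗ face β (n + 1) i := by
  refine ten_ext fun x => ?_
  rw [LinearMap.comp_apply, LinearMap.comp_apply, face_seqTen _ _ _ (by omega),
    face_seqTen _ _ _ (by omega), face_seqTen _ _ _ (by omega), face_seqTen _ _ _ (by omega)]
  refine seqTen_congr fun l hl => ?_
  grind [seqFace]

end Sequences

/-! ### The boundary, its behaviour under rotations, and the boundary of 1 ⊗ x. -/

section Boundary

variable {k : Type*} [CommRing k] {C : Type*} [Ring C] [Algebra k C]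

/-- The alternating sums of the faces of an associative product form a complex. -/
lemma cyclicSum_comp (β : C →ₗ[k] C →ₗ[k] C) (hβ : ∀ x y z, β (β x y) z = β x (β y z)) (n : ℕ) :
    cyclicSum β n ∘ₗ cyclicSum β (n + 1) = 0 := by
  have hsum : cyclicSum β n ∘ₗ cyclicSum β (n + 1) =
      ∑ p ∈ Finset.range (n + 2) ×ˢ Finset.range (n + 3),
        sface β n p.1 ∘ₗ sface β (n + 1) p.2 := by
    rw [cyclicSum_eq, cyclicSum_eq, Finset.sum_product]
    ext x
    simp only [LinearMap.compMultilinearMap_apply, LinearMap.comp_apply, LinearMap.sum_apply,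
      map_sum]
    exact Finset.sum_comm
  rw [hsum, ← Finset.sum_filter_add_sum_filter_not _ (fun p : ℕ × ℕ => p.1 < p.2)]
  rw [← eq_neg_iff_add_eq_zero, ← Finset.sum_neg_distrib]
  -- The simplicial identity pairs (i, j), i < j, with (j - 1, i). The two terms differ by one in
  -- the exponent of the sign and cancel.
  refine Finset.sum_nbij' (fun p => (p.2 - 1, p.1)) (fun p => (p.2, p.1 + 1)) ?_ ?_ ?_ ?_ ?_
  · rintro ⟨i, j⟩ h
    simp only [Finset.mem_filter, Finset.mem_product, Finset.mem_range] at h ⊢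
    omega
  · rintro ⟨i, j⟩ h
    simp only [Finset.mem_filter, Finset.mem_product, Finset.mem_range] at h ⊢
    omega
  · rintro ⟨i, j⟩ h
    simp only [Finset.mem_filter, Finset.mem_product, Finset.mem_range] at h
    simp only [Prod.mk.injEq, true_and]
    omega
  · rintro ⟨i, j⟩ h
    simp
  · rintro ⟨i, j⟩ h
    simp only [Finset.mem_filter, Finset.mem_product, Finset.mem_range] at h
    simp only [sface, LinearMap.smul_comp, LinearMap.comp_smul, smul_smul]
    rw [face_face β hβ n i j (by omega) (by omega), ← neg_smul]
    congr 1
    obtain ⟨j, rfl⟩ : ∃ j', j = j' + 1 := ⟨j - 1, by omega⟩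
    simp only [Nat.add_sub_cancel]
    ring

lemma sface_cyc_pow (β : C →ₗ[k] C →ₗ[k] C) (n r j : ℕ) (hj : r + j ≤ n + 1)
    (z : Ten k C (n + 1)) :
    sface β n (r + j) ((cyc k C (n + 1) ^ r) z) = (cyc k C n ^ r) (sface β n j z) := by
  induction r with
  | zero => simp
  | succ r ih =>
    have h := LinearMap.congr_fun (sface_cyc_succ (k := k) β n (r + j) (by omega))
      ((cyc k C (n + 1) ^ r) z)
    simp only [LinearMap.comp_apply] at h
    rw [ih (by omega)] at h
    rw [pow_succ', Module.End.mul_apply, Nat.add_right_comm r 1 j, h, pow_succ', Module.End.mul_apply]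

/-- After j rotations have been moved past the face it has become face 0. The next rotation is
absorbed by turning it into the cyclic face n + 1, and the rest lower its index again. Hence one
power of τ is lost. -/
lemma sface_cyc_pow_of_lt (β : C →ₗ[k] C →ₗ[k] C) (n r j : ℕ) (hj : j ≤ r) (hr : r ≤ n)
    (z : Ten k C (n + 1)) :
    sface β n j ((cyc k C (n + 1) ^ (r + 1)) z) =
      (cyc k C n ^ r) (sface β n (n + 1 - r + j) z) := by
  obtain ⟨q, rfl⟩ : ∃ q, r = j + q := ⟨r - j, by omega⟩
  have h1 := sface_cyc_pow β n j 0 (by omega) ((cyc k C (n + 1) ^ (1 + q)) z)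
  have h2 := sface_cyc_pow β n q (n + 1 - q) (by omega) z
  have h3 := LinearMap.congr_fun (sface_cyc_zero (k := k) β n) ((cyc k C (n + 1) ^ q) z)
  simp only [LinearMap.comp_apply] at h3
  rw [show q + (n + 1 - q) = n + 1 by omega] at h2
  rw [Nat.add_zero j] at h1
  rw [Nat.add_assoc j q 1, Nat.add_comm q 1, pow_add, Module.End.mul_apply, h1, pow_add, pow_one,
    Module.End.mul_apply, h3, h2, pow_add, Module.End.mul_apply]
  congr 4
  omega

/-- The faces beyond r commute with all r + 1 rotations; each of the faces 0, …, r absorbs one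
rotation by passing through the cyclic face. -/
lemma openSum_cyc_pow (β : C →ₗ[k] C →ₗ[k] C) (n r : ℕ) (hr : r ≤ n) (z : Ten k C (n + 1)) :
    openSum β n ((cyc k C (n + 1) ^ (r + 1)) z) =
      (cyc k C n ^ (r + 1)) (∑ j ∈ Finset.range (n - r), sface β n j z) +
      (cyc k C n ^ r) (∑ j ∈ Finset.Ico (n + 1 - r) (n + 2), sface β n j z) := by
  have hsplit : ∀ g : ℕ → Ten k C n, ∑ j ∈ Finset.range (n + 1), g j =
      ∑ j ∈ Finset.range (n - r), g (r + 1 + j) + ∑ j ∈ Finset.range (r + 1), g j := by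
    intro g
    have := Finset.sum_range_add g (r + 1) (n - r)
    rw [show r + 1 + (n - r) = n + 1 by omega] at this
    rw [this, add_comm]
  rw [openSum_eq, LinearMap.sum_apply, hsplit, map_sum, map_sum]
  congr 1
  · refine Finset.sum_congr rfl fun j hj => ?_
    have := Finset.mem_range.1 hj
    exact sface_cyc_pow β n (r + 1) j (by omega) z
  · rw [Finset.sum_Ico_eq_sum_range, show n + 2 - (n + 1 - r) = r + 1 by omega]
    refine Finset.sum_congr rfl fun j hj => ?_
    have := Finset.mem_range.1 hj
    exact sface_cyc_pow_of_lt β n r j (by omega) hr z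

/-- The sum of the open boundaries of the rotations `1, …, τ ^ R`. -/
lemma openSum_sum_cyc_pow (β : C →ₗ[k] C →ₗ[k] C) (n R : ℕ) (hR : R ≤ n + 1)
    (z : Ten k C (n + 1)) :
    ∑ r ∈ Finset.range (R + 1), openSum β n ((cyc k C (n + 1) ^ r) z) =
      ∑ r ∈ Finset.range (R + 1), (cyc k C n ^ r)
        (∑ j ∈ Finset.range (n + 1 - R), sface β n j z) +
      ∑ r ∈ Finset.range R, (cyc k C n ^ r)
        (∑ j ∈ Finset.Ico (n + 1 - R) (n + 2), sface β n j z) := by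
  induction R with
  | zero => simp [openSum_eq]
  | succ R ih =>
    -- Passing from R to R + 1 moves exactly the face n - R from the first group to the second one.
    have h1 : ∑ j ∈ Finset.range (n + 1 - R), sface β n j z =
        ∑ j ∈ Finset.range (n - R), sface β n j z + sface β n (n - R) z := by
      rw [show n + 1 - R = n - R + 1 by omega, Finset.sum_range_succ]
    have h2 : ∑ j ∈ Finset.Ico (n - R) (n + 2), sface β n j z =
        sface β n (n - R) z + ∑ j ∈ Finset.Ico (n + 1 - R) (n + 2), sface β n j z := by
      rw [Finset.sum_eq_sum_Ico_succ_bot (by omega), show n - R + 1 = n + 1 - R by omega]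
    rw [Finset.sum_range_succ, ih (by omega), openSum_cyc_pow β n R (by omega),
      show n + 1 - (R + 1) = n - R by omega, h1, h2, Finset.sum_range_succ _ (R + 1),
      Finset.sum_range_succ (fun r => (cyc k C n ^ r) (_ + _)) R]
    simp only [map_add, Finset.sum_add_distrib]
    rw [Finset.sum_range_succ _ R, Finset.sum_range_succ _ R, Finset.sum_range_succ _ R]
    abel

/-- The faces of `1 ⊗ x`. -/
lemma sface_consOne_succ (n j : ℕ) (hj : j ≤ n) :
    sface (mulMap k C) (n + 1) (j + 1) ∘ₗ consOne (n + 1) =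
      -(consOne n ∘ₗ sface (mulMap k C) n j) := by
  refine ten_ext fun x => ?_
  rw [LinearMap.comp_apply, LinearMap.neg_apply, LinearMap.comp_apply, consOne_seqTen,
    sface_seqTen _ _ _ (by omega), sface_seqTen _ _ _ (by omega), map_smul, consOne_seqTen,
    ← neg_smul]
  congr 1
  · ring
  · refine seqTen_congr fun l hl => ?_
    grind [seqFace, seqCons]

lemma sface_consOne_zero (n : ℕ) : sface (mulMap k C) n 0 ∘ₗ consOne n = LinearMap.id := by
  refine ten_ext fun x => ?_
  rw [LinearMap.comp_apply, consOne_seqTen, sface_seqTen _ _ _ (by omega), pow_zero, one_smul]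
  refine seqTen_congr fun l hl => ?_
  simp only [seqFace, seqCons, LinearMap.mul_apply']
  grind

lemma sface_consOne_last (n : ℕ) :
    sface (mulMap k C) n (n + 1) ∘ₗ consOne n = -cyc k C n := by
  refine ten_ext fun x => ?_
  rw [LinearMap.comp_apply, consOne_seqTen, sface_seqTen _ _ _ (by omega), LinearMap.neg_apply,
    cyc_seqTen, ← neg_smul]
  congr 1
  · ring
  · refine seqTen_congr fun l hl => ?_
    grind [seqFace, seqCons, seqRot, LinearMap.mul_apply']

lemma cyclicSum_consOne_zero (z : Ten k C 0) :
    cyclicSum (mulMap k C) 0 (consOne 0 z) = z - cyc k C 0 z := by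
  refine LinearMap.congr_fun (?_ : cyclicSum (mulMap k C) 0 ∘ₗ consOne 0 =
    LinearMap.id - cyc k C 0) z
  rw [cyclicSum_eq, Finset.sum_range_succ, Finset.sum_range_one, LinearMap.add_comp,
    sface_consOne_zero, sface_consOne_last, sub_eq_add_neg]

/-- Face 0 removes the 1, the cyclic face gives -τ, and every other face acts behind the 1 with the
opposite sign. -/
lemma cyclicSum_consOne_succ (n : ℕ) (z : Ten k C (n + 1)) :
    cyclicSum (mulMap k C) (n + 1) (consOne (n + 1) z) =
      z - cyc k C (n + 1) z - consOne n (openSum (mulMap k C) n z) := by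
  refine LinearMap.congr_fun (?_ : cyclicSum (mulMap k C) (n + 1) ∘ₗ consOne (n + 1) =
    LinearMap.id - cyc k C (n + 1) - consOne n ∘ₗ openSum (mulMap k C) n) z
  rw [cyclicSum_eq, Finset.sum_range_succ, Finset.sum_range_succ', LinearMap.add_comp,
    LinearMap.add_comp, sface_consOne_zero, sface_consOne_last, openSum_eq]
  have : (∑ j ∈ Finset.range (n + 1), sface (mulMap k C) (n + 1) (j + 1)) ∘ₗ consOne (n + 1) =
      -(consOne n ∘ₗ ∑ j ∈ Finset.range (n + 1), sface (mulMap k C) n j) := by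
    refine LinearMap.ext fun z => ?_
    simp only [LinearMap.comp_apply, LinearMap.sum_apply, LinearMap.neg_apply, map_sum]
    rw [← Finset.sum_neg_distrib]
    refine Finset.sum_congr rfl fun j hj => ?_
    exact LinearMap.congr_fun (sface_consOne_succ n j (by have := Finset.mem_range.1 hj; omega)) z
  rw [this]
  abel

end Boundary

/-! ### The normalized chains and the relative chains are mixed complexes. -/

section MixedComplex

variable {k : Type*} [CommRing k] {C : Type*} [Ring C] [Algebra k C] (K : Subalgebra k C)

lemma chain_induction {n : ℕ} {P : Chain K n → Prop} (h : ∀ z, P ((relations K n).mkQ z))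
    (z : Chain K n) : P z := by
  obtain ⟨y, rfl⟩ := Submodule.mkQ_surjective _ z
  exact h y

lemma hochschild_mk (n : ℕ) (z : Ten k C (n + 1)) : hochschild K n ((relations K (n + 1)).mkQ z) =
    (relations K n).mkQ (cyclicSum (mulMap k C) n z) := rfl

lemma connes_mk (n : ℕ) (z : Ten k C n) : connes K n ((relations K n).mkQ z) =
    (relations K (n + 1)).mkQ (connesSum n z) := rfl

lemma mk_seqTen_eq_zero {n : ℕ} {x : ℕ → C} {l : ℕ} (h0 : l ≠ 0) (hn : l ≤ n) (hl : x l ∈ K) :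
    (relations K n).mkQ (seqTen k n x) = 0 := by
  rw [Submodule.mkQ_apply, Submodule.Quotient.mk_eq_zero]
  exact Submodule.mem_sup_right (deg_mem K _ ⟨l, by omega⟩ (fun e => h0 (congrArg Fin.val e)) hl)

lemma consOne_le (n : ℕ) : relations K n ≤ (relations K (n + 1)).comap (consOne n) := by
  refine sup_le ((consOne_le_balanced K n).trans (Submodule.comap_mono le_sup_left)) ?_
  refine Submodule.span_le.2 ?_
  rintro _ ⟨x, i, hi, hx, rfl⟩
  simp only [SetLike.mem_coe, Submodule.mem_comap, consOne_tprod]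
  exact Submodule.mem_sup_right (deg_mem K _ i.succ (Fin.succ_ne_zero i) (by simpa using hx))

/-- The map `x₀ ⊗ ⋯ ⊗ xₙ ↦ 1 ⊗ x₀ ⊗ ⋯ ⊗ xₙ` on normalized chains. -/
def consChain (n : ℕ) : Chain K n →ₗ[k] Chain K (n + 1) :=
  Submodule.mapQ _ _ (consOne n) (consOne_le K n)

lemma consChain_mk (n : ℕ) (z : Ten k C n) : consChain K n ((relations K n).mkQ z) =
    (relations K (n + 1)).mkQ (consOne n z) := rfl

lemma hochschild_hochschild (n : ℕ) (z : Chain K (n + 2)) :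
    hochschild K n (hochschild K (n + 1) z) = 0 := by
  induction z using chain_induction with
  | h z =>
    have h := LinearMap.congr_fun (cyclicSum_comp (mulMap k C) mul_assoc n) z
    rw [LinearMap.comp_apply, LinearMap.zero_apply] at h
    rw [hochschild_mk, hochschild_mk, h, map_zero]

/-- After the second 1 is put in front, the first one stands at a place other than 0, so the tensor
is degenerate. This is the source of B² = 0 and of B s = 0. -/
lemma consChain_rot_consChain (n : ℕ) (i : Fin (n + 2)) (z : Ten k C n) :
    (relations K (n + 2)).mkQ (consOne (n + 1) (rot i (consOne n z))) = 0 := by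
  suffices h : (relations K (n + 2)).mkQ ∘ₗ consOne (n + 1) ∘ₗ rot i ∘ₗ consOne n = 0 from
    LinearMap.congr_fun h z
  refine PiTensorProduct.ext (MultilinearMap.ext fun x => ?_)
  simp only [LinearMap.compMultilinearMap_apply, LinearMap.comp_apply, consOne_tprod, rot_tprod,
    LinearMap.zero_apply]
  rw [Submodule.mkQ_apply, Submodule.Quotient.mk_eq_zero]
  refine Submodule.mem_sup_right (deg_mem K _ (0 - i).succ (Fin.succ_ne_zero _) ?_)
  simp [one_mem]

lemma connes_consChain (n : ℕ) (z : Chain K n) : connes K (n + 1) (consChain K n z) = 0 := by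
  induction z using chain_induction with
  | h z =>
    rw [consChain_mk, connes_mk, connesSum, LinearMap.sum_apply, map_sum]
    refine Finset.sum_eq_zero fun i _ => ?_
    rw [LinearMap.smul_apply, map_smul, LinearMap.comp_apply, consChain_rot_consChain, smul_zero]

lemma consChain_consChain (n : ℕ) (z : Chain K n) : consChain K (n + 1) (consChain K n z) = 0 := by
  induction z using chain_induction with
  | h z =>
    have h := consChain_rot_consChain K n 0 z
    have h0 : (rot 0 : Ten k C (n + 1) →ₗ[k] Ten k C (n + 1)) = LinearMap.id := by
      refine ten_ext fun x => ?_
      rw [rot_seqTen]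
      exact seqTen_congr fun l hl => by simp [hl]
    rwa [h0] at h

lemma connes_mk_eq (n : ℕ) (z : Ten k C n) : connes K n ((relations K n).mkQ z) =
    consChain K n ((relations K n).mkQ (∑ r ∈ Finset.range (n + 1), (cyc k C n ^ r) z)) := by
  rw [connes_mk, connesSum_eq, consChain_mk, LinearMap.comp_apply, LinearMap.sum_apply]

lemma connes_connes (n : ℕ) (z : Chain K n) : connes K (n + 1) (connes K n z) = 0 := by
  induction z using chain_induction with
  | h z => rw [connes_mk_eq, connes_consChain]

/-- The sum over a full period is invariant under τ, because τ^(n+1) = 1. -/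
lemma sum_cyc_pow_sub (n : ℕ) (z : Ten k C n) : ∑ r ∈ Finset.range (n + 1), (cyc k C n ^ r) z -
    cyc k C n (∑ r ∈ Finset.range (n + 1), (cyc k C n ^ r) z) = 0 := by
  have h : ∀ r, cyc k C n ((cyc k C n ^ r) z) = (cyc k C n ^ (r + 1)) z := fun r => by
    rw [pow_succ', Module.End.mul_apply]
  rw [map_sum, Finset.sum_congr rfl fun r _ => h r, Finset.sum_range_succ',
    Finset.sum_range_succ _ n, cyc_pow_succ, pow_zero, sub_self]

lemma hochschild_connes_zero (z : Chain K 0) : hochschild K 0 (connes K 0 z) = 0 := by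
  induction z using chain_induction with
  | h z =>
    rw [connes_mk_eq, consChain_mk, hochschild_mk, cyclicSum_consOne_zero,
      sum_cyc_pow_sub, map_zero]

lemma hochschild_connes (n : ℕ) (z : Chain K (n + 1)) :
    hochschild K (n + 1) (connes K (n + 1) z) + connes K n (hochschild K n z) = 0 := by
  induction z using chain_induction with
  | h z =>
    -- Taking R = n + 1 in `openSum_sum_cyc_pow` empties the first group of faces. The result is
    -- that the open boundary of the full sum of rotations is the full sum of rotations of the
    -- boundary.
    rw [connes_mk_eq, consChain_mk, hochschild_mk, cyclicSum_consOne_succ,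
      sum_cyc_pow_sub, zero_sub, hochschild_mk, connes_mk_eq, consChain_mk, map_sum,
      openSum_sum_cyc_pow _ _ _ le_rfl, cyclicSum_eq, LinearMap.sum_apply]
    simp only [tsub_self, Finset.range_zero, Finset.sum_empty, map_zero, Finset.sum_const_zero,
      zero_add, ← Finset.range_eq_Ico]
    rw [map_neg, neg_add_cancel]

theorem isMixedComplex_rel {D : Type*} [Ring D] [Algebra k D] (f : C →ₐ[k] D) :
    IsMixedComplex (fun n => relChain f K n) (relHochschild f K) (relConnes f K) where
  b_b n := LinearMap.ext fun z => Subtype.ext (hochschild_hochschild K n z)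
  B_B n := LinearMap.ext fun z => Subtype.ext (connes_connes K n z)
  b_B_zero := LinearMap.ext fun z => Subtype.ext (hochschild_connes_zero K z)
  b_B n := LinearMap.ext fun z => Subtype.ext (hochschild_connes K n z)

end MixedComplex

/-! ### Additivity of the boundary in the product, and descent of further operators to normalized
chains. -/

section Additivity

variable {k : Type*} [CommRing k] {C : Type*} [Ring C] [Algebra k C]

lemma inner_add (β γ : C →ₗ[k] C →ₗ[k] C) {n : ℕ} (a : Fin (n + 1)) :
    inner (β + γ) a = inner β a + inner γ a := by
  refine PiTensorProduct.ext (MultilinearMap.ext fun x => ?_)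
  simp only [LinearMap.compMultilinearMap_apply, LinearMap.add_apply, inner_tprod, contract,
    MultilinearMap.map_update_add]

lemma openSum_add (β γ : C →ₗ[k] C →ₗ[k] C) (n : ℕ) :
    openSum (β + γ) n = openSum β n + openSum γ n := by
  simp only [openSum, inner_add, smul_add, Finset.sum_add_distrib]

lemma cyclicSum_add (β γ : C →ₗ[k] C →ₗ[k] C) (n : ℕ) :
    cyclicSum (β + γ) n = cyclicSum β n + cyclicSum γ n := by
  simp only [cyclicSum, openSum_add, outer, inner_add, LinearMap.add_comp, smul_add]
  abel

lemma cyc_le_balanced (K : Subalgebra k C) (n r : ℕ) :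
    balanced K n ≤ (balanced K n).comap (cyc k C n ^ r) := by
  induction r with
  | zero => exact le_rfl
  | succ r ih =>
    intro z hz
    rw [Submodule.mem_comap, pow_succ', Module.End.mul_apply]
    exact Submodule.smul_mem _ _ (rot_le_balanced K _ (ih hz))

/-- A rotation does not respect degenerate tensors, since it may carry the entry from K to place 0.
With a 1 in front, that entry stays away from place 0. -/
lemma consOne_cyc_pow_le (K : Subalgebra k C) (n r : ℕ) (hr : r ≤ n) :
    relations K n ≤ (relations K (n + 1)).comap (consOne n ∘ₗ cyc k C n ^ r) := by
  refine sup_le (fun z hz => ?_) (Submodule.span_le.2 ?_)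
  · exact Submodule.mem_sup_left (consOne_le_balanced K n (cyc_le_balanced K n r hz))
  · rintro _ ⟨x, i, hi, hx, rfl⟩
    obtain ⟨y, hy, e⟩ := exists_seqTen (k := k) x
    rw [e, SetLike.mem_coe, Submodule.mem_comap, LinearMap.comp_apply,
      cyc_pow_seqTen n r (by omega), map_smul, consOne_seqTen]
    refine Submodule.smul_mem _ _ ?_
    rw [← hy i] at hx
    have hi' : (i : ℕ) ≠ 0 := fun e => hi (Fin.ext e)
    rw [← Submodule.Quotient.mk_eq_zero, ← Submodule.mkQ_apply]
    have := i.2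
    by_cases h : i + r ≤ n
    · refine mk_seqTen_eq_zero K (l := i + r + 1) (by omega) (by omega) ?_
      simpa [seqCons, seqRots] using hx
    · refine mk_seqTen_eq_zero K (l := i + r - (n + 1) + 1) (by omega) (by omega) ?_
      have e1 : seqCons (seqRots n r y) (i + r - (n + 1) + 1) = y i := by
        simp only [seqCons, seqRots]
        rw [if_neg (by omega), if_pos (by omega)]
        congr 1
        omega
      rwa [e1]

lemma map_seqTen (n : ℕ) (g : ℕ → C →ₗ[k] C) (x : ℕ → C) :
    PiTensorProduct.map (fun j : Fin (n + 1) => g j) (seqTen k n x) =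
      seqTen k n fun l => g l (x l) := by
  rw [seqTen, PiTensorProduct.map_tprod, seqTen]

/-- A `K`-bimodule map which preserves `K`. -/
structure IsMode (K : Subalgebra k C) (g : C →ₗ[k] C) : Prop where
  left : ∀ r ∈ K, ∀ x, g (r * x) = r * g x
  right : ∀ r ∈ K, ∀ x, g (x * r) = g x * r
  mem : ∀ r ∈ K, g r ∈ K

lemma IsMode.id (K : Subalgebra k C) : IsMode K LinearMap.id :=
  ⟨fun _ _ _ => rfl, fun _ _ _ => rfl, fun _ h => h⟩

lemma map_mode_le {K : Subalgebra k C} {n : ℕ} (g : Fin (n + 1) → C →ₗ[k] C)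
    (hg : ∀ j, IsMode K (g j)) :
    relations K n ≤ (relations K n).comap (PiTensorProduct.map g) := by
  have hup : ∀ (x : Fin (n + 1) → C) (i : Fin (n + 1)) (v : C),
      (fun j => g j (Function.update x i v j)) =
        Function.update (fun j => g j (x j)) i (g i v) := by
    intro x i v
    funext j
    by_cases h : j = i
    · subst h; simp
    · simp [h]
  refine relations_le_comap _ (fun x i r hr => ?_) (fun x i hi hx => ?_)
  · rw [PiTensorProduct.map_tprod, PiTensorProduct.map_tprod, hup, hup, (hg i).right r hr,
      (hg (i + 1)).left r hr]
    exact Submodule.mem_sup_left (bal_mem K (fun j => g j (x j)) i hr)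
  · rw [PiTensorProduct.map_tprod]
    exact Submodule.mem_sup_right (deg_mem K _ i hi ((hg i).mem _ hx))

end Additivity

/-! ### The map s on words and its boundary. -/

namespace CleftExt

variable {k A E : Type*} [CommRing k] [Ring A] [Algebra k A] [Ring E] [Algebra k E]
  (c : CleftExt k A E) (K : Subalgebra k A)

lemma isMode_projA : IsMode (c.base K) c.projA where
  left r hr x := c.projA_left (c.base_le K r hr) x
  right r hr x := c.projA_right (c.base_le K r hr) x
  mem r hr := by
    rw [projA_apply, c.i_p (c.base_le K r hr)]
    exact hr

lemma isMode_projM : IsMode (c.base K) c.projM where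
  left r hr x := c.projM_left (c.base_le K r hr) x
  right r hr x := c.projM_right (c.base_le K r hr) x
  mem r hr := by
    rw [c.projM_of_range (c.base_le K r hr)]
    exact zero_mem _

lemma projA_of_ker {x : E} (hx : c.p x = 0) : c.projA x = 0 := by
  rw [projA_apply, hx, map_zero]

lemma projA_of_range {x : E} (hx : x ∈ c.i.range) : c.projA x = x := c.i_p hx

/-- The last `r` entries are projected onto `i(A)`. -/
def tailEntry (n r l : ℕ) : E →ₗ[k] E := if n < l + r then c.projA else LinearMap.id

/-- The map which sends `x₀ ⊗ ⋯ ⊗ xₙ` with last entry from `M` at the place `i` to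
`∑_{j ≥ i} ± 1 ⊗ xⱼ₊₁ ⊗ ⋯ ⊗ xₙ ⊗ x₀ ⊗ ⋯ ⊗ xⱼ`. -/
def sTen (n : ℕ) : Ten k E n →ₗ[k] Ten k E (n + 1) :=
  ∑ r ∈ Finset.range (n + 1), consOne n ∘ₗ (cyc k E n ^ r) ∘ₗ
    PiTensorProduct.map fun j : Fin (n + 1) => c.tailEntry n r j

lemma sTen_le (n : ℕ) :
    relations (c.base K) n ≤ (relations (c.base K) (n + 1)).comap (c.sTen n) := by
  intro z hz
  rw [Submodule.mem_comap, sTen, LinearMap.sum_apply]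
  refine sum_mem fun r hr => ?_
  refine consOne_cyc_pow_le (c.base K) n r (by have := Finset.mem_range.1 hr; omega)
    (map_mode_le _ (fun j => ?_) hz)
  unfold tailEntry
  split_ifs
  · exact c.isMode_projA K
  · exact IsMode.id _

/-- `sTen` on normalized chains. -/
def sChain (n : ℕ) : Chain (c.base K) n →ₗ[k] Chain (c.base K) (n + 1) :=
  Submodule.mapQ _ _ (c.sTen n) (c.sTen_le K n)

lemma sChain_mk (n : ℕ) (z : Ten k E n) : c.sChain K n ((relations (c.base K) n).mkQ z) =
    (relations (c.base K) (n + 1)).mkQ (c.sTen n z) := rfl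

/-- The last entry from `M` among `x₀, …, xₙ` is followed by exactly `R` entries from `A`. -/
def Trail (n R : ℕ) (x : ℕ → E) : Prop :=
  c.p (x (n - R)) = 0 ∧ ∀ l, n - R < l → l ≤ n → x l ∈ c.i.range

/-- For r ≤ R the last r entries are already in A, so the projection changes nothing. For r > R the
last M-entry is among them and is projected to zero. In this way a single formula, defined on all
tensors, adapts its number of rotations to the word. -/
lemma sTen_of_trail {n R : ℕ} (hR : R ≤ n) {x : ℕ → E} (h : c.Trail n R x) :
    c.sTen n (seqTen k n x) =
      consOne n (∑ r ∈ Finset.range (R + 1), (cyc k E n ^ r) (seqTen k n x)) := by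
  rw [sTen, LinearMap.sum_apply, map_sum, ← Finset.sum_range_add_sum_Ico _ (Nat.succ_le_succ hR)]
  have h1 : ∀ r ∈ Finset.Ico (R + 1) (n + 1), (consOne n ∘ₗ (cyc k E n ^ r) ∘ₗ
      PiTensorProduct.map fun j : Fin (n + 1) => c.tailEntry n r j) (seqTen k n x) = 0 := by
    intro r hr
    have := Finset.mem_Ico.1 hr
    rw [LinearMap.comp_apply, LinearMap.comp_apply, map_seqTen, seqTen,
      tprod_zero _ ⟨n - R, by omega⟩, map_zero, map_zero]
    change c.tailEntry n r (n - R) (x (n - R)) = 0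
    rw [tailEntry, if_pos (by omega), c.projA_of_ker h.1]
  rw [Finset.sum_eq_zero h1, add_zero]
  refine Finset.sum_congr rfl fun r hr => ?_
  have := Finset.mem_range.1 hr
  rw [LinearMap.comp_apply, LinearMap.comp_apply, map_seqTen]
  congr 2
  refine seqTen_congr fun l hl => ?_
  unfold tailEntry
  split_ifs with hl'
  · exact c.projA_of_range (h.2 l (by omega) hl)
  · rfl

/-- Of the summands defining `tTen` only the one for the place n - R survives: the place of an
A-entry further right is killed by `projM`, and for a place further left the entry at n - R is
killed by `projA`. -/
lemma tTen_of_trail {n R : ℕ} (hR : R ≤ n) {x : ℕ → E} (h : c.Trail n R x) :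
    c.tTen n (seqTen k n x) = (cyc k E n ^ (R + 1)) (seqTen k n x) := by
  have h0 : n + 1 - (n - R) = R + 1 := by omega
  have hi := cyc_pow_eq_rot (k := k) (C := E) n ⟨n - R, by omega⟩
  simp only [h0] at hi
  rw [hi, tTen, LinearMap.sum_apply, Fintype.sum_eq_single ⟨n - R, by omega⟩]
  · rw [LinearMap.smul_apply, LinearMap.smul_apply, LinearMap.comp_apply]
    congr 2
    rw [seqTen, lastProj_tprod]
    congr 1
    funext j
    unfold lastEntry
    split_ifs with h1 h2
    · rfl
    · subst h2
      exact c.projM_of_ker h.1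
    · have h3 : (j : ℕ) ≠ n - R := fun e => h2 (Fin.ext e)
      have h4 : ¬ (j : ℕ) < n - R := h1
      exact c.projA_of_range (h.2 j (by omega) (by omega))
  · intro i hne
    have hne' : (i : ℕ) ≠ n - R := fun e => hne (Fin.ext e)
    rw [LinearMap.smul_apply, LinearMap.comp_apply, seqTen, lastProj_tprod]
    rcases Nat.lt_or_gt_of_ne hne' with h1 | h1
    · rw [tprod_zero _ ⟨n - R, by omega⟩, map_zero, smul_zero]
      unfold lastEntry
      rw [if_neg (by rw [Fin.lt_def]; simp; omega), if_neg (fun e => hne e.symm)]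
      exact c.projA_of_ker h.1
    · rw [tprod_zero _ i, map_zero, smul_zero]
      unfold lastEntry
      rw [if_neg (lt_irrefl _), if_pos rfl]
      exact c.projM_of_range (h.2 i h1 (by omega))

lemma mu_add_nabla : c.mu + c.nabla = mulMap k E := by
  refine LinearMap.ext₂ fun x y => ?_
  change c.mu x y + c.nabla x y = x * y
  rw [mu_apply, nabla_apply, sub_add_cancel]

/-- The sum of `b` and `d'` on the tensor powers. -/
def obTen (n : ℕ) : Ten k E (n + 1) →ₗ[k] Ten k E n := cyclicSum c.mu n + openSum c.nabla n

/-- Since d' has no cyclic term, the open faces of `mu` and `nabla` combine to those of the full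
multiplication, and only the cyclic face is still taken with `mu`. -/
lemma obTen_eq (n : ℕ) (z : Ten k E (n + 1)) : c.obTen n z =
    ∑ j ∈ Finset.range (n + 1), sface (mulMap k E) n j z + sface c.mu n (n + 1) z := by
  have h : c.obTen n = openSum (mulMap k E) n + sface c.mu n (n + 1) := by
    rw [obTen, ← c.mu_add_nabla, openSum_add, cyclicSum_eq, Finset.sum_range_succ, ← openSum_eq]
    abel
  rw [h, LinearMap.add_apply, openSum_eq, LinearMap.sum_apply]

/-- A face to the left of the last M-entry, or multiplying into it from the left, leaves the
A-entries behind it untouched. -/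
lemma trail_face_of_lt {n R j : ℕ} {x : ℕ → E} (h : c.Trail (n + 1) R x) (hj : j < n + 1 - R) :
    c.Trail n R (seqFace (mulMap k E) (n + 1) j x) := by
  have h1 := h.1
  constructor
  · rcases Nat.lt_or_ge j (n - R) with h2 | h2
    · rw [show seqFace (mulMap k E) (n + 1) j x (n - R) = x (n + 1 - R) by
        unfold seqFace
        rw [if_neg (by omega), if_neg (by omega), if_neg (by omega)]
        congr 1; omega, h1]
    · rw [show seqFace (mulMap k E) (n + 1) j x (n - R) = x (n - R) * x (n + 1 - R) by
        obtain rfl : j = n - R := by omega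
        unfold seqFace
        rw [if_neg (by omega), if_neg (by omega), if_pos rfl, LinearMap.mul_apply']
        congr 2; omega, map_mul, h1, mul_zero]
  · intro l hl hl'
    rw [show seqFace (mulMap k E) (n + 1) j x l = x (l + 1) by
      unfold seqFace
      rw [if_neg (by omega), if_neg (by omega), if_neg (by omega)]]
    exact h.2 _ (by omega) (by omega)

/-- Such a face uses up one of the A-entries behind the last M-entry. For the cyclic face the
condition on x₀ matters when x₀ itself is the last M-entry: the product must again lie in M. -/
lemma trail_face_of_ge {n R j : ℕ} {x : ℕ → E} (hR : R ≤ n) (h : c.Trail (n + 1) (R + 1) x)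
    (hj : n - R ≤ j) (hjn : j ≤ n + 1) (h0 : j = n + 1 → c.p (x 0) = 0) :
    c.Trail n R (seqFace (mulMap k E) (n + 1) j x) := by
  obtain ⟨h1, h2⟩ := h
  rw [show n + 1 - (R + 1) = n - R by omega] at h1 h2
  constructor
  · unfold seqFace
    split_ifs with h3 h4 h5
    · rw [LinearMap.mul_apply', map_mul, h0 h3.2, mul_zero]
    · exact h1
    · rw [LinearMap.mul_apply', map_mul, ← h5, h1, zero_mul]
    · omega
  · intro l hl hl'
    unfold seqFace
    split_ifs with h3 h4 h5
    · omega
    · exact h2 l hl (by omega)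
    · rw [LinearMap.mul_apply']
      exact mul_mem (h2 j (by omega) (by omega)) (h2 _ (by omega) (by omega))
    · exact h2 _ (by omega) (by omega)

/-- Faces in front of the last M-entry keep R, and s then uses R + 1 rotations; the later faces
lower R by one, and s uses only R of them. This is precisely the grouping in `openSum_sum_cyc_pow`.
-/
lemma sTen_obTen {n R : ℕ} (hR : R ≤ n + 1) {x : ℕ → E} (h : c.Trail (n + 1) R x)
    (h0 : c.p (x 0) = 0) : c.sTen n (c.obTen n (seqTen k (n + 1) x)) =
      consOne n (∑ r ∈ Finset.range (R + 1), openSum (mulMap k E) n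
        ((cyc k E (n + 1) ^ r) (seqTen k (n + 1) x))) := by
  -- If R = 0, both factors of the cyclic face lie in M and `mu` kills the product, matching the
  -- empty second group of faces. If R > 0, the last entry is in A and `mu` is the multiplication.
  have hmu : sface c.mu n (n + 1) (seqTen k (n + 1) x) =
      if R = 0 then 0 else sface (mulMap k E) n (n + 1) (seqTen k (n + 1) x) := by
    rw [sface_seqTen _ _ _ le_rfl, sface_seqTen _ _ _ le_rfl]
    split_ifs with hR0
    · subst hR0
      rw [seqTen, tprod_zero _ 0, smul_zero]
      have h1 : c.p (x (n + 1)) = 0 := h.1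
      simp [seqFace, mu_apply, c.projM_of_ker h1, c.projM_of_ker h0]
    · congr 1
      refine seqTen_congr fun l hl => ?_
      unfold seqFace
      split_ifs
      · rw [mu_apply, c.projM_of_range (h.2 (n + 1) (by omega) le_rfl), zero_mul, sub_zero,
          LinearMap.mul_apply']
      · rfl
      · omega
      · rfl
  have hlt : ∀ j ∈ Finset.range (n + 1 - R), c.sTen n (sface (mulMap k E) n j
      (seqTen k (n + 1) x)) = consOne n (∑ r ∈ Finset.range (R + 1), (cyc k E n ^ r)
        (sface (mulMap k E) n j (seqTen k (n + 1) x))) := by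
    intro j hj
    have := Finset.mem_range.1 hj
    rw [sface_seqTen _ _ _ (by omega), map_smul,
      c.sTen_of_trail (by omega) (c.trail_face_of_lt h this)]
    simp only [map_smul, ← Finset.smul_sum]
  rw [openSum_sum_cyc_pow _ _ _ hR, c.obTen_eq, hmu]
  cases R with
  | zero =>
    rw [if_pos rfl, add_zero, map_sum]
    refine (Finset.sum_congr rfl hlt).trans ?_
    simp
  | succ R =>
    have hge : ∀ j ∈ Finset.Ico (n + 1 - (R + 1)) (n + 2), c.sTen n (sface (mulMap k E) n j
        (seqTen k (n + 1) x)) = consOne n (∑ r ∈ Finset.range (R + 1), (cyc k E n ^ r)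
          (sface (mulMap k E) n j (seqTen k (n + 1) x))) := by
      intro j hj
      have := Finset.mem_Ico.1 hj
      rw [sface_seqTen _ _ _ (by omega), map_smul, c.sTen_of_trail (by omega)
        (c.trail_face_of_ge (by omega) h (by omega) (by omega) fun _ => h0)]
      simp only [map_smul, ← Finset.smul_sum]
    rw [if_neg (by omega), ← Finset.sum_range_succ (fun j => sface (mulMap k E) n j _) (n + 1),
      ← Finset.sum_range_add_sum_Ico _ (show n + 1 - (R + 1) ≤ n + 1 + 1 by omega), map_add,
      map_sum, map_sum, Finset.sum_congr rfl hlt, Finset.sum_congr rfl hge]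
    simp only [map_add, map_sum]
    rw [Finset.sum_comm, Finset.sum_comm (s := Finset.range (R + 1))
      (t := Finset.Ico (n + 1 - (R + 1)) (n + 2))]

lemma cyclicSum_sTen_zero {x : ℕ → E} (h0 : c.p (x 0) = 0) :
    cyclicSum (mulMap k E) 0 (c.sTen 0 (seqTen k 0 x)) =
      seqTen k 0 x - c.tTen 0 (seqTen k 0 x) := by
  have h : c.Trail 0 0 x := ⟨h0, fun l h1 h2 => by omega⟩
  rw [c.sTen_of_trail le_rfl h, c.tTen_of_trail le_rfl h]
  simp [cyclicSum_consOne_zero]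

lemma sum_sub_cyc (n R : ℕ) (z : Ten k E n) :
    ∑ r ∈ Finset.range (R + 1), (cyc k E n ^ r) z -
      cyc k E n (∑ r ∈ Finset.range (R + 1), (cyc k E n ^ r) z) = z - (cyc k E n ^ (R + 1)) z := by
  have h : ∀ r, cyc k E n ((cyc k E n ^ r) z) = (cyc k E n ^ (r + 1)) z := fun r => by
    rw [pow_succ', Module.End.mul_apply]
  rw [map_sum, Finset.sum_congr rfl fun r _ => h r, ← Finset.sum_sub_distrib,
    Finset.sum_range_sub' (fun r => (cyc k E n ^ r) z), pow_zero, Module.End.one_apply]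

/-- The part of ∂(1 ⊗ z) of the form z - τ z telescopes over the R + 1 rotations to x - τ^(R+1) x =
x - t x. The open boundaries of the rotations are collected by `sTen_obTen`. -/
lemma cyclicSum_sTen_succ {n R : ℕ} (hR : R ≤ n + 1) {x : ℕ → E} (h : c.Trail (n + 1) R x)
    (h0 : c.p (x 0) = 0) :
    cyclicSum (mulMap k E) (n + 1) (c.sTen (n + 1) (seqTen k (n + 1) x)) =
      seqTen k (n + 1) x - c.tTen (n + 1) (seqTen k (n + 1) x) -
        c.sTen n (c.obTen n (seqTen k (n + 1) x)) := by
  rw [c.sTen_of_trail hR h, c.tTen_of_trail hR h, cyclicSum_consOne_succ, c.sTen_obTen hR h h0,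
    sum_sub_cyc, map_sum]

end CleftExt
namespace CleftExt

variable {k A E : Type*} [CommRing k] [Ring A] [Algebra k A] [Ring E] [Algebra k E]
  (c : CleftExt k A E) (K : Subalgebra k A)

/-! ### Words as sequences -/

/-- The terms `x₀, …, xₙ` of a sequence are in `M` at the places in `S` and in `i(A)` otherwise. -/
def SWord (n : ℕ) (S : Finset ℕ) (x : ℕ → E) : Prop :=
  ∀ l ≤ n, (l ∈ S → c.p (x l) = 0) ∧ (l ∉ S → x l ∈ c.i.range)

variable {c} in
lemma IsWord.exists_sword {n : ℕ} {S : Finset (Fin (n + 1))} {x : Fin (n + 1) → E}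
    (hx : c.IsWord S x) : ∃ y : ℕ → E, c.SWord n (S.map Fin.valEmbedding) y ∧
      (∀ j : Fin (n + 1), y j = x j) ∧ PiTensorProduct.tprod k x = seqTen k n y := by
  obtain ⟨y, hy, e⟩ := exists_seqTen (k := k) x
  refine ⟨y, fun l hl => ?_, hy, e⟩
  have h1 : l ∈ S.map Fin.valEmbedding ↔ (⟨l, by omega⟩ : Fin (n + 1)) ∈ S := by
    simp only [Finset.mem_map, Fin.valEmbedding_apply]
    constructor
    · rintro ⟨a, ha, rfl⟩
      exact ha
    · exact fun h => ⟨_, h, rfl⟩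
  rw [h1, show y l = x ⟨l, by omega⟩ from hy ⟨l, by omega⟩]
  exact hx _

variable {c} in
lemma SWord.mk_mem {n w : ℕ} {S : Finset ℕ} {x : ℕ → E} (hx : c.SWord n S x) (h0 : 0 ∈ S)
    (hS : S ⊆ Finset.range (n + 1)) (hw : S.card = w + 1) :
    (relations (c.base K) n).mkQ (seqTen k n x) ∈ c.X K n w := by
  classical
  have e : (Finset.univ.filter fun j : Fin (n + 1) => (j : ℕ) ∈ S).map Fin.valEmbedding = S := by
    ext l
    simp only [Finset.mem_map, Finset.mem_filter, Finset.mem_univ, true_and,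
      Fin.valEmbedding_apply]
    constructor
    · rintro ⟨a, ha, rfl⟩
      exact ha
    · exact fun h => ⟨⟨l, Finset.mem_range.1 (hS h)⟩, h, rfl⟩
  refine c.cls_mem K (S := Finset.univ.filter fun j : Fin (n + 1) => (j : ℕ) ∈ S) (by simpa) ?_ ?_
  · rw [← hw, ← e, Finset.card_map, e]
  · intro j
    have := hx j (by omega)
    simpa using this

/-- Two linear maps agree on `X_{vw}` if they do so on words. -/
lemma eq_of_mem_X {n w : ℕ} {V : Type*} [AddCommGroup V] [Module k V]
    {f g : Chain (c.base K) n →ₗ[k] V}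
    (h : ∀ (S : Finset ℕ) (x : ℕ → E), 0 ∈ S → S ⊆ Finset.range (n + 1) → S.card = w + 1 →
      c.SWord n S x → f ((relations (c.base K) n).mkQ (seqTen k n x)) =
        g ((relations (c.base K) n).mkQ (seqTen k n x))) {z : Chain (c.base K) n}
    (hz : z ∈ c.X K n w) : f z = g z := by
  refine LinearMap.eqOn_span (s := _) ?_ hz
  rintro _ ⟨S, x, h0, hS, hx, rfl⟩
  obtain ⟨y, hy, -, e⟩ := hx.exists_sword
  rw [cls, e]
  refine h _ y ?_ ?_ (by rwa [Finset.card_map]) hy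
  · exact Finset.mem_map.2 ⟨0, h0, rfl⟩
  · intro l hl
    obtain ⟨a, -, rfl⟩ := Finset.mem_map.1 hl
    exact Finset.mem_range.2 a.2

variable {c} in
lemma SWord.exists_trail {n : ℕ} {S : Finset ℕ} {x : ℕ → E} (hx : c.SWord n S x)
    (hS : S ⊆ Finset.range (n + 1)) (h : S.Nonempty) : ∃ R ≤ n, n - R ∈ S ∧
      (∀ l ∈ S, l ≤ n - R) ∧ c.Trail n R x := by
  have h1 := S.max'_mem h
  have h2 := Finset.mem_range.1 (hS h1)
  have h3 : n - (n - S.max' h) = S.max' h := by omega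
  refine ⟨n - S.max' h, by omega, by rwa [h3], fun l hl => ?_, ?_⟩
  · rw [h3]
    exact S.le_max' l hl
  rw [Trail, h3]
  refine ⟨(hx _ (by omega)).1 h1, fun l hl hl' => (hx l hl').2 fun hm => ?_⟩
  have := S.le_max' l hm
  omega

lemma X_eq_bot {n w : ℕ} (h : n < w) : c.X K n w = ⊥ := by
  rw [X, Submodule.span_eq_bot]
  rintro _ ⟨S, x, -, hS, -, rfl⟩
  have := Finset.card_le_univ S
  rw [Fintype.card_fin] at this
  omega

lemma eq_zero_of_mem_X {n w : ℕ} (h : n < w) {z : Chain (c.base K) n} (hz : z ∈ c.X K n w) :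
    z = 0 := by
  rw [c.X_eq_bot K h] at hz
  exact hz

/-! ### Operators on normalized chains -/

/-- The operator `t` on all normalized chains. -/
def tChain (n : ℕ) : Module.End k (Chain (c.base K) n) :=
  Submodule.mapQ _ _ (c.tTen n) (c.tTen_le K n)

/-- The operator `b` on all normalized chains. -/
def muChain (n : ℕ) : Chain (c.base K) (n + 1) →ₗ[k] Chain (c.base K) n :=
  Submodule.mapQ _ _ (cyclicSum c.mu n) (cyclicSum_unital (c.mu_unital K) n)

/-- The operator `d` on all normalized chains. -/
def nablaChain (n : ℕ) : Chain (c.base K) (n + 1) →ₗ[k] Chain (c.base K) n :=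
  Submodule.mapQ _ _ (cyclicSum c.nabla n) (cyclicSum_vanishing (c.nabla_vanishing K) n)

/-- The operator `d'` on all normalized chains. -/
def openNablaChain (n : ℕ) : Chain (c.base K) (n + 1) →ₗ[k] Chain (c.base K) n :=
  Submodule.mapQ _ _ (openSum c.nabla n) (openSum_vanishing (c.nabla_vanishing K) n)

lemma coe_t (n w : ℕ) (z : c.X K n w) : (c.t K n w z : Chain (c.base K) n) = c.tChain K n z := rfl

lemma coe_b (n w : ℕ) (z : c.X K (n + 1) w) :
    (c.b K n w z : Chain (c.base K) n) = c.muChain K n z := rfl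

lemma coe_t_pow (n w l : ℕ) (z : c.X K n w) :
    ((c.t K n w ^ l) z : Chain (c.base K) n) = (c.tChain K n ^ l) z := by
  induction l with
  | zero => rfl
  | succ l ih => rw [pow_succ', pow_succ', Module.End.mul_apply, Module.End.mul_apply, coe_t, ih]

lemma muChain_add_nablaChain (n : ℕ) (z : Chain (c.base K) (n + 1)) :
    c.muChain K n z + c.nablaChain K n z = hochschild (c.base K) n z := by
  induction z using chain_induction with
  | h z =>
    change (relations (c.base K) n).mkQ (cyclicSum c.mu n z) +
      (relations (c.base K) n).mkQ (cyclicSum c.nabla n z) = _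
    rw [hochschild_mk, ← map_add, ← LinearMap.add_apply, ← cyclicSum_add, c.mu_add_nabla]

/-- The components with only one entry from `M` are annihilated by all the faces for `nabla`. -/
lemma sface_nabla_eq_zero {n : ℕ} {S : Finset ℕ} {x : ℕ → E} (hx : c.SWord (n + 1) S x)
    (h0 : 0 ∈ S) (hS : S.card = 1) (j : ℕ) (hj : j ≤ n + 1) :
    sface c.nabla n j (seqTen k (n + 1) x) = 0 := by
  obtain ⟨a, rfl⟩ := Finset.card_eq_one.1 hS
  obtain rfl := Finset.mem_singleton.1 h0
  have hA : ∀ l, 0 < l → l ≤ n + 1 → c.projM (x l) = 0 := fun l h1 h2 =>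
    c.projM_of_range ((hx l h2).2 (by simp; omega))
  rw [sface_seqTen _ _ _ hj]
  rcases Nat.lt_or_ge n j with h | h
  · obtain rfl : j = n + 1 := by omega
    rw [seqTen, tprod_zero _ 0, smul_zero]
    simp [seqFace, nabla_apply, hA]
  · rw [seqTen, tprod_zero _ ⟨j, by omega⟩, smul_zero]
    change seqFace c.nabla (n + 1) j x j = 0
    rw [seqFace, if_neg (by omega), if_neg (by omega), if_pos rfl, nabla_apply,
      hA (j + 1) (by omega) (by omega), mul_zero]

lemma nablaChain_zero (n : ℕ) {z : Chain (c.base K) (n + 1)} (hz : z ∈ c.X K (n + 1) 0) :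
    c.nablaChain K n z = 0 := by
  refine c.eq_of_mem_X K (f := c.nablaChain K n) (g := 0) (fun S x h0 hS hw hx => ?_) hz
  change (relations (c.base K) n).mkQ (cyclicSum c.nabla n (seqTen k (n + 1) x)) = 0
  rw [cyclicSum_eq, LinearMap.sum_apply, Finset.sum_eq_zero, map_zero]
  intro j hj
  have := Finset.mem_range.1 hj
  exact c.sface_nabla_eq_zero hx h0 hw j (by omega)

lemma openNablaChain_zero (n : ℕ) {z : Chain (c.base K) (n + 1)} (hz : z ∈ c.X K (n + 1) 0) :
    c.openNablaChain K n z = 0 := by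
  refine c.eq_of_mem_X K (f := c.openNablaChain K n) (g := 0) (fun S x h0 hS hw hx => ?_) hz
  change (relations (c.base K) n).mkQ (openSum c.nabla n (seqTen k (n + 1) x)) = 0
  rw [openSum_eq, LinearMap.sum_apply, Finset.sum_eq_zero, map_zero]
  intro j hj
  have := Finset.mem_range.1 hj
  exact c.sface_nabla_eq_zero hx h0 hw j (by omega)

/-! ### The total complexes and the maps into normalized chains -/

/-- The degree `n` part of the total complexes of `(X, b, d)` and `(X, -b, -d')`. -/
abbrev TotX (n : ℕ) := Tot (fun m w => c.X K m w) n

/-- The inclusion of `⨁_w X_{vw}` into the normalized chains. -/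
def incl (n : ℕ) : c.TotX K n →ₗ[k] Chain (c.base K) n :=
  ∑ w ∈ Finset.range (n + 1), (c.X K n w).subtype ∘ₗ LinearMap.proj w

lemma incl_apply (n : ℕ) (x : c.TotX K n) :
    c.incl K n x = ∑ w ∈ Finset.range (n + 1), (x w : Chain (c.base K) n) := by
  simp [incl]

/-- The boundary `b + d`. -/
abbrev bd (n : ℕ) : c.TotX K (n + 1) →ₗ[k] c.TotX K n :=
  tot (fun m w => c.X K m w) (c.b K) (c.d K) n

/-- The boundary `b + d'`. -/
abbrev bd' (n : ℕ) : c.TotX K (n + 1) →ₗ[k] c.TotX K n :=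
  tot (fun m w => c.X K m w) (c.b K) (c.d' K) n

/-- The operator `t` on the total complex. -/
def tTot (n : ℕ) : c.TotX K n →ₗ[k] c.TotX K n :=
  LinearMap.pi fun w => c.t K n w ∘ₗ LinearMap.proj w

/-- The operator `N` on the total complex. -/
def NTot (n : ℕ) : c.TotX K n →ₗ[k] c.TotX K n :=
  LinearMap.pi fun w => c.N K n w ∘ₗ LinearMap.proj w

/-- The map `sTen` on the total complex. -/
def s (n : ℕ) : c.TotX K n →ₗ[k] Chain (c.base K) (n + 1) := c.sChain K n ∘ₗ c.incl K n

/-- Splitting the multiplication into `mu` and `nabla` splits ∂ into a part that preserves w and a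
part that lowers it by one. -/
lemma hochschild_incl (n : ℕ) (x : c.TotX K (n + 1)) :
    hochschild (c.base K) n (c.incl K (n + 1) x) = c.incl K n (c.bd K n x) := by
  rw [← muChain_add_nablaChain, incl_apply, incl_apply, map_sum, map_sum,
    Finset.sum_range_succ _ (n + 1),
    Finset.sum_range_succ' (fun w => c.nablaChain K n (x w : Chain (c.base K) (n + 1))),
    c.nablaChain_zero K n (x 0).2, add_zero]
  -- The summand w = n + 1 exists in degree n + 1 but not in the range for degree n; there b takes
  -- values in a zero module.
  have h := c.eq_zero_of_mem_X K (Nat.lt_succ_self n) (c.b K n (n + 1) (x (n + 1))).2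
  rw [coe_b] at h
  rw [h, add_zero, ← Finset.sum_add_distrib]
  rfl

lemma incl_tTot (n : ℕ) (x : c.TotX K n) :
    c.incl K n (c.tTot K n x) = c.tChain K n (c.incl K n x) := by
  rw [incl_apply, incl_apply, map_sum]
  rfl

lemma incl_bd' (n : ℕ) (x : c.TotX K (n + 1)) : c.incl K n (c.bd' K n x) =
    c.muChain K n (c.incl K (n + 1) x) + c.openNablaChain K n (c.incl K (n + 1) x) := by
  rw [incl_apply, incl_apply, map_sum, map_sum,
    Finset.sum_range_succ _ (n + 1),
    Finset.sum_range_succ' (fun w => c.openNablaChain K n (x w : Chain (c.base K) (n + 1))),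
    c.openNablaChain_zero K n (x 0).2, add_zero]
  have h := c.eq_zero_of_mem_X K (Nat.lt_succ_self n) (c.b K n (n + 1) (x (n + 1))).2
  rw [coe_b] at h
  rw [h, add_zero, ← Finset.sum_add_distrib]
  rfl

/-- Two linear maps agree on the total complex if they do so on words. -/
lemma eq_of_incl {n : ℕ} {V : Type*} [AddCommGroup V] [Module k V]
    {f g : Chain (c.base K) n →ₗ[k] V}
    (h : ∀ (S : Finset ℕ) (x : ℕ → E), 0 ∈ S → S ⊆ Finset.range (n + 1) →
      c.SWord n S x → f ((relations (c.base K) n).mkQ (seqTen k n x)) =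
        g ((relations (c.base K) n).mkQ (seqTen k n x))) (x : c.TotX K n) :
    f (c.incl K n x) = g (c.incl K n x) := by
  rw [incl_apply, map_sum, map_sum]
  exact Finset.sum_congr rfl fun w _ =>
    c.eq_of_mem_X K (fun S x h0 hS _ hx => h S x h0 hS hx) (x w).2

lemma hochschild_s_zero (x : c.TotX K 0) :
    hochschild (c.base K) 0 (c.s K 0 x) = c.incl K 0 (x - c.tTot K 0 x) := by
  rw [map_sub, incl_tTot]
  refine c.eq_of_incl K (f := hochschild (c.base K) 0 ∘ₗ c.sChain K 0)
    (g := LinearMap.id - c.tChain K 0) (fun S x h0 _ hx => ?_) x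
  have h := c.cyclicSum_sTen_zero ((hx 0 le_rfl).1 h0)
  have := congrArg (relations (c.base K) 0).mkQ h
  rwa [map_sub] at this

lemma hochschild_s (n : ℕ) (x : c.TotX K (n + 1)) :
    hochschild (c.base K) (n + 1) (c.s K (n + 1) x) =
      c.incl K (n + 1) (x - c.tTot K (n + 1) x) - c.s K n (c.bd' K n x) := by
  rw [map_sub, incl_tTot, s, s, LinearMap.comp_apply, LinearMap.comp_apply, incl_bd']
  refine c.eq_of_incl K (f := hochschild (c.base K) (n + 1) ∘ₗ c.sChain K (n + 1))
    (g := LinearMap.id - c.tChain K (n + 1) -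
      c.sChain K n ∘ₗ (c.muChain K n + c.openNablaChain K n)) (fun S x h0 hS hx => ?_) x
  obtain ⟨R, hR, -, -, hT⟩ := hx.exists_trail hS ⟨0, h0⟩
  have h := c.cyclicSum_sTen_succ hR hT ((hx 0 (Nat.zero_le _)).1 h0)
  have := congrArg (relations (c.base K) (n + 1)).mkQ h
  rw [map_sub, map_sub] at this
  exact this

/-- Every value of s has the form 1 ⊗ y, which is all that is needed for the vanishing of B, Φ and
iterated 1 ⊗ on it. -/
lemma exists_sChain_eq (n : ℕ) (z : Chain (c.base K) n) :
    ∃ y, c.sChain K n z = consChain (c.base K) n y := by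
  induction z using chain_induction with
  | h z =>
    refine ⟨(relations (c.base K) n).mkQ (∑ r ∈ Finset.range (n + 1), (cyc k E n ^ r)
      (PiTensorProduct.map (fun j : Fin (n + 1) => c.tailEntry n r j) z)), ?_⟩
    rw [sChain_mk, consChain_mk, sTen, LinearMap.sum_apply]
    simp only [LinearMap.comp_apply, map_sum]

lemma connes_sChain (n : ℕ) (z : Chain (c.base K) n) :
    connes (c.base K) (n + 1) (c.sChain K n z) = 0 := by
  obtain ⟨y, hy⟩ := c.exists_sChain_eq K n z
  rw [hy, connes_consChain]

end CleftExt

/-! ### The contracting homotopy of the rows as an identity of polynomials. -/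

section GeometricSums

variable {k V : Type*} [CommRing k] [Algebra ℚ k] [AddCommGroup V] [Module k V]

/-- With α = 1/(w+1) and aⱼ = (w-j)/(w+1), comparing coefficients leaves α + a₀ = 1, α + aⱼ₊₁ - aⱼ =
0 and a_w = 0. No relation for e is needed; in particular e^(w+1) = 1 plays no role. -/
lemma geom_homotopy (w : ℕ) (e : Module.End k V) :
    (∑ l ∈ Finset.range (w + 1), e ^ l) * (algebraMap ℚ k (1 / (w + 1)) • 1) +
      (∑ j ∈ Finset.range w, algebraMap ℚ k (((w : ℚ) - j) / (w + 1)) • e ^ j) * (1 - e) = 1 := by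
  have hw : (w : ℚ) + 1 ≠ 0 := by positivity
  set a : ℕ → k := fun j => algebraMap ℚ k (((w : ℚ) - j) / (w + 1)) with ha
  set α := algebraMap ℚ k (1 / (w + 1)) with hα
  have h0 : α + a 0 = 1 := by
    rw [hα, ha, ← map_add, ← map_one (algebraMap ℚ k)]
    congr 1
    field_simp
    push_cast
    ring
  have h1 : ∀ j, α + a (j + 1) - a j = 0 := by
    intro j
    rw [hα, ha, ← map_add, ← map_sub, ← map_zero (algebraMap ℚ k)]
    congr 1
    field_simp
    push_cast
    ring
  have h2 : a w = 0 := by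
    rw [ha]
    simp
  have h3 : (∑ j ∈ Finset.range w, a j • e ^ j) = ∑ j ∈ Finset.range (w + 1), a j • e ^ j := by
    rw [Finset.sum_range_succ, h2, zero_smul, add_zero]
  have h4 : (∑ j ∈ Finset.range w, a j • e ^ j) * e = ∑ j ∈ Finset.range w, a j • e ^ (j + 1) := by
    rw [Finset.sum_mul]
    exact Finset.sum_congr rfl fun j _ => by rw [smul_mul_assoc, pow_succ]
  rw [mul_sub, mul_one, h4, h3, mul_smul_comm, mul_one, Finset.sum_range_succ',
    Finset.sum_range_succ' (fun j => a j • e ^ j), pow_zero, smul_add, Finset.smul_sum]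
  have h5 : ∑ j ∈ Finset.range w, α • e ^ (j + 1) + ∑ j ∈ Finset.range w, a (j + 1) • e ^ (j + 1) -
      ∑ j ∈ Finset.range w, a j • e ^ (j + 1) = 0 := by
    rw [← Finset.sum_add_distrib, ← Finset.sum_sub_distrib]
    refine Finset.sum_eq_zero fun j _ => ?_
    rw [← add_smul, ← sub_smul, h1, zero_smul]
  calc _ = (∑ j ∈ Finset.range w, α • e ^ (j + 1) +
        ∑ j ∈ Finset.range w, a (j + 1) • e ^ (j + 1) -
        ∑ j ∈ Finset.range w, a j • e ^ (j + 1)) + (α + a 0) • (1 : Module.End k V) := by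
        rw [add_smul]
        abel
    _ = 1 := by rw [h5, h0, one_smul, zero_add]

lemma geom_homotopy' (w : ℕ) (e : Module.End k V) :
    (1 - e) * (∑ j ∈ Finset.range w, algebraMap ℚ k (((w : ℚ) - j) / (w + 1)) • e ^ j) +
      (algebraMap ℚ k (1 / (w + 1)) • 1) * (∑ l ∈ Finset.range (w + 1), e ^ l) = 1 := by
  have h : Commute (1 - e)
      (∑ j ∈ Finset.range w, algebraMap ℚ k (((w : ℚ) - j) / (w + 1)) • e ^ j) :=
    Commute.sum_right _ _ _ fun j _ => Commute.smul_right
      (((Commute.one_left e).sub_left (Commute.refl e)).pow_right j) _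
  have h1 := geom_homotopy w e
  rw [mul_smul_comm, mul_one] at h1
  rw [h.eq, smul_mul_assoc, one_mul, add_comm, h1]

end GeometricSums

/-! ### The powers of t, the identity B = s N, and the rows. -/

namespace CleftExt

variable {k A E : Type*} [CommRing k] [Ring A] [Algebra k A] [Ring E] [Algebra k E]
  (c : CleftExt k A E) (K : Subalgebra k A)

/-- The powers of `t` and the partial sums of Connes' operator on a word. -/
lemma tTen_pow_word {n : ℕ} {S : Finset ℕ} {x : ℕ → E} (hx : c.SWord n S x)
    (hS : S ⊆ Finset.range (n + 1)) (q : ℕ) (hq : q ≤ n + 1) (hgood : q = 0 ∨ n + 1 - q ∈ S) :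
    (c.tTen n ^ (S.filter (n + 1 - q ≤ ·)).card) (seqTen k n x) =
      (cyc k E n ^ q) (seqTen k n x) ∧
    c.sTen n (∑ l ∈ Finset.range (S.filter (n + 1 - q ≤ ·)).card, (c.tTen n ^ l) (seqTen k n x)) =
      consOne n (∑ r ∈ Finset.range q, (cyc k E n ^ r) (seqTen k n x)) := by
  have hSn : ∀ l ∈ S, l ≤ n := fun l hl => Nat.lt_succ_iff.1 (Finset.mem_range.1 (hS hl))
  induction q using Nat.strong_induction_on with
  | _ q ih =>
    rcases Nat.eq_zero_or_pos q with rfl | hpos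
    · have : S.filter (n + 1 - 0 ≤ ·) = ∅ :=
        Finset.filter_eq_empty_iff.2 fun l hl => by have := hSn l hl; omega
      rw [this]
      simp
    have hmem : n + 1 - q ∈ S := hgood.resolve_left (by omega)
    -- The place n + 1 - q' is the next M-entry to the right of n + 1 - q, and q' = 0 stands for the
    -- end of the word. One more application of t brings the entry at n + 1 - q to the front.
    obtain ⟨q', hq', hgood', hgap⟩ : ∃ q' < q, (q' = 0 ∨ n + 1 - q' ∈ S) ∧
        ∀ l ∈ S, n + 1 - q < l → n + 1 - q' ≤ l := by
      rcases (S.filter (n + 1 - q < ·)).eq_empty_or_nonempty with h | h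
      · refine ⟨0, hpos, Or.inl rfl, fun l hl hl' => ?_⟩
        exact absurd (Finset.mem_filter.2 ⟨hl, hl'⟩) (by rw [h]; simp)
      · have h1 := Finset.mem_filter.1 (Finset.min'_mem _ h)
        have h2 := hSn _ h1.1
        have h3 : n + 1 - (n + 1 - (S.filter (n + 1 - q < ·)).min' h) =
            (S.filter (n + 1 - q < ·)).min' h := by omega
        refine ⟨n + 1 - (S.filter (n + 1 - q < ·)).min' h, by omega, Or.inr (by rw [h3]; exact h1.1),
          fun l hl hl' => ?_⟩
        rw [h3]
        exact Finset.min'_le _ _ (Finset.mem_filter.2 ⟨hl, hl'⟩)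
    obtain ⟨R, rfl⟩ : ∃ R, q = q' + (R + 1) := ⟨q - q' - 1, by omega⟩
    obtain ⟨ih1, ih2⟩ := ih q' hq' (by omega) hgood'
    have hcard : (S.filter (n + 1 - (q' + (R + 1)) ≤ ·)).card =
        (S.filter (n + 1 - q' ≤ ·)).card + 1 := by
      have : S.filter (n + 1 - (q' + (R + 1)) ≤ ·) =
          insert (n + 1 - (q' + (R + 1))) (S.filter (n + 1 - q' ≤ ·)) := by
        ext l
        simp only [Finset.mem_filter, Finset.mem_insert]
        constructor
        · rintro ⟨h1, h2⟩
          rcases h2.eq_or_lt with h3 | h3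
          · exact Or.inl h3.symm
          · exact Or.inr ⟨h1, hgap l h1 h3⟩
        · rintro (rfl | ⟨h1, h2⟩)
          · exact ⟨hmem, le_rfl⟩
          · exact ⟨h1, by omega⟩
      rw [this, Finset.card_insert_of_notMem]
      simp only [Finset.mem_filter, not_and]
      omega
    -- After q' rotations the M-entry from the place n + 1 - q is the last one, followed by the R
    -- entries from A that stood between the two M-entries. Hence t contributes R + 1 further
    -- rotations and s exactly the missing partial sum.
    have htrail : c.Trail n R (seqRots n q' x) := by
      constructor
      · rw [seqRots, if_neg (by omega), show n - R - q' = n + 1 - (q' + (R + 1)) by omega]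
        exact (hx _ (by omega)).1 hmem
      · intro l hl hl'
        rw [seqRots, if_neg (by omega)]
        refine (hx _ (by omega)).2 fun hm => ?_
        have := hgap _ hm (by omega)
        omega
    have hR : R ≤ n := by omega
    have ht : c.tTen n ((cyc k E n ^ q') (seqTen k n x)) =
        (cyc k E n ^ (q' + (R + 1))) (seqTen k n x) := by
      rw [Nat.add_comm q', pow_add, Module.End.mul_apply, cyc_pow_seqTen _ _ (by omega), map_smul,
        map_smul, c.tTen_of_trail hR htrail]
    have hs : c.sTen n ((cyc k E n ^ q') (seqTen k n x)) =
        consOne n (∑ r ∈ Finset.range (R + 1), (cyc k E n ^ (q' + r)) (seqTen k n x)) := by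
      have : ∀ r, (cyc k E n ^ (q' + r)) (seqTen k n x) =
          (cyc k E n ^ r) ((cyc k E n ^ q') (seqTen k n x)) := fun r => by
        rw [Nat.add_comm q', pow_add, Module.End.mul_apply]
      simp only [this]
      rw [cyc_pow_seqTen _ _ (by omega), map_smul, c.sTen_of_trail hR htrail]
      simp only [map_smul, ← Finset.smul_sum]
    rw [hcard, Finset.sum_range_succ, map_add, ih2, ih1, hs, pow_succ', Module.End.mul_apply, ih1,
      ht, Finset.sum_range_add _ q' (R + 1), map_add]
    exact ⟨rfl, rfl⟩

/-- Since x₀ ∈ M, the choice q = n + 1 is admissible: all M-entries are passed and the rotation is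
complete. -/
lemma tTen_pow_word_card {n : ℕ} {S : Finset ℕ} {x : ℕ → E} (hx : c.SWord n S x)
    (hS : S ⊆ Finset.range (n + 1)) (h0 : 0 ∈ S) :
    (c.tTen n ^ S.card) (seqTen k n x) = seqTen k n x ∧
    c.sTen n (∑ l ∈ Finset.range S.card, (c.tTen n ^ l) (seqTen k n x)) =
      consOne n (∑ r ∈ Finset.range (n + 1), (cyc k E n ^ r) (seqTen k n x)) := by
  have h := c.tTen_pow_word hx hS (n + 1) le_rfl (Or.inr (by simpa))
  have hf : S.filter (n + 1 - (n + 1) ≤ ·) = S := by simp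
  rwa [hf, cyc_pow_succ, Module.End.one_apply] at h

lemma tChain_pow_mk (n l : ℕ) (z : Ten k E n) :
    (c.tChain K n ^ l) ((relations (c.base K) n).mkQ z) =
      (relations (c.base K) n).mkQ ((c.tTen n ^ l) z) := by
  induction l with
  | zero => rfl
  | succ l ih =>
    rw [pow_succ', pow_succ', Module.End.mul_apply, Module.End.mul_apply, ih]
    rfl

lemma t_pow_succ (n w : ℕ) : c.t K n w ^ (w + 1) = 1 := by
  refine LinearMap.ext fun z => Subtype.ext ?_
  rw [coe_t_pow]
  refine c.eq_of_mem_X K (f := c.tChain K n ^ (w + 1)) (g := LinearMap.id)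
    (fun S x h0 hS hw hx => ?_) z.2
  have := (c.tTen_pow_word_card hx hS h0).1
  rw [tChain_pow_mk, ← hw, this]
  rfl

/-- The partial sums of rotations produced by s on x, t x, …, t^w x fit together to the full sum of
rotations in Connes' operator. -/
lemma connes_incl (n : ℕ) (x : c.TotX K n) :
    connes (c.base K) n (c.incl K n x) = c.s K n (c.NTot K n x) := by
  rw [s, LinearMap.comp_apply, incl_apply, incl_apply, map_sum, map_sum]
  refine Finset.sum_congr rfl fun w _ => ?_
  have hN : ((c.NTot K n x) w : Chain (c.base K) n) =
      (∑ l ∈ Finset.range (w + 1), c.tChain K n ^ l) (x w : Chain (c.base K) n) := by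
    change ((c.N K n w (x w) : c.X K n w) : Chain (c.base K) n) = _
    rw [N, LinearMap.sum_apply, LinearMap.sum_apply, Submodule.coe_sum]
    exact Finset.sum_congr rfl fun l _ => c.coe_t_pow K n w l (x w)
  rw [hN]
  refine c.eq_of_mem_X K (f := connes (c.base K) n)
    (g := c.sChain K n ∘ₗ ∑ l ∈ Finset.range (w + 1), c.tChain K n ^ l)
    (fun S y h0 hS hw hx => ?_) (x w).2
  have := (c.tTen_pow_word_card hx hS h0).2
  rw [connes_mk_eq, consChain_mk, ← this, LinearMap.comp_apply, LinearMap.sum_apply, ← hw]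
  simp only [tChain_pow_mk]
  rw [← map_sum, sChain_mk]

lemma oneSubT_comp_N (n w : ℕ) : c.oneSubT K n w ∘ₗ c.N K n w = 0 := by
  have := mul_neg_geom_sum (c.t K n w) (w + 1)
  rwa [t_pow_succ, sub_self] at this

lemma N_comp_oneSubT (n w : ℕ) : c.N K n w ∘ₗ c.oneSubT K n w = 0 := by
  have := geom_sum_mul_neg (c.t K n w) (w + 1)
  rwa [t_pow_succ, sub_self] at this

lemma N_comp_sigma_add [Algebra ℚ k] (n w : ℕ) :
    c.N K n w ∘ₗ c.sigma K n w + c.sigma' K n w ∘ₗ c.oneSubT K n w = LinearMap.id :=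
  geom_homotopy w (c.t K n w)

lemma oneSubT_comp_sigma'_add [Algebra ℚ k] (n w : ℕ) :
    c.oneSubT K n w ∘ₗ c.sigma' K n w + c.sigma K n w ∘ₗ c.N K n w = LinearMap.id :=
  geom_homotopy' w (c.t K n w)

end CleftExt

/-! ### Double complexes and their total complexes. -/

section DoubleComplexes

variable {k : Type*} [CommRing k] {Y : ℕ → ℕ → Type*} [∀ n w, AddCommGroup (Y n w)]
  [∀ n w, Module k (Y n w)] {b : ∀ n w, Y (n + 1) w →ₗ[k] Y n w}
  {d : ∀ n w, Y (n + 1) (w + 1) →ₗ[k] Y n w}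

lemma tot_apply (n w : ℕ) (x : Tot Y (n + 1)) :
    tot Y b d n x w = b n w (x w) + d n w (x (w + 1)) := rfl

/-- A double complex can be recognized by its total complex. -/
lemma isDoubleComplex_of_tot (h : ∀ n x, tot Y b d n (tot Y b d (n + 1) x) = 0) :
    IsDoubleComplex Y b d := by
  classical
  refine ⟨fun n w => LinearMap.ext fun z => ?_, fun n w => LinearMap.ext fun z => ?_,
    fun n w => LinearMap.ext fun z => ?_⟩
  · have := congrFun (h n (Pi.single w z)) w
    have e : (Pi.single w z : Tot Y (n + 2)) (w + 1 + 1) = 0 :=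
      Pi.single_eq_of_ne (by omega) _
    simp only [tot_apply] at this
    simpa [e] using this
  · have := congrFun (h n (Pi.single (w + 2) z)) w
    simp only [tot_apply] at this
    simpa using this
  · have := congrFun (h n (Pi.single (w + 1) z)) w
    simp only [tot_apply] at this
    simpa using this

lemma IsDoubleComplex.neg (h : IsDoubleComplex Y b d) :
    IsDoubleComplex Y (fun n w => -b n w) (fun n w => -d n w) where
  b_b n w := by rw [LinearMap.neg_comp, LinearMap.comp_neg, neg_neg, h.b_b]
  d_d n w := by rw [LinearMap.neg_comp, LinearMap.comp_neg, neg_neg, h.d_d]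
  b_d n w := by
    rw [LinearMap.neg_comp, LinearMap.comp_neg, neg_neg, LinearMap.neg_comp, LinearMap.comp_neg,
      neg_neg, h.b_d]

end DoubleComplexes

namespace CleftExt

variable {k A E : Type*} [CommRing k] [Ring A] [Algebra k A] [Ring E] [Algebra k E]
  (c : CleftExt k A E) (K : Subalgebra k A)

/-! ### Projections onto the components -/

/-- The projection onto the span of the words with entries from `M` at the places in `S`. -/
def wordProj (n : ℕ) (S : Finset ℕ) : Chain (c.base K) n →ₗ[k] Chain (c.base K) n :=
  Submodule.mapQ _ _ (PiTensorProduct.map fun j : Fin (n + 1) =>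
    if (j : ℕ) ∈ S then c.projM else c.projA) (map_mode_le _ fun j => by
      split_ifs
      · exact c.isMode_projM K
      · exact c.isMode_projA K)

lemma wordProj_seqTen (n : ℕ) (S : Finset ℕ) (x : ℕ → E) :
    c.wordProj K n S ((relations (c.base K) n).mkQ (seqTen k n x)) =
      (relations (c.base K) n).mkQ
        (seqTen k n fun l => (if l ∈ S then c.projM else c.projA) (x l)) := by
  change (relations (c.base K) n).mkQ (PiTensorProduct.map _ (seqTen k n x)) = _
  rw [map_seqTen n fun l => if l ∈ S then c.projM else c.projA]

lemma sword_wordProj (n : ℕ) (S : Finset ℕ) (x : ℕ → E) :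
    c.SWord n S fun l => (if l ∈ S then c.projM else c.projA) (x l) := by
  intro l _
  constructor
  · intro h
    dsimp only
    rw [if_pos h, p_projM]
  · intro h
    dsimp only
    rw [if_neg h]
    exact ⟨_, rfl⟩

/-- At a place where S and S' differ, the prescribed projection kills the entry of the word. -/
lemma wordProj_sword {n : ℕ} {S S' : Finset ℕ} (hS : S ⊆ Finset.range (n + 1))
    (hS' : S' ⊆ Finset.range (n + 1)) {x : ℕ → E} (hx : c.SWord n S' x) :
    c.wordProj K n S ((relations (c.base K) n).mkQ (seqTen k n x)) =
      if S = S' then (relations (c.base K) n).mkQ (seqTen k n x) else 0 := by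
  rw [wordProj_seqTen]
  split_ifs with h
  · subst h
    congr 1
    refine seqTen_congr fun l hl => ?_
    split_ifs with h1
    · exact c.projM_of_ker ((hx l hl).1 h1)
    · exact c.projA_of_range ((hx l hl).2 h1)
  · obtain ⟨l, hl⟩ : ∃ l, ¬ (l ∈ S ↔ l ∈ S') := by
      by_contra hne
      push Not at hne
      exact h (Finset.ext hne)
    have hln : l < n + 1 := by
      by_contra hl'
      have h1 : l ∉ S := fun h => hl' (Finset.mem_range.1 (hS h))
      have h2 : l ∉ S' := fun h => hl' (Finset.mem_range.1 (hS' h))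
      exact hl ⟨fun h => absurd h h1, fun h => absurd h h2⟩
    rw [seqTen, tprod_zero _ ⟨l, hln⟩, map_zero]
    change (if l ∈ S then c.projM else c.projA) (x l) = 0
    split_ifs with h1
    · exact c.projM_of_range ((hx l (by omega)).2 fun h2 => hl ⟨fun _ => h2, fun _ => h1⟩)
    · refine c.projA_of_ker ((hx l (by omega)).1 ?_)
      by_contra h2
      exact hl ⟨fun h => absurd h h1, fun h => absurd h h2⟩

/-- The places of the words in `X_{vw}`. -/
def places (n w : ℕ) : Finset (Finset ℕ) :=
  ((Finset.range (n + 1)).powersetCard (w + 1)).filter (0 ∈ ·)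

lemma mem_places {n w : ℕ} {S : Finset ℕ} :
    S ∈ places n w ↔ (S ⊆ Finset.range (n + 1) ∧ S.card = w + 1) ∧ 0 ∈ S := by
  rw [places, Finset.mem_filter, Finset.mem_powersetCard]

/-- The projection of the normalized chains onto `X_{vw}`. -/
def projX (n w : ℕ) : Chain (c.base K) n →ₗ[k] c.X K n w :=
  (∑ S ∈ places n w, c.wordProj K n S).codRestrict (c.X K n w) fun z => by
    rw [LinearMap.sum_apply]
    refine sum_mem fun S hS => ?_
    rw [mem_places] at hS
    rw [← Submodule.Quotient.mk_eq_zero, ← Submodule.mkQ_apply]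
    induction z using chain_induction with
    | h z =>
      refine LinearMap.congr_fun (f := (c.X K n w).mkQ ∘ₗ c.wordProj K n S ∘ₗ
        (relations (c.base K) n).mkQ) (g := 0) (ten_ext fun x => ?_) z
      rw [LinearMap.comp_apply, LinearMap.comp_apply, wordProj_seqTen, LinearMap.zero_apply,
        Submodule.mkQ_apply, Submodule.Quotient.mk_eq_zero]
      exact (c.sword_wordProj n S x).mk_mem K hS.2 hS.1.1 hS.1.2

lemma coe_projX (n w : ℕ) (z : Chain (c.base K) n) :
    (c.projX K n w z : Chain (c.base K) n) = ∑ S ∈ places n w, c.wordProj K n S z := by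
  simp [projX]

lemma coe_projX_of_mem {n w w' : ℕ} {z : Chain (c.base K) n} (hz : z ∈ c.X K n w') :
    (c.projX K n w z : Chain (c.base K) n) = if w = w' then z else 0 := by
  rw [coe_projX, ← LinearMap.sum_apply]
  refine (c.eq_of_mem_X K (f := ∑ S ∈ places n w, c.wordProj K n S)
    (g := if w = w' then LinearMap.id else 0) (fun S x h0 hS hw hx => ?_) hz).trans ?_
  · have h1 : ∀ S' ∈ places n w, c.wordProj K n S' ((relations (c.base K) n).mkQ (seqTen k n x)) =
        if S' = S then (relations (c.base K) n).mkQ (seqTen k n x) else 0 := fun S' hS' =>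
      c.wordProj_sword K (mem_places.1 hS').1.1 hS hx
    rw [LinearMap.sum_apply, Finset.sum_congr rfl h1, Finset.sum_ite_eq']
    have h2 : S ∈ places n w ↔ w = w' := by
      rw [mem_places, hw]
      constructor
      · rintro ⟨⟨-, h⟩, -⟩
        omega
      · rintro rfl
        exact ⟨⟨hS, rfl⟩, h0⟩
    by_cases h : w = w'
    · rw [if_pos (h2.2 h), if_pos h, LinearMap.id_apply]
    · rw [if_neg (fun h' => h (h2.1 h')), if_neg h, LinearMap.zero_apply]
  · split_ifs <;> rfl

/-- The projection of the normalized chains onto `⨁_w X_{vw}`. -/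
def Phi (n : ℕ) : Chain (c.base K) n →ₗ[k] c.TotX K n := LinearMap.pi (c.projX K n)

lemma Phi_incl (n : ℕ) (x : c.TotX K n) : c.Phi K n (c.incl K n x) = x := by
  funext w
  refine Subtype.ext ?_
  change (c.projX K n w (c.incl K n x) : Chain (c.base K) n) = x w
  rw [incl_apply, map_sum, Submodule.coe_sum,
    Finset.sum_congr rfl fun w' _ => c.coe_projX_of_mem K (x w').2, Finset.sum_ite_eq]
  -- A component with w > n is forgotten by `incl`, but its module is zero.
  split_ifs with h
  · rfl
  · exact (c.eq_zero_of_mem_X K (by simpa using h) (x w).2).symm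

/-- All words in X start in M, whereas 1 lies in A. -/
lemma Phi_consChain (n : ℕ) (z : Chain (c.base K) n) :
    c.Phi K (n + 1) (consChain (c.base K) n z) = 0 := by
  funext w
  refine Subtype.ext ?_
  change (c.projX K (n + 1) w (consChain (c.base K) n z) : Chain (c.base K) (n + 1)) = 0
  rw [coe_projX]
  refine Finset.sum_eq_zero fun S hS => ?_
  induction z using chain_induction with
  | h z =>
    refine LinearMap.congr_fun (f := c.wordProj K (n + 1) S ∘ₗ consChain (c.base K) n ∘ₗ
      (relations (c.base K) n).mkQ) (g := 0) (ten_ext fun x => ?_) z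
    rw [LinearMap.comp_apply, LinearMap.comp_apply, consChain_mk, consOne_seqTen, wordProj_seqTen,
      seqTen, tprod_zero _ 0, map_zero, LinearMap.zero_apply]
    change (if 0 ∈ S then c.projM else c.projA) 1 = 0
    rw [if_pos (mem_places.1 hS).2]
    exact c.projM_of_range (one_mem _)

lemma Phi_s (n : ℕ) (x : c.TotX K n) : c.Phi K (n + 1) (c.s K n x) = 0 := by
  obtain ⟨y, hy⟩ := c.exists_sChain_eq K n (c.incl K n x)
  rw [s, LinearMap.comp_apply, hy, Phi_consChain]

lemma Phi_connes (n : ℕ) (z : Chain (c.base K) n) :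
    c.Phi K (n + 1) (connes (c.base K) n z) = 0 := by
  induction z using chain_induction with
  | h z => rw [connes_mk_eq, Phi_consChain]

/-- The bilinear map `(x, m) ↦ x m` for `x ∈ i(A)` and `m ∈ M`. -/
def actM : E →ₗ[k] E →ₗ[k] E := (mulMap k E).compl₁₂ c.projA c.projM

lemma actM_apply (x y : E) : c.actM x y = c.projA x * c.projM y := rfl

lemma bil_actM : Bil (c.base K) c.actM where
  left r hr x y := by rw [actM_apply, actM_apply, c.projA_left (c.base_le K r hr), mul_assoc]
  mid r hr x y := by
    rw [actM_apply, actM_apply, c.projA_right (c.base_le K r hr),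
      c.projM_left (c.base_le K r hr), mul_assoc]
  right r hr x y := by
    rw [actM_apply, actM_apply, c.projM_right (c.base_le K r hr), mul_assoc]

/-- The map `x₀ ⊗ x₁ ⊗ ⋯ ↦ x₀ x₁ ⊗ ⋯` for `x₀ ∈ i(A)` and `x₁ ∈ M`. -/
def retr (n : ℕ) : Chain (c.base K) (n + 1) →ₗ[k] Chain (c.base K) n :=
  Submodule.mapQ _ _ (inner c.actM 0) <| by
    refine relations_le_comap _ (fun x i r hr => ?_) (fun x i hi hx => ?_)
    · exact Submodule.mem_sup_left (inner_balanced (c.bil_actM K) 0 x i hr)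
    · rcases index_cases 0 i with rfl | rfl | ⟨l, hl, rfl⟩
      · rw [inner_tprod, tprod_zero _ 0]
        · exact zero_mem _
        · rw [contract_self, actM_apply, c.projM_of_range (c.base_le K _ hx), mul_zero]
      · exact absurd rfl hi
      · exact inner_degenerate c.actM 0 x l hl hi hx

lemma retr_consChain (n : ℕ) (x : ℕ → E) :
    c.retr K n (consChain (c.base K) n ((relations (c.base K) n).mkQ (seqTen k n x))) =
      (relations (c.base K) n).mkQ (seqTen k n fun l => if l = 0 then c.projM (x 0) else x l) := by
  rw [consChain_mk]
  change (relations (c.base K) n).mkQ (inner c.actM 0 _) = _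
  have h := face_seqTen (k := k) c.actM n 0 (Nat.zero_le _) (seqCons x)
  rw [face, dif_pos (Nat.succ_pos n)] at h
  rw [consOne_seqTen]
  refine congrArg _ (h.trans (seqTen_congr fun l hl => ?_))
  unfold seqFace
  rw [if_neg (by omega), if_neg (by omega)]
  split_ifs
  · change c.actM 1 (x 0) = _
    rw [actM_apply, c.projA_of_range (one_mem _), one_mul]
  · rfl

/-- In 1 ⊗ τ^r x with 1 ≤ r ≤ R the entry behind the 1 is one of the trailing A-entries, which
`actM` kills; the term r = 0 returns x. Thus s has a left inverse up to `incl`, and so is injective.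
-/
lemma retr_s (n : ℕ) (x : c.TotX K n) : c.retr K n (c.s K n x) = c.incl K n x := by
  refine c.eq_of_incl K (f := c.retr K n ∘ₗ c.sChain K n) (g := LinearMap.id)
    (fun S x h0 hS hx => ?_) x
  obtain ⟨R, hR, -, -, hT⟩ := hx.exists_trail hS ⟨0, h0⟩
  rw [LinearMap.comp_apply, sChain_mk, c.sTen_of_trail hR hT, ← consChain_mk, map_sum, map_sum,
    map_sum, Finset.sum_range_succ', pow_zero, Module.End.one_apply, retr_consChain,
    Finset.sum_eq_zero, zero_add]
  · refine congrArg _ (seqTen_congr fun l hl => ?_)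
    split_ifs with h
    · rw [h, c.projM_of_ker ((hx 0 (Nat.zero_le _)).1 h0)]
    · rfl
  · intro r hr
    have hr' := Finset.mem_range.1 hr
    rw [cyc_pow_seqTen _ _ (by omega), map_smul, map_smul, map_smul, retr_consChain, seqTen,
      tprod_zero _ 0, map_zero, smul_zero]
    change c.projM (seqRots n (r + 1) x 0) = 0
    rw [seqRots, if_pos (Nat.succ_pos r)]
    exact c.projM_of_range (hT.2 _ (by omega) (by omega))

lemma eq_zero_of_s {n : ℕ} {x : c.TotX K n} (h : c.s K n x = 0) : x = 0 := by
  rw [← c.Phi_incl K n x, ← retr_s, h, map_zero, map_zero]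

/-! ### The double complexes -/

lemma bd_bd (n : ℕ) (x : c.TotX K (n + 2)) : c.bd K n (c.bd K (n + 1) x) = 0 := by
  rw [← c.Phi_incl K n (c.bd K n _), ← hochschild_incl, ← hochschild_incl, hochschild_hochschild,
    map_zero]

/-- This is the X-component of ∂² = 0 on s x; `Phi` discards the s-component. -/
lemma bd_sub_tTot (n : ℕ) (x : c.TotX K (n + 1)) : c.bd K n (x - c.tTot K (n + 1) x) =
    c.bd' K n x - c.tTot K n (c.bd' K n x) := by
  have h := hochschild_hochschild (c.base K) n (c.s K (n + 1) x)
  rw [hochschild_s, map_sub, hochschild_incl] at h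
  replace h := congrArg (c.Phi K n) h
  rw [map_sub, Phi_incl, map_zero, sub_eq_zero] at h
  rw [h]
  cases n with
  | zero => rw [hochschild_s_zero, Phi_incl]
  | succ n => rw [hochschild_s, map_sub, Phi_incl, Phi_s, sub_zero]

/-- Once the X-component of ∂² (s x) = 0 is known to vanish, what remains is s applied to the square
of b + d', and s is injective. -/
lemma bd'_bd' (n : ℕ) (x : c.TotX K (n + 2)) : c.bd' K n (c.bd' K (n + 1) x) = 0 := by
  have h := hochschild_hochschild (c.base K) (n + 1) (c.s K (n + 2) x)
  rw [hochschild_s, map_sub, hochschild_incl, hochschild_s, bd_sub_tTot, sub_sub_cancel] at h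
  exact c.eq_zero_of_s K h

theorem isDoubleComplex_X : IsDoubleComplex (fun n w => c.X K n w) (c.b K) (c.d K) :=
  isDoubleComplex_of_tot (c.bd_bd K)

theorem isDoubleComplex_X' : IsDoubleComplex (fun n w => c.X K n w) (c.b K) (c.d' K) :=
  isDoubleComplex_of_tot (c.bd'_bd' K)

/-- The total relation separates by w: for an input in the single component w, the output in w
involves only b, since d lowers w. -/
theorem b_comp_oneSubT (n w : ℕ) :
    c.b K n w ∘ₗ c.oneSubT K (n + 1) w = c.oneSubT K n w ∘ₗ c.b K n w := by
  classical
  refine LinearMap.ext fun z => ?_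
  have := congrFun (c.bd_sub_tTot K n (Pi.single w z)) w
  simp only [tot_apply, tTot, LinearMap.pi_apply, Pi.sub_apply, LinearMap.comp_apply,
    LinearMap.proj_apply] at this
  simpa using this

theorem d_comp_oneSubT (n w : ℕ) :
    c.d K n w ∘ₗ c.oneSubT K (n + 1) (w + 1) = c.oneSubT K n w ∘ₗ c.d' K n w := by
  classical
  refine LinearMap.ext fun z => ?_
  have := congrFun (c.bd_sub_tTot K n (Pi.single (w + 1) z)) w
  simp only [tot_apply, tTot, LinearMap.pi_apply, Pi.sub_apply, LinearMap.comp_apply,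
    LinearMap.proj_apply] at this
  simpa using this

end CleftExt
namespace CleftExt

variable {k A E : Type*} [CommRing k] [Ring A] [Algebra k A] [Ring E] [Algebra k E]
  (c : CleftExt k A E) (K : Subalgebra k A)

/-! ### A small mixed subcomplex of the relative complex -/

/-- The mixed subcomplex generated by the components `X_{vw}`. -/
def smallChain : ∀ n, Submodule k (Chain (c.base K) n)
  | 0 => LinearMap.range (c.incl K 0)
  | n + 1 => LinearMap.range (c.incl K (n + 1)) ⊔ LinearMap.range (c.s K n)

lemma incl_mem_small (n : ℕ) (x : c.TotX K n) : c.incl K n x ∈ c.smallChain K n := by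
  cases n with
  | zero => exact ⟨x, rfl⟩
  | succ n => exact Submodule.mem_sup_left ⟨x, rfl⟩

lemma s_mem_small (n : ℕ) (x : c.TotX K n) : c.s K n x ∈ c.smallChain K (n + 1) :=
  Submodule.mem_sup_right ⟨x, rfl⟩

lemma exists_of_mem_small_succ {n : ℕ} {z : Chain (c.base K) (n + 1)}
    (hz : z ∈ c.smallChain K (n + 1)) : ∃ x y, c.incl K (n + 1) x + c.s K n y = z := by
  obtain ⟨_, ⟨x, rfl⟩, _, ⟨y, rfl⟩, e⟩ := Submodule.mem_sup.1 hz
  exact ⟨x, y, e⟩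

lemma small_induction {n : ℕ} {Q : Submodule k (Chain (c.base K) n)}
    (h1 : ∀ x, c.incl K n x ∈ Q) (h2 : ∀ m (e : n = m + 1) y, e ▸ c.s K m y ∈ Q) :
    c.smallChain K n ≤ Q := by
  cases n with
  | zero =>
    rintro _ ⟨x, rfl⟩
    exact h1 x
  | succ n =>
    refine sup_le ?_ ?_
    · rintro _ ⟨x, rfl⟩
      exact h1 x
    · rintro _ ⟨y, rfl⟩
      exact h2 n rfl y

lemma hochschild_mem_small (n : ℕ) {z : Chain (c.base K) (n + 1)}
    (hz : z ∈ c.smallChain K (n + 1)) : hochschild (c.base K) n z ∈ c.smallChain K n := by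
  obtain ⟨x, y, rfl⟩ := c.exists_of_mem_small_succ K hz
  rw [map_add, hochschild_incl]
  refine add_mem (c.incl_mem_small K _ _) ?_
  cases n with
  | zero =>
    rw [hochschild_s_zero]
    exact c.incl_mem_small K _ _
  | succ n =>
    rw [hochschild_s]
    exact sub_mem (c.incl_mem_small K _ _) (c.s_mem_small K _ _)

lemma connes_mem_small (n : ℕ) {z : Chain (c.base K) n} (hz : z ∈ c.smallChain K n) :
    connes (c.base K) n z ∈ c.smallChain K (n + 1) := by
  refine c.small_induction K (Q := (c.smallChain K (n + 1)).comap (connes (c.base K) n))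
    (fun x => ?_) (fun m e y => ?_) hz
  · rw [Submodule.mem_comap, connes_incl]
    exact c.s_mem_small K _ _
  · subst e
    change connes (c.base K) (m + 1) (c.sChain K m (c.incl K m y)) ∈ c.smallChain K (m + 1 + 1)
    rw [connes_sChain]
    exact zero_mem _

lemma seqTen_mem_rel {n l : ℕ} (hl : l ≤ n) {x : ℕ → E} (h : c.p (x l) = 0) :
    (relations (c.base K) n).mkQ (seqTen k n x) ∈ relChain c.p (c.base K) n := by
  change (relations ((c.base K).map c.p) n).mkQ (tenMap c.p n (seqTen k n x)) = 0
  rw [seqTen, tenMap_tprod, tprod_zero _ ⟨l, by omega⟩ h, map_zero]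

lemma incl_mem_rel (n : ℕ) (x : c.TotX K n) : c.incl K n x ∈ relChain c.p (c.base K) n := by
  refine c.eq_of_incl K (f := chainMap c.p (c.base K) n) (g := 0) (fun S y h0 _ hx => ?_) x
  exact c.seqTen_mem_rel K (Nat.zero_le _) ((hx 0 (Nat.zero_le _)).1 h0)

lemma chainMap_consChain (n : ℕ) (z : Chain (c.base K) n) :
    chainMap c.p (c.base K) (n + 1) (consChain (c.base K) n z) =
      consChain ((c.base K).map c.p) n (chainMap c.p (c.base K) n z) := by
  induction z using chain_induction with
  | h z =>
    change (relations _ (n + 1)).mkQ (tenMap c.p (n + 1) (consOne n z)) =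
      (relations _ (n + 1)).mkQ (consOne n (tenMap c.p n z))
    rw [← LinearMap.comp_apply (tenMap c.p (n + 1)), tenMap_consOne, LinearMap.comp_apply]

lemma consChain_mem_rel (n : ℕ) {z : Chain (c.base K) n} (hz : z ∈ relChain c.p (c.base K) n) :
    consChain (c.base K) n z ∈ relChain c.p (c.base K) (n + 1) := by
  rw [relChain, LinearMap.mem_ker] at hz ⊢
  rw [chainMap_consChain, hz, map_zero]

lemma cyc_pow_mem_rel {n r : ℕ} (hr : r ≤ n) {x : ℕ → E} (h : c.p (x 0) = 0) :
    (relations (c.base K) n).mkQ ((cyc k E n ^ r) (seqTen k n x)) ∈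
      relChain c.p (c.base K) n := by
  rw [cyc_pow_seqTen _ _ (by omega), map_smul]
  refine Submodule.smul_mem _ _ (c.seqTen_mem_rel K hr ?_)
  rwa [seqRots, if_neg (lt_irrefl _), Nat.sub_self]

lemma s_mem_rel (n : ℕ) (x : c.TotX K n) : c.s K n x ∈ relChain c.p (c.base K) (n + 1) := by
  refine c.eq_of_incl K (f := chainMap c.p (c.base K) (n + 1) ∘ₗ c.sChain K n) (g := 0)
    (fun S y h0 hS hx => ?_) x
  obtain ⟨R, hR, -, -, hT⟩ := hx.exists_trail hS ⟨0, h0⟩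
  rw [LinearMap.comp_apply, sChain_mk, c.sTen_of_trail hR hT, ← consChain_mk, map_sum]
  refine c.consChain_mem_rel K n (sum_mem fun r hr => ?_)
  have := Finset.mem_range.1 hr
  exact c.cyc_pow_mem_rel K (by omega) ((hx 0 (Nat.zero_le _)).1 h0)

lemma small_le_rel (n : ℕ) : c.smallChain K n ≤ relChain c.p (c.base K) n := by
  refine c.small_induction K (fun x => c.incl_mem_rel K n x) (fun m e y => ?_)
  subst e
  exact c.s_mem_rel K m y

/-! ### Sequences with entries from `M` or `A` -/

/-- Each of the terms `x₀, …, xₙ` is in `M` or in `i(A)`. -/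
def Pure (n : ℕ) (x : ℕ → E) : Prop := ∀ l ≤ n, c.p (x l) = 0 ∨ x l ∈ c.i.range

variable {c} in
lemma SWord.pure {n : ℕ} {S : Finset ℕ} {x : ℕ → E} (hx : c.SWord n S x) : c.Pure n x := by
  intro l hl
  by_cases h : l ∈ S
  · exact Or.inl ((hx l hl).1 h)
  · exact Or.inr ((hx l hl).2 h)

variable {c} in
lemma Pure.exists_sword {n : ℕ} {x : ℕ → E} (hx : c.Pure n x) :
    ∃ S ⊆ Finset.range (n + 1), c.SWord n S x ∧ ∀ l ≤ n, c.p (x l) = 0 → l ∈ S := by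
  classical
  refine ⟨(Finset.range (n + 1)).filter fun l => c.p (x l) = 0, Finset.filter_subset _ _,
    fun l hl => ⟨fun h => (Finset.mem_filter.1 h).2, fun h => (hx l hl).resolve_left fun h' => ?_⟩,
    fun l hl h => ?_⟩
  · exact h (Finset.mem_filter.2 ⟨Finset.mem_range.2 (by omega), h'⟩)
  · exact Finset.mem_filter.2 ⟨Finset.mem_range.2 (by omega), h⟩

lemma X_le_range_incl (n w : ℕ) : c.X K n w ≤ LinearMap.range (c.incl K n) := by
  classical
  intro z hz
  by_cases hw : w < n + 1
  · refine ⟨Pi.single w ⟨z, hz⟩, ?_⟩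
    rw [incl_apply, Finset.sum_eq_single w]
    · rw [Pi.single_eq_same]
    · intro w' _ h
      rw [Pi.single_eq_of_ne h]
      rfl
    · intro h
      exact absurd (Finset.mem_range.2 hw) h
  · rw [c.eq_zero_of_mem_X K (by omega) hz]
    exact zero_mem _

variable {c} in
lemma Pure.mem_small {n : ℕ} {x : ℕ → E} (hx : c.Pure n x) (h0 : c.p (x 0) = 0) :
    (relations (c.base K) n).mkQ (seqTen k n x) ∈ c.smallChain K n := by
  obtain ⟨S, hS, hw, hmem⟩ := hx.exists_sword
  have h0' := hmem 0 (Nat.zero_le _) h0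
  have hpos := Finset.card_pos.2 ⟨0, h0'⟩
  obtain ⟨y, hy⟩ := c.X_le_range_incl K n (S.card - 1) (hw.mk_mem K h0' hS (by omega))
  rw [← hy]
  exact c.incl_mem_small K _ _

lemma mul_pure {x y : E} (hx : c.p x = 0 ∨ x ∈ c.i.range) (hy : c.p y = 0 ∨ y ∈ c.i.range) :
    c.p (x * y) = 0 ∨ x * y ∈ c.i.range := by
  rcases hx with hx | hx
  · exact Or.inl (by rw [map_mul, hx, zero_mul])
  · rcases hy with hy | hy
    · exact Or.inl (by rw [map_mul, hy, mul_zero])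
    · exact Or.inr (mul_mem hx hy)

variable {c} in
lemma Pure.face {n j : ℕ} (hj : j ≤ n + 1) {x : ℕ → E} (hx : c.Pure (n + 1) x) :
    c.Pure n (seqFace (mulMap k E) (n + 1) j x) := by
  intro l hl
  unfold seqFace
  split_ifs
  · exact c.mul_pure (hx _ le_rfl) (hx _ (Nat.zero_le _))
  · exact hx _ (by omega)
  · exact c.mul_pure (hx _ hj) (hx _ (by omega))
  · exact hx _ (by omega)

variable {c} in
lemma Pure.rot {n : ℕ} {x : ℕ → E} (hx : c.Pure n x) : c.Pure n (seqRot n x) := by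
  intro l hl
  unfold seqRot
  split_ifs
  · exact hx _ le_rfl
  · exact hx _ (by omega)

variable {c} in
lemma Pure.rots {n r : ℕ} (hr : r ≤ n + 1) {x : ℕ → E} (hx : c.Pure n x) :
    c.Pure n (seqRots n r x) := by
  intro l hl
  unfold seqRots
  split_ifs
  · exact hx _ (by omega)
  · exact hx _ (by omega)

variable {c} in
lemma Pure.cons {n : ℕ} {x : ℕ → E} (hx : c.Pure n x) : c.Pure (n + 1) (seqCons x) := by
  intro l hl
  unfold seqCons
  split_ifs
  · exact Or.inr (one_mem _)
  · exact hx _ (by omega)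

/-- The span of the words with first entry from `A` and at most `r - 1` entries from `A` after the
last one from `M`. -/
def tailSpan (n r : ℕ) : Submodule k (Chain (c.base K) n) :=
  Submodule.span k {z | ∃ x, c.Pure n x ∧ x 0 ∈ c.i.range ∧
    (∃ i ≤ n, c.p (x i) = 0 ∧ n < i + r) ∧ z = (relations (c.base K) n).mkQ (seqTen k n x)}

lemma tailSpan_zero (n : ℕ) : c.tailSpan K n 0 = ⊥ := by
  rw [tailSpan, Submodule.span_eq_bot]
  rintro _ ⟨x, -, -, ⟨i, hi, -, hi'⟩, -⟩
  omega

/-- Expand every entry as the sum of its M-part and its A-part. -/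
lemma sum_wordProj (n : ℕ) (z : Chain (c.base K) n) :
    ∑ S : Finset (Fin (n + 1)), c.wordProj K n (S.map Fin.valEmbedding) z = z := by
  induction z using chain_induction with
  | h z =>
    rw [← LinearMap.sum_apply]
    refine LinearMap.congr_fun (f := (∑ S : Finset (Fin (n + 1)),
      c.wordProj K n (S.map Fin.valEmbedding)) ∘ₗ (relations (c.base K) n).mkQ)
      (g := (relations (c.base K) n).mkQ) (ten_ext fun x => ?_) z
    rw [LinearMap.comp_apply, LinearMap.sum_apply]
    simp only [wordProj_seqTen]
    rw [← map_sum]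
    congr 1
    have h := (PiTensorProduct.tprod k (s := fun _ : Fin (n + 1) => E)).map_add_univ
      (fun j => c.projM (x j)) (fun j => c.projA (x j))
    have e : (fun j : Fin (n + 1) => c.projM (x j)) + (fun j : Fin (n + 1) => c.projA (x j)) =
        fun j : Fin (n + 1) => x j := by
      funext j
      simp [projM_apply, projA_apply]
    rw [e] at h
    rw [seqTen, h]
    refine Finset.sum_congr rfl fun S _ => ?_
    rw [seqTen]
    congr 1
    funext j
    have hj : (j : ℕ) ∈ S.map Fin.valEmbedding ↔ j ∈ S := by
      simp [Fin.val_inj]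
    by_cases h : j ∈ S
    · rw [if_pos (hj.2 h), Finset.piecewise_eq_of_mem _ _ _ h]
    · rw [if_neg (fun h' => h (hj.1 h')), Finset.piecewise_eq_of_notMem _ _ _ h]

/-- Projecting all entries onto A is applying p and then i. If p sends a representative to a
relation over K, then i carries this relation back to one in E. -/
lemma wordProj_empty (n : ℕ) {z : Chain (c.base K) n} (hz : z ∈ relChain c.p (c.base K) n) :
    c.wordProj K n ∅ z = 0 := by
  revert hz
  induction z using chain_induction with
  | h z =>
    intro hz
    have h1 : tenMap c.p n z ∈ relations ((c.base K).map c.p) n :=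
      (Submodule.Quotient.mk_eq_zero _).1 hz
    have h2 := tenMap_le c.i ((c.base K).map c.p) n h1
    have e : ((c.base K).map c.p).map c.i = c.base K := by
      refine le_antisymm ?_ ?_
      · rintro _ ⟨_, ⟨_, ⟨a, ha, rfl⟩, rfl⟩, rfl⟩
        exact ⟨a, ha, congrArg c.i (c.p_i a).symm⟩
      · rintro _ ⟨a, ha, rfl⟩
        exact ⟨a, ⟨c.i a, ⟨a, ha, rfl⟩, c.p_i a⟩, rfl⟩
    rw [e, Submodule.mem_comap] at h2
    change (relations (c.base K) n).mkQ (PiTensorProduct.map _ z) = 0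
    rw [Submodule.mkQ_apply, Submodule.Quotient.mk_eq_zero]
    convert h2 using 1
    refine LinearMap.congr_fun (g := tenMap c.i n ∘ₗ tenMap c.p n) (ten_ext fun x => ?_) z
    rw [LinearMap.comp_apply, seqTen, PiTensorProduct.map_tprod, tenMap_tprod, tenMap_tprod]
    rfl

/-- The relative chains are spanned by the words with an entry from `M`. -/
lemma rel_le (n : ℕ) : relChain c.p (c.base K) n ≤ c.tailSpan K n (n + 1) ⊔ c.smallChain K n := by
  intro z hz
  rw [← c.sum_wordProj K n z]
  refine sum_mem fun S _ => ?_
  rcases S.eq_empty_or_nonempty with rfl | ⟨i, hi⟩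
  · rw [Finset.map_empty, c.wordProj_empty K n hz]
    exact zero_mem _
  · clear hz
    rw [← Submodule.Quotient.mk_eq_zero, ← Submodule.mkQ_apply]
    induction z using chain_induction with
    | h z =>
      refine LinearMap.congr_fun (f := (c.tailSpan K n (n + 1) ⊔ c.smallChain K n).mkQ ∘ₗ
        c.wordProj K n (S.map Fin.valEmbedding) ∘ₗ (relations (c.base K) n).mkQ) (g := 0)
        (ten_ext fun x => ?_) z
      rw [LinearMap.comp_apply, LinearMap.comp_apply, wordProj_seqTen, LinearMap.zero_apply,
        Submodule.mkQ_apply, Submodule.Quotient.mk_eq_zero]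
      have hw := c.sword_wordProj n (S.map Fin.valEmbedding) x
      by_cases h0 : 0 ∈ S.map Fin.valEmbedding
      · exact Submodule.mem_sup_right (hw.pure.mem_small K ((hw 0 (Nat.zero_le _)).1 h0))
      · refine Submodule.mem_sup_left (Submodule.subset_span ⟨_, hw.pure,
          (hw 0 (Nat.zero_le _)).2 h0, ⟨i, by omega, ?_, by omega⟩, rfl⟩)
        exact (hw i (by omega)).1 (Finset.mem_map.2 ⟨i, hi, rfl⟩)

end CleftExt
namespace CleftExt

variable {k A E : Type*} [CommRing k] [Ring A] [Algebra k A] [Ring E] [Algebra k E]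
  (c : CleftExt k A E) (K : Subalgebra k A)

/-! ### The relative complex retracts onto the small subcomplex -/

/-- The first entry is projected onto `i(A)`. -/
def headEntry (l : ℕ) : E →ₗ[k] E := if l = 0 then c.projA else LinearMap.id

/-- The map which projects the first entry of a tensor onto `i(A)`. -/
def headA (n : ℕ) : Chain (c.base K) n →ₗ[k] Chain (c.base K) n :=
  Submodule.mapQ _ _ (PiTensorProduct.map fun j : Fin (n + 1) => c.headEntry j)
    (map_mode_le _ fun j => by
      unfold headEntry
      split_ifs
      · exact c.isMode_projA K
      · exact IsMode.id _)

lemma headA_seqTen (n : ℕ) (x : ℕ → E) :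
    c.headA K n ((relations (c.base K) n).mkQ (seqTen k n x)) =
      (relations (c.base K) n).mkQ (seqTen k n fun l => c.headEntry l (x l)) := by
  change (relations (c.base K) n).mkQ (PiTensorProduct.map _ (seqTen k n x)) = _
  rw [map_seqTen n c.headEntry]

lemma headA_of_ker {n : ℕ} {x : ℕ → E} (h : c.p (x 0) = 0) :
    c.headA K n ((relations (c.base K) n).mkQ (seqTen k n x)) = 0 := by
  rw [headA_seqTen, seqTen, tprod_zero _ 0, map_zero]
  exact c.projA_of_ker h

lemma headA_of_range {n : ℕ} {x : ℕ → E} (h : x 0 ∈ c.i.range) :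
    c.headA K n ((relations (c.base K) n).mkQ (seqTen k n x)) =
      (relations (c.base K) n).mkQ (seqTen k n x) := by
  rw [headA_seqTen]
  refine congrArg _ (seqTen_congr fun l _ => ?_)
  unfold headEntry
  split_ifs with hl
  · subst hl
    exact c.projA_of_range h
  · rfl

lemma headA_consChain (n : ℕ) (z : Chain (c.base K) n) :
    c.headA K (n + 1) (consChain (c.base K) n z) = consChain (c.base K) n z := by
  induction z using chain_induction with
  | h z =>
    refine LinearMap.congr_fun (f := c.headA K (n + 1) ∘ₗ consChain (c.base K) n ∘ₗ
      (relations (c.base K) n).mkQ) (g := consChain (c.base K) n ∘ₗ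
      (relations (c.base K) n).mkQ) (ten_ext fun x => ?_) z
    rw [LinearMap.comp_apply, LinearMap.comp_apply, consChain_mk, consOne_seqTen]
    exact c.headA_of_range K (one_mem _)

lemma headA_mem_rel (n : ℕ) {z : Chain (c.base K) n} (hz : z ∈ relChain c.p (c.base K) n) :
    c.headA K n z ∈ relChain c.p (c.base K) n := by
  rw [relChain, LinearMap.mem_ker] at hz ⊢
  rw [← hz]
  clear hz
  induction z using chain_induction with
  | h z =>
    refine LinearMap.congr_fun (f := chainMap c.p (c.base K) n ∘ₗ c.headA K n ∘ₗ
      (relations (c.base K) n).mkQ) (g := chainMap c.p (c.base K) n ∘ₗ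
      (relations (c.base K) n).mkQ) (ten_ext fun x => ?_) z
    rw [LinearMap.comp_apply, LinearMap.comp_apply, LinearMap.comp_apply, headA_seqTen]
    change (relations ((c.base K).map c.p) n).mkQ (tenMap c.p n _) =
      (relations ((c.base K).map c.p) n).mkQ (tenMap c.p n _)
    rw [seqTen, seqTen, tenMap_tprod, tenMap_tprod]
    congr 2
    funext j
    unfold headEntry
    split_ifs
    · exact c.p_projA _
    · rfl

/-- The homotopy `x₀ ⊗ ⋯ ⊗ xₙ ↦ 1 ⊗ x₀ ⊗ ⋯ ⊗ xₙ` for `x₀ ∈ i(A)`, and zero for `x₀ ∈ M`. -/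
def headHom (n : ℕ) : Chain (c.base K) n →ₗ[k] Chain (c.base K) (n + 1) :=
  consChain (c.base K) n ∘ₗ c.headA K n

lemma headHom_mem_rel (n : ℕ) {z : Chain (c.base K) n} (hz : z ∈ relChain c.p (c.base K) n) :
    c.headHom K n z ∈ relChain c.p (c.base K) (n + 1) :=
  c.consChain_mem_rel K n (c.headA_mem_rel K n hz)

/-- Words in X start in M, where the homotopy is zero; elements of sX start with 1, and a second 1
makes them degenerate. -/
lemma headHom_eq_zero (n : ℕ) {z : Chain (c.base K) n} (hz : z ∈ c.smallChain K n) :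
    c.headHom K n z = 0 := by
  refine c.small_induction K (Q := LinearMap.ker (c.headHom K n)) (fun x => ?_)
    (fun m e y => ?_) hz
  · refine c.eq_of_incl K (f := c.headHom K n) (g := 0) (fun S y h0 _ hx => ?_) x
    rw [headHom, LinearMap.comp_apply, c.headA_of_ker K ((hx 0 (Nat.zero_le _)).1 h0), map_zero]
    rfl
  · subst e
    change c.headHom K (m + 1) (c.sChain K m (c.incl K m y)) = 0
    obtain ⟨v, hv⟩ := c.exists_sChain_eq K m (c.incl K m y)
    rw [hv, headHom, LinearMap.comp_apply, headA_consChain, consChain_consChain]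

/-- The map `1 - b h - h b` for the homotopy `h`. -/
def headDefect (n : ℕ) : Chain (c.base K) (n + 1) →ₗ[k] Chain (c.base K) (n + 1) :=
  LinearMap.id - hochschild (c.base K) (n + 1) ∘ₗ c.headHom K (n + 1) -
    c.headHom K n ∘ₗ hochschild (c.base K) n

lemma headDefect_apply (n : ℕ) (z : Chain (c.base K) (n + 1)) : c.headDefect K n z =
    z - hochschild (c.base K) (n + 1) (c.headHom K (n + 1) z) -
      c.headHom K n (hochschild (c.base K) n z) := rfl

lemma mk_mem_tailSpan {n r i : ℕ} {x : ℕ → E} (hx : c.Pure n x) (h0 : x 0 ∈ c.i.range)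
    (hi : i ≤ n) (hxi : c.p (x i) = 0) (hr : n < i + r) :
    (relations (c.base K) n).mkQ (seqTen k n x) ∈ c.tailSpan K n r :=
  Submodule.subset_span ⟨x, hx, h0, ⟨i, hi, hxi, hr⟩, rfl⟩

lemma consChain_seqTen (n : ℕ) (x : ℕ → E) :
    consChain (c.base K) n ((relations (c.base K) n).mkQ (seqTen k n x)) =
      (relations (c.base K) (n + 1)).mkQ (seqTen k (n + 1) (seqCons x)) := by
  rw [consChain_mk, consOne_seqTen]

/-- For y starting in M, s y is 1 ⊗ y plus the terms 1 ⊗ τ^q y with 1 ≤ q ≤ R. In those the last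
M-entry of y has moved q places towards the end, so modulo the small subcomplex 1 ⊗ y has a shorter
tail. -/
lemma consChain_mem_of_ker {n r i : ℕ} {x : ℕ → E} (hx : c.Pure n x) (h0 : c.p (x 0) = 0)
    (hi : i ≤ n) (hxi : c.p (x i) = 0) (hr : n < i + r + 1) :
    consChain (c.base K) n ((relations (c.base K) n).mkQ (seqTen k n x)) ∈
      c.tailSpan K (n + 1) r ⊔ c.smallChain K (n + 1) := by
  obtain ⟨S, hS, hw, hmem⟩ := hx.exists_sword
  have h0' := hmem 0 (Nat.zero_le _) h0
  obtain ⟨R, hR, -, hmax, hT⟩ := hw.exists_trail hS ⟨0, h0'⟩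
  have hiR := hmax i (hmem i hi hxi)
  have hsmall : c.sChain K n ((relations (c.base K) n).mkQ (seqTen k n x)) ∈
      c.smallChain K (n + 1) := by
    have hpos := Finset.card_pos.2 ⟨0, h0'⟩
    obtain ⟨y, hy⟩ := c.X_le_range_incl K n (S.card - 1) (hw.mk_mem K h0' hS (by omega))
    rw [← hy]
    exact c.s_mem_small K n y
  have hs := c.sChain_mk K n (seqTen k n x)
  rw [c.sTen_of_trail hR hT, ← consChain_mk, Finset.sum_range_succ', pow_zero,
    Module.End.one_apply, map_add, map_add] at hs
  rw [← add_sub_cancel_left (consChain (c.base K) n _ )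
    (consChain (c.base K) n ((relations (c.base K) n).mkQ (seqTen k n x))), ← hs]
  refine sub_mem (Submodule.mem_sup_right hsmall) (Submodule.mem_sup_left ?_)
  rw [map_sum, map_sum]
  refine sum_mem fun q hq => ?_
  have hq' := Finset.mem_range.1 hq
  rw [cyc_pow_seqTen _ _ (by omega), map_smul, map_smul, consChain_seqTen]
  refine Submodule.smul_mem _ _ (c.mk_mem_tailSpan K (i := n - R + q + 1 + 1)
    (hx.rots (by omega)).cons (one_mem _) (by omega) ?_ (by omega))
  rw [seqCons, if_neg (by omega), Nat.add_sub_cancel, seqRots, if_neg (by omega)]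
  rw [show n - R + q + 1 - (q + 1) = n - R by omega]
  exact hT.1

/-- A rotation either brings an M-entry to the front, giving a word of X, or an A-entry, and then
the M-entry at i moves one place closer to the end. -/
lemma cyc_mem {n r i : ℕ} {x : ℕ → E} (hx : c.Pure n x) (hi : i ≤ n) (hxi : c.p (x i) = 0)
    (hr : n < i + r + 1) :
    (relations (c.base K) n).mkQ (cyc k E n (seqTen k n x)) ∈
      c.tailSpan K n r ⊔ c.smallChain K n := by
  rw [cyc_seqTen, map_smul]
  refine Submodule.smul_mem _ _ ?_
  by_cases h : c.p (x n) = 0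
  · exact Submodule.mem_sup_right (hx.rot.mem_small K h)
  · have hin : i ≠ n := fun e => h (e ▸ hxi)
    exact Submodule.mem_sup_left (c.mk_mem_tailSpan K (i := i + 1) hx.rot
      ((hx n le_rfl).resolve_left h) (by omega) hxi (by omega))

/-- If the last entry is in M, so is its product with x₀ and the homotopy vanishes. Otherwise the
cyclic face consumes one A-entry at the end and the new 1 in front shifts the M-entry one place to
the right. -/
lemma headHom_last_mem {n r i : ℕ} {x : ℕ → E} (hx : c.Pure (n + 1) x) (h0 : x 0 ∈ c.i.range)
    (hi : i ≤ n + 1) (hxi : c.p (x i) = 0) (hr : n + 1 < i + r + 1) :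
    c.headHom K n ((relations (c.base K) n).mkQ
      (sface (mulMap k E) n (n + 1) (seqTen k (n + 1) x))) ∈ c.tailSpan K (n + 1) r := by
  rw [sface_seqTen _ _ _ le_rfl, map_smul, map_smul, headHom, LinearMap.comp_apply]
  refine Submodule.smul_mem _ _ ?_
  have hF0 : seqFace (mulMap k E) (n + 1) (n + 1) x 0 = x (n + 1) * x 0 := by
    rw [seqFace, if_pos ⟨rfl, rfl⟩, LinearMap.mul_apply']
  by_cases h : c.p (x (n + 1)) = 0
  · rw [c.headA_of_ker K (by rw [hF0, map_mul, h, zero_mul]), map_zero]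
    exact zero_mem _
  · have hin : i ≠ n + 1 := fun e => h (e ▸ hxi)
    have hA := (hx (n + 1) le_rfl).resolve_left h
    rw [c.headA_of_range K (by rw [hF0]; exact mul_mem hA h0), consChain_seqTen]
    refine c.mk_mem_tailSpan K (i := i + 1) (hx.face le_rfl).cons (one_mem _) (by omega) ?_
      (by omega)
    rw [seqCons, if_neg (by omega), Nat.add_sub_cancel]
    rcases Nat.eq_zero_or_pos i with rfl | hpos
    · rw [hF0, map_mul, hxi, mul_zero]
    · rw [seqFace, if_neg (by omega), if_pos (by omega), hxi]

/-- If x₁ ∈ A, the homotopy is 1 ⊗ on this face and the difference is zero. If x₁ ∈ M, the homotopy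
vanishes and 1 ⊗ y remains for a word y starting in M. -/
lemma consChain_face_zero_mem {n r i : ℕ} {x : ℕ → E} (hx : c.Pure (n + 1) x)
    (h0 : x 0 ∈ c.i.range) (hi : i ≤ n + 1) (hxi : c.p (x i) = 0) (hr : n + 1 < i + r + 1) :
    consChain (c.base K) n ((relations (c.base K) n).mkQ
      (sface (mulMap k E) n 0 (seqTen k (n + 1) x))) -
    c.headHom K n ((relations (c.base K) n).mkQ
      (sface (mulMap k E) n 0 (seqTen k (n + 1) x))) ∈
        c.tailSpan K (n + 1) r ⊔ c.smallChain K (n + 1) := by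
  rw [sface_seqTen _ _ _ (Nat.zero_le _), pow_zero, one_smul, headHom, LinearMap.comp_apply]
  have hF0 : seqFace (mulMap k E) (n + 1) 0 x 0 = x 0 * x 1 := by
    rw [seqFace, if_neg (by omega), if_neg (by omega), if_pos rfl, LinearMap.mul_apply']
  by_cases h : c.p (x 1) = 0
  · have hF : c.p (seqFace (mulMap k E) (n + 1) 0 x 0) = 0 := by
      rw [hF0, map_mul, h, mul_zero]
    rw [c.headA_of_ker K hF, map_zero, sub_zero]
    refine c.consChain_mem_of_ker K (i := i - 1) (hx.face (Nat.zero_le _)) hF (by omega) ?_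
      (by omega)
    rcases Nat.eq_zero_or_pos (i - 1) with h' | h'
    · rw [h', hF]
    · rw [seqFace, if_neg (by omega), if_neg (by omega), if_neg (by omega),
        Nat.sub_add_cancel (by omega), hxi]
  · rw [c.headA_of_range K (by
      rw [hF0]; exact mul_mem h0 ((hx 1 (by omega)).resolve_left h)), sub_self]
    exact zero_mem _

/-- The faces that leave x₀ alone cancel between ∂h and h∂. What is left is the rotation and the
contributions of face 0 and of the cyclic face, each of which has a shorter tail or is small. -/
lemma headDefect_mem {n r i : ℕ} {x : ℕ → E} (hx : c.Pure (n + 1) x) (h0 : x 0 ∈ c.i.range)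
    (hi : i ≤ n + 1) (hxi : c.p (x i) = 0) (hr : n + 1 < i + r + 1) :
    c.headDefect K n ((relations (c.base K) (n + 1)).mkQ (seqTen k (n + 1) x)) ∈
      c.tailSpan K (n + 1) r ⊔ c.smallChain K (n + 1) := by
  have hinner : ∀ j ∈ Finset.range n, c.headHom K n ((relations (c.base K) n).mkQ
      (sface (mulMap k E) n (j + 1) (seqTen k (n + 1) x))) = consChain (c.base K) n
        ((relations (c.base K) n).mkQ (sface (mulMap k E) n (j + 1) (seqTen k (n + 1) x))) := by
    intro j hj
    have := Finset.mem_range.1 hj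
    rw [sface_seqTen _ _ _ (by omega), map_smul, map_smul, map_smul, headHom,
      LinearMap.comp_apply, c.headA_of_range K]
    rwa [seqFace, if_neg (by omega), if_pos (by omega)]
  have e : c.headDefect K n ((relations (c.base K) (n + 1)).mkQ (seqTen k (n + 1) x)) =
      (relations (c.base K) (n + 1)).mkQ (cyc k E (n + 1) (seqTen k (n + 1) x)) +
      (consChain (c.base K) n ((relations (c.base K) n).mkQ
          (sface (mulMap k E) n 0 (seqTen k (n + 1) x))) -
        c.headHom K n ((relations (c.base K) n).mkQ
          (sface (mulMap k E) n 0 (seqTen k (n + 1) x)))) -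
      c.headHom K n ((relations (c.base K) n).mkQ
        (sface (mulMap k E) n (n + 1) (seqTen k (n + 1) x))) := by
    rw [headDefect_apply]
    nth_rewrite 1 [headHom]
    rw [LinearMap.comp_apply, c.headA_of_range K h0, consChain_mk, hochschild_mk, hochschild_mk,
      cyclicSum_consOne_succ, cyclicSum_eq, openSum_eq, Finset.sum_range_succ _ (n + 1),
      Finset.sum_range_succ']
    simp only [LinearMap.add_apply, LinearMap.sum_apply, map_add, map_sub, map_sum]
    rw [Finset.sum_congr rfl hinner]
    simp only [consChain_mk]
    abel
  rw [e]
  exact sub_mem (add_mem (c.cyc_mem K hx hi hxi hr)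
    (c.consChain_face_zero_mem K hx h0 hi hxi hr))
    (Submodule.mem_sup_left (c.headHom_last_mem K hx h0 hi hxi hr))

lemma headDefect_le (n r : ℕ) :
    c.tailSpan K (n + 1) (r + 1) ⊔ c.smallChain K (n + 1) ≤
      (c.tailSpan K (n + 1) r ⊔ c.smallChain K (n + 1)).comap (c.headDefect K n) := by
  refine sup_le (Submodule.span_le.2 ?_) fun z hz => ?_
  · rintro _ ⟨x, hx, h0, ⟨i, hi, hxi, hr⟩, rfl⟩
    exact c.headDefect_mem K hx h0 hi hxi hr
  · rw [Submodule.mem_comap, headDefect_apply, c.headHom_eq_zero K _ hz,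
      c.headHom_eq_zero K _ (c.hochschild_mem_small K n hz), map_zero, sub_zero, sub_zero]
    exact Submodule.mem_sup_right hz

/-- Because h kills the small subcomplex, h ∂ z = 0, so z - ∂ h z is the defect of z and lies one
step lower in the filtration. After r steps only the small part remains. -/
lemma exists_sub_mem_small {n : ℕ} (r : ℕ) {z : Chain (c.base K) (n + 1)}
    (hz : z ∈ c.tailSpan K (n + 1) r ⊔ c.smallChain K (n + 1))
    (hrel : z ∈ relChain c.p (c.base K) (n + 1))
    (hb : hochschild (c.base K) n z ∈ c.smallChain K n) :
    ∃ y ∈ relChain c.p (c.base K) (n + 2),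
      z - hochschild (c.base K) (n + 1) y ∈ c.smallChain K (n + 1) := by
  induction r generalizing z with
  | zero =>
    rw [tailSpan_zero, bot_sup_eq] at hz
    exact ⟨0, zero_mem _, by rwa [map_zero, sub_zero]⟩
  | succ r ih =>
    have h1 := c.headDefect_le K n r hz
    rw [Submodule.mem_comap, headDefect_apply, c.headHom_eq_zero K n hb, sub_zero] at h1
    have hy := c.headHom_mem_rel K (n + 1) hrel
    have h2 : hochschild (c.base K) (n + 1) (c.headHom K (n + 1) z) ∈
        relChain c.p (c.base K) (n + 1) :=
      (relHochschild c.p (c.base K) (n + 1) ⟨_, hy⟩).2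
    obtain ⟨y, hy', h3⟩ := ih h1 (sub_mem hrel h2)
      (by rwa [map_sub, hochschild_hochschild, sub_zero])
    refine ⟨c.headHom K (n + 1) z + y, add_mem hy hy', ?_⟩
    rwa [map_add, ← sub_sub]

lemma rel_zero_le : relChain c.p (c.base K) 0 ≤ c.smallChain K 0 := by
  refine (c.rel_le K 0).trans (sup_le (Submodule.span_le.2 ?_) le_rfl)
  rintro _ ⟨x, hx, -, ⟨i, hi, hxi, -⟩, rfl⟩
  obtain rfl : i = 0 := by omega
  exact hx.mem_small K hxi

end CleftExt

/-! ### Restriction of a mixed complex to a subcomplex. -/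

section Restriction

variable {k : Type*} [CommRing k] {C : ℕ → Type*} [∀ n, AddCommGroup (C n)] [∀ n, Module k (C n)]
  {b : ∀ n, C (n + 1) →ₗ[k] C n} {B : ∀ n, C n →ₗ[k] C (n + 1)}

lemma IsMixedComplex.restrict (h : IsMixedComplex C b B) (P : ∀ n, Submodule k (C n))
    (hb : ∀ n, ∀ z ∈ P (n + 1), b n z ∈ P n) (hB : ∀ n, ∀ z ∈ P n, B n z ∈ P (n + 1)) :
    IsMixedComplex (fun n => P n) (fun n => (b n).restrict (hb n))
      (fun n => (B n).restrict (hB n)) where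
  b_b n := LinearMap.ext fun z => Subtype.ext (LinearMap.congr_fun (h.b_b n) z)
  B_B n := LinearMap.ext fun z => Subtype.ext (LinearMap.congr_fun (h.B_B n) z)
  b_B_zero := LinearMap.ext fun z => Subtype.ext (LinearMap.congr_fun h.b_B_zero z)
  b_B n := LinearMap.ext fun z => Subtype.ext (LinearMap.congr_fun (h.b_B n) z)

end Restriction

namespace CleftExt

variable {k A E : Type*} [CommRing k] [Ring A] [Algebra k A] [Ring E] [Algebra k E]
  (c : CleftExt k A E) (K : Subalgebra k A)

/-! ### The cokernel of `1 - t` -/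

/-- The projection `X_{vw} → X̄_{vw}`. -/
def mkXbar (n w : ℕ) : c.X K n w →ₗ[k] c.Xbar K n w :=
  (LinearMap.range (c.oneSubT K n w)).mkQ

lemma mkXbar_surjective (n w : ℕ) : Function.Surjective (c.mkXbar K n w) :=
  Submodule.mkQ_surjective _

lemma mkXbar_oneSubT (n w : ℕ) (x : c.X K n w) : c.mkXbar K n w (c.oneSubT K n w x) = 0 :=
  (Submodule.Quotient.mk_eq_zero _).2 ⟨x, rfl⟩

lemma exists_of_mkXbar_eq_zero {n w : ℕ} {x : c.X K n w} (h : c.mkXbar K n w x = 0) :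
    ∃ y, c.oneSubT K n w y = x :=
  (Submodule.Quotient.mk_eq_zero _).1 h

lemma isDoubleComplex_Xbar
    (hb : ∀ n w, c.b K n w ∘ₗ c.oneSubT K (n + 1) w = c.oneSubT K n w ∘ₗ c.b K n w)
    (hd : ∀ n w, c.d K n w ∘ₗ c.oneSubT K (n + 1) (w + 1) = c.oneSubT K n w ∘ₗ c.d' K n w) :
    IsDoubleComplex (fun n w => c.Xbar K n w) (c.bBar K hb) (c.dBar K hd) where
  b_b n w := by
    refine LinearMap.ext fun z => ?_
    obtain ⟨x, rfl⟩ := c.mkXbar_surjective K _ _ z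
    exact congrArg (c.mkXbar K n w) (LinearMap.congr_fun ((c.isDoubleComplex_X K).b_b n w) x)
  d_d n w := by
    refine LinearMap.ext fun z => ?_
    obtain ⟨x, rfl⟩ := c.mkXbar_surjective K _ _ z
    exact congrArg (c.mkXbar K n w) (LinearMap.congr_fun ((c.isDoubleComplex_X K).d_d n w) x)
  b_d n w := by
    refine LinearMap.ext fun z => ?_
    obtain ⟨x, rfl⟩ := c.mkXbar_surjective K _ _ z
    exact congrArg (c.mkXbar K n w) (LinearMap.congr_fun ((c.isDoubleComplex_X K).b_d n w) x)

/-- The projection of the total complexes. -/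
def mkTot (n : ℕ) : c.TotX K n →ₗ[k] Tot (fun m w => c.Xbar K m w) n :=
  LinearMap.pi fun w => c.mkXbar K n w ∘ₗ LinearMap.proj w

lemma mkTot_surjective (n : ℕ) : Function.Surjective (c.mkTot K n) := by
  intro z
  choose x hx using fun w => c.mkXbar_surjective K n w (z w)
  exact ⟨x, funext hx⟩

lemma mkTot_sub_tTot (n : ℕ) (x : c.TotX K n) : c.mkTot K n (x - c.tTot K n x) = 0 :=
  funext fun w => c.mkXbar_oneSubT K n w (x w)

lemma mkTot_bd (hb : ∀ n w, c.b K n w ∘ₗ c.oneSubT K (n + 1) w = c.oneSubT K n w ∘ₗ c.b K n w)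
    (hd : ∀ n w, c.d K n w ∘ₗ c.oneSubT K (n + 1) (w + 1) = c.oneSubT K n w ∘ₗ c.d' K n w)
    (n : ℕ) (x : c.TotX K (n + 1)) : c.mkTot K n (c.bd K n x) =
      tot (fun m w => c.Xbar K m w) (c.bBar K hb) (c.dBar K hd) n (c.mkTot K (n + 1) x) :=
  funext fun w => map_add (c.mkXbar K n w) _ _

lemma exists_of_mkTot_eq_zero {n : ℕ} {x : c.TotX K n} (h : c.mkTot K n x = 0) :
    ∃ y, y - c.tTot K n y = x := by
  choose y hy using fun w => c.exists_of_mkXbar_eq_zero K (congrFun h w)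
  exact ⟨y, funext hy⟩

/-- Exactness of the rows at the two kinds of places, here and in the next lemma, comes from the
homotopies σ' and σ; this is where ℚ ⊆ k enters. -/
lemma exists_of_NTot_eq_zero [Algebra ℚ k] {n : ℕ} {x : c.TotX K n} (h : c.NTot K n x = 0) :
    ∃ y, y - c.tTot K n y = x := by
  refine ⟨fun w => c.sigma' K n w (x w), funext fun w => ?_⟩
  have h1 := LinearMap.congr_fun (c.oneSubT_comp_sigma'_add K n w) (x w)
  have h2 : c.N K n w (x w) = 0 := congrFun h w
  rw [LinearMap.add_apply, LinearMap.comp_apply, LinearMap.comp_apply, h2, map_zero,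
    add_zero] at h1
  exact h1

lemma exists_of_sub_tTot_eq_zero [Algebra ℚ k] {n : ℕ} {x : c.TotX K n} (h : x - c.tTot K n x = 0) :
    ∃ y, c.NTot K n y = x := by
  refine ⟨fun w => c.sigma K n w (x w), funext fun w => ?_⟩
  have h1 := LinearMap.congr_fun (c.N_comp_sigma_add K n w) (x w)
  have h2 : c.oneSubT K n w (x w) = 0 := congrFun h w
  rw [LinearMap.add_apply, LinearMap.comp_apply, LinearMap.comp_apply, h2, map_zero,
    add_zero] at h1
  exact h1

/-! ### Cyclic homology -/

/-- The small mixed subcomplex as a subcomplex of the relative complex. -/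
def smallRel (n : ℕ) : Submodule k (relChain c.p (c.base K) n) :=
  (c.smallChain K n).comap (relChain c.p (c.base K) n).subtype

instance (n : ℕ) : AddCommGroup (c.smallRel K n) := Submodule.addCommGroup (c.smallRel K n)

lemma relHochschild_mem (n : ℕ) (z : relChain c.p (c.base K) (n + 1))
    (hz : z ∈ c.smallRel K (n + 1)) : relHochschild c.p (c.base K) n z ∈ c.smallRel K n :=
  c.hochschild_mem_small K n hz

lemma relConnes_mem (n : ℕ) (z : relChain c.p (c.base K) n)
    (hz : z ∈ c.smallRel K n) : relConnes c.p (c.base K) n z ∈ c.smallRel K (n + 1) :=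
  c.connes_mem_small K n hz

/-- An element of the small subcomplex as a relative chain. -/
def toSmallRel (n : ℕ) (z : Chain (c.base K) n) (hz : z ∈ c.smallChain K n) : c.smallRel K n :=
  ⟨⟨z, c.small_le_rel K n hz⟩, hz⟩

/-- The boundary `b` of the small subcomplex. -/
abbrev smallHochschild (n : ℕ) : c.smallRel K (n + 1) →ₗ[k] c.smallRel K n :=
  (relHochschild c.p (c.base K) n).restrict (c.relHochschild_mem K n)

/-- The operator `B` of the small subcomplex. -/
abbrev smallConnes (n : ℕ) : c.smallRel K n →ₗ[k] c.smallRel K (n + 1) :=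
  (relConnes c.p (c.base K) n).restrict (c.relConnes_mem K n)

lemma nonempty_smallHC_equiv_relHC (n : ℕ) :
    Nonempty (CyclicHomology (fun m => c.smallRel K m) (c.smallHochschild K) (c.smallConnes K) n
      ≃ₗ[k] c.relHC K n) := by
  refine CyclicHomology.nonempty_linearEquiv_of_sub _ _ (isMixedComplex_rel (c.base K) c.p)
    (c.smallRel K) (c.relHochschild_mem K) (c.relConnes_mem K) (fun z => ⟨0, ?_⟩)
    (fun n z hz => ?_) n
  · rw [map_zero, sub_zero]
    exact c.rel_zero_le K z.2
  -- In degree n + 1 the bound n + 2 allows the M-entry to be anywhere in the word, so every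
  -- relative chain is covered.
  · obtain ⟨y, hy, h⟩ := c.exists_sub_mem_small K (n + 1 + 1) (c.rel_le K (n + 1) z.2) z.2 hz
    exact ⟨⟨y, hy⟩, h⟩

/-- The projection of the small subcomplex onto the total complex of `X`. -/
def smallPhi (n : ℕ) : c.smallRel K n →ₗ[k] c.TotX K n :=
  c.Phi K n ∘ₗ (relChain c.p (c.base K) n).subtype ∘ₗ (c.smallRel K n).subtype

lemma smallPhi_apply (n : ℕ) (z : c.smallRel K n) : c.smallPhi K n z = c.Phi K n z.1.1 := rfl

lemma smallPhi_smallHochschild (n : ℕ) (z : c.smallRel K (n + 1)) :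
    c.smallPhi K n (c.smallHochschild K n z) = c.Phi K n (hochschild (c.base K) n z.1.1) := rfl

/-- On incl x + s y the operator B is s N x, because B s = 0; injectivity of s then gives N x = 0.
-/
lemma NTot_smallPhi {n : ℕ} {z : c.smallRel K n} (hz : connes (c.base K) n z.1.1 = 0) :
    c.NTot K n (c.smallPhi K n z) = 0 := by
  refine c.eq_zero_of_s K ?_
  rw [← connes_incl, ← hz, smallPhi_apply]
  have h := z.2
  change z.1.1 ∈ c.smallChain K n at h
  cases n with
  | zero =>
    obtain ⟨x, hx⟩ := h
    rw [← hx, Phi_incl]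
  | succ n =>
    obtain ⟨x, y, e⟩ := c.exists_of_mem_small_succ K h
    rw [← e, map_add, Phi_incl, Phi_s, add_zero, map_add, s, LinearMap.comp_apply, connes_sChain,
      add_zero]

lemma Phi_hochschild (m : ℕ) (x : c.TotX K (m + 1)) (y : c.TotX K m) :
    c.Phi K m (hochschild (c.base K) m (c.incl K (m + 1) x + c.s K m y)) =
      c.bd K m x + (y - c.tTot K m y) := by
  rw [map_add, hochschild_incl, map_add, Phi_incl]
  cases m with
  | zero => rw [hochschild_s_zero, Phi_incl]
  | succ m => rw [hochschild_s, map_sub, Phi_incl, Phi_s, sub_zero]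

/-- Write x = (1 - t)v. The X-component of the boundary becomes (1 - t)(y + (b + d')v), so by
exactness y + (b + d')v = N u. Then ∂(s v) = x - s(b + d')v and B u = s N u add up to the given
element. -/
lemma exists_of_Phi_hochschild [Algebra ℚ k] {m : ℕ} {x : c.TotX K (m + 1)} {y : c.TotX K m}
    (hx : c.mkTot K (m + 1) x = 0)
    (h : c.Phi K m (hochschild (c.base K) m (c.incl K (m + 1) x + c.s K m y)) = 0) :
    ∃ v ∈ c.smallChain K (m + 2), ∃ u ∈ c.smallChain K m, connes (c.base K) (m + 2) v = 0 ∧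
      c.Phi K (m + 2) v = 0 ∧ hochschild (c.base K) (m + 1) v + connes (c.base K) m u =
        c.incl K (m + 1) x + c.s K m y := by
  obtain ⟨v, rfl⟩ := c.exists_of_mkTot_eq_zero K hx
  rw [Phi_hochschild, bd_sub_tTot] at h
  have h1 : (y + c.bd' K m v) - c.tTot K m (y + c.bd' K m v) = 0 := by
    rw [map_add, ← h]
    abel
  obtain ⟨u, hu⟩ := c.exists_of_sub_tTot_eq_zero K h1
  refine ⟨_, c.s_mem_small K (m + 1) v, _, c.incl_mem_small K m u,
    c.connes_sChain K (m + 1) (c.incl K (m + 1) v), c.Phi_s K (m + 1) v, ?_⟩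
  rw [hochschild_s, connes_incl, hu, map_add]
  abel

lemma nonempty_smallHC_equiv [Algebra ℚ k]
    (hb : ∀ n w, c.b K n w ∘ₗ c.oneSubT K (n + 1) w = c.oneSubT K n w ∘ₗ c.b K n w)
    (hd : ∀ n w, c.d K n w ∘ₗ c.oneSubT K (n + 1) (w + 1) = c.oneSubT K n w ∘ₗ c.d' K n w)
    (n : ℕ) :
    Nonempty (CyclicHomology (fun m => c.smallRel K m) (c.smallHochschild K) (c.smallConnes K) n
      ≃ₗ[k] c.homologyXbar K hb hd n) := by
  have hs : ∀ m (y : c.TotX K m), c.smallConnes K (m + 1)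
      (c.toSmallRel K (m + 1) (c.s K m y) (c.s_mem_small K m y)) = 0 := fun m y =>
    Subtype.ext (Subtype.ext (c.connes_sChain K m (c.incl K m y)))
  have hf0 : ∀ m (z : c.smallRel K m), c.Phi K m z.1.1 = 0 →
      (c.mkTot K m ∘ₗ c.smallPhi K m) z = 0 := fun m z h =>
    (congrArg (c.mkTot K m) h).trans (map_zero _)
  -- Here Φ is the projection to X and f its composite with the projection to the cokernel of 1 - t.
  -- Only the finer map Φ can express that 1 - t annihilates y + (b + d')v, which f would not
  -- detect.
  refine CyclicHomology.nonempty_linearEquiv_of_kernel (Z := fun m => c.TotX K m) _ _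
    ((isMixedComplex_rel (c.base K) c.p).restrict (c.smallRel K) (c.relHochschild_mem K)
      (c.relConnes_mem K)) _ (c.smallPhi K) (fun m => c.mkTot K m ∘ₗ c.smallPhi K m)
    (fun m y => ?_) (fun m z => ?_) (fun m z => ?_) (fun m z => ?_) (fun m z hz => ?_)
    (fun z hz => ?_) (fun m z hz hz' => ?_) n
  · obtain ⟨x, rfl⟩ := c.mkTot_surjective K m y
    refine ⟨c.toSmallRel K m (c.incl K m x) (c.incl_mem_small K m x), ?_⟩
    exact congrArg (c.mkTot K m) (c.Phi_incl K m x)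
  · obtain ⟨x, y, e⟩ := c.exists_of_mem_small_succ K z.2
    rw [LinearMap.comp_apply, LinearMap.comp_apply, ← mkTot_bd, ← sub_eq_zero, ← map_sub]
    change c.mkTot K m (c.Phi K m (hochschild (c.base K) m z.1.1) -
      c.bd K m (c.Phi K (m + 1) z.1.1)) = 0
    have e' : z.1.1 = c.incl K (m + 1) x + c.s K m y := e.symm
    rw [e', Phi_hochschild, map_add, Phi_incl, Phi_s, add_zero, add_sub_cancel_left, mkTot_sub_tTot]
  · rw [LinearMap.comp_apply]
    exact (congrArg (c.mkTot K (m + 1)) (c.Phi_connes K m z.1.1)).trans (map_zero _)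
  · exact c.Phi_connes K m z.1.1
  · obtain ⟨y, hy⟩ := c.exists_of_NTot_eq_zero K
      (c.NTot_smallPhi K (congrArg (fun v => v.1.1) hz))
    rw [LinearMap.comp_apply, ← hy, mkTot_sub_tTot]
  · obtain ⟨x, e⟩ := z.2
    have e' : c.incl K 0 x = z.1.1 := e
    have hx : c.mkTot K 0 x = 0 := by
      rw [← hz, LinearMap.comp_apply, smallPhi_apply, ← e', Phi_incl]
    obtain ⟨y, hy⟩ := c.exists_of_mkTot_eq_zero K hx
    refine ⟨_, hs 0 y, hf0 1 _ (c.Phi_s K 0 y), Subtype.ext (Subtype.ext ?_)⟩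
    change hochschild (c.base K) 0 (c.s K 0 y) = z.1.1
    rw [hochschild_s_zero, hy, e']
  · obtain ⟨x, y, e⟩ := c.exists_of_mem_small_succ K z.2
    have e' : c.incl K (m + 1) x + c.s K m y = z.1.1 := e
    have hx : c.mkTot K (m + 1) x = 0 := by
      rw [← hz, LinearMap.comp_apply, smallPhi_apply, ← e', map_add, Phi_incl, Phi_s, add_zero]
    have h1 := (c.smallPhi_smallHochschild K m z).symm.trans hz'
    rw [← e'] at h1
    obtain ⟨v, hv, u, hu, h2, h3, h4⟩ := c.exists_of_Phi_hochschild K hx h1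
    refine ⟨c.toSmallRel K (m + 2) v hv, c.toSmallRel K m u hu, Subtype.ext (Subtype.ext h2), ?_,
      Subtype.ext (Subtype.ext (h4.trans e'))⟩
    exact hf0 (m + 2) _ h3

/-- The relative cyclic homology is the homology of the total complex of `X̄`. -/
theorem nonempty_relHC_equiv [Algebra ℚ k]
    (hb : ∀ n w, c.b K n w ∘ₗ c.oneSubT K (n + 1) w = c.oneSubT K n w ∘ₗ c.b K n w)
    (hd : ∀ n w, c.d K n w ∘ₗ c.oneSubT K (n + 1) (w + 1) = c.oneSubT K n w ∘ₗ c.d' K n w)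
    (n : ℕ) : Nonempty (c.relHC K n ≃ₗ[k] c.homologyXbar K hb hd n) := by
  obtain ⟨e⟩ := c.nonempty_smallHC_equiv_relHC K n
  obtain ⟨e'⟩ := c.nonempty_smallHC_equiv K hb hd n
  exact ⟨e.symm.trans e'⟩

end CleftExt

end CleftHC

end

theorem mainTheorem3 {k A E : Type*} [CommRing k] [Algebra ℚ k] [Ring A] [Algebra k A]
    [Ring E] [Algebra k E] (c : CleftHC.CleftExt k A E) (K : Subalgebra k A) :
    -- the relative normalized complex is a mixed complex
    CleftHC.IsMixedComplex (fun n => CleftHC.relChain c.p (c.base K) n)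
      (CleftHC.relHochschild c.p (c.base K)) (CleftHC.relConnes c.p (c.base K)) ∧
    -- `(X, b, d)` and `(X, -b, -d')` are double complexes
    CleftHC.IsDoubleComplex (fun n w => c.X K n w) (c.b K) (c.d K) ∧
    CleftHC.IsDoubleComplex (fun n w => c.X K n w) (fun n w => -c.b K n w)
      (fun n w => -c.d' K n w) ∧
    -- the rows `⋯ → X → X → X → ⋯` with the maps `1 - t` and `N` are contractible complexes
    (∀ n w, c.oneSubT K n w ∘ₗ c.N K n w = 0 ∧ c.N K n w ∘ₗ c.oneSubT K n w = 0 ∧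
      c.N K n w ∘ₗ c.sigma K n w + c.sigma' K n w ∘ₗ c.oneSubT K n w = LinearMap.id ∧
      c.oneSubT K n w ∘ₗ c.sigma' K n w + c.sigma K n w ∘ₗ c.N K n w = LinearMap.id) ∧
    -- `1 - t` is compatible with the boundaries, and the cokernel computes the cyclic homology
    ∃ (hb : ∀ n w, c.b K n w ∘ₗ c.oneSubT K (n + 1) w = c.oneSubT K n w ∘ₗ c.b K n w)
      (hd : ∀ n w, c.d K n w ∘ₗ c.oneSubT K (n + 1) (w + 1) =
        c.oneSubT K n w ∘ₗ c.d' K n w),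
      CleftHC.IsDoubleComplex (fun n w => c.Xbar K n w) (c.bBar K hb) (c.dBar K hd) ∧
      ∀ n, Nonempty (c.relHC K n ≃ₗ[k] c.homologyXbar K hb hd n) := by
  exact ⟨CleftHC.isMixedComplex_rel (c.base K) c.p, c.isDoubleComplex_X K,
    (c.isDoubleComplex_X' K).neg,
    fun n w => ⟨c.oneSubT_comp_N K n w, c.N_comp_oneSubT K n w, c.N_comp_sigma_add K n w,
      c.oneSubT_comp_sigma'_add K n w⟩,
    c.b_comp_oneSubT K, c.d_comp_oneSubT K,
    c.isDoubleComplex_Xbar K (c.b_comp_oneSubT K) (c.d_comp_oneSubT K),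
    c.nonempty_relHC_equiv K (c.b_comp_oneSubT K) (c.d_comp_oneSubT K)⟩
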